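/- **Setting.** *Multimodal Lambek calculus.* Given a set $P$ of primitive formulas, a set $I$ of modes with subsets $C$ (commutative) and $A$ (associative), and a set $J$ of modalities, formulas are built from $P$ by $\bullet_i,\backslash_i,/_i$ ($i\in I$) and $\Diamond_j,\Box_j$ ($j\in J$). Structured databases are formulas, $(\Pi_1,\Pi_2)^i$, and $\langle\Pi\rangle^j$. Sequents are $\Pi\to T$. The rules are: $T\to T$; from $\Delta[(X,Y)^i]\to Z$ infer $\Delta[X\bullet_iY]\to Z$; from $\Pi_1\to X_1$ and $\Pi_2\to X_2$ infer $(\Pi_1,\Pi_2)^i\to X_1\bullet_iX_2$; from $\Delta[X]\to Z$ and $\Pi\to Y$ infer $\Delta[(\Pi,Y\backslash_iX)^i]\to Z$ and $\Delta[(X/_iY,\Pi)^i]\to Z$; from $(Y,\Pi)^i\to X$ infer $\Pi\to Y\backslash_iX$; from $(\Pi,Y)^i\to X$ infer $\Pi\to X/_iY$; from $\Delta[\langle X\rangle^j]\to Z$ infer $\Delta[\Diamond_jX]\to Z$; from $\Pi\to X$ infer $\langle\Pi\rangle^j\to\Diamond_jX$; from $\Delta[X]\to Z$ infer $\Delta[\langle\Box_jX\rangle^j]\to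 Z$; from $\langle\Pi\rangle^j\to X$ infer $\Pi\to\Box_jX$; for $c\in C$, from $\Delta[(\Pi_1,\Pi_2)^c]\to Z$ infer $\Delta[(\Pi_2,\Pi_1)^c]\to Z$; for $a\in A$, $\Delta[(\Pi_1,(\Pi_2,\Pi_3)^a)^a]\to Z$ and $\Delta[((\Pi_1,\Pi_2)^a,\Pi_3)^a]\to Z$ are inferred from each other. *Hypergraph Lambek calculus $\mathrm{HL}$.* Hypergraphs are finite, have hyperedges $e$ with strings $att(e)$ of attachment nodes, labels of rank $|att(e)|$ from a ranked set, and a string $ext$ of external nodes whose length is the rank of the hypergraph; they are considered up to isomorphism. $G[e_1/H_1,\dots,e_k/H_k]$ is hyperedge replacement (remove each $e_l$, add $H_l$, identify the attachment nodes of $e_l$ with the external nodes of $H_l$ position by position). $a^\bullet$ is the hypergraph with nodes $1,\dots,\mathrm{rk}(a)$, all external in this order, and one hyperedge labeled $a$ attached to them in this order. Let $\mathit{Pr}$ be a ranked set of primitive formulas with infinitely many elements of each rank. Formulas are the elements of $\mathit{Pr}$, the $\times(M)$ for hypergraphs $M$ labeled by formulas ($\mathrm{rk}(\times(M))=\mathrm{rk}(M)$),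 and the $N\div D$ where $N$ is a formula and $D$ is a hypergraph of rank $\mathrm{rk}(N)$ with exactly one hyperedge $e^\$_D$ labeled by a hole $\$_d$ and all others labeled by formulas ($\mathrm{rk}(N\div D)=d$). The rules are: $X^\bullet\to X$; from $H[e/M]\to X$ infer $H[e/\times(M)^\bullet]\to X$; from $H_l\to lab(m_l)$ for all hyperedges $m_1,\dots,m_k$ of $M$ infer $M[m_1/H_1,\dots,m_k/H_k]\to\times(M)$; from $H[e/N^\bullet]\to X$ and $H_l\to lab(d_l)$ for all hyperedges $d_1,\dots,d_k\ne e^\$_D$ of $D$ infer $H[e/D[e^\$_D/(N\div D)^\bullet,d_1/H_1,\dots,d_k/H_k]]\to X$; from $D[e^\$_D/F]\to N$ infer $F\to N\div D$. *Translations.* Modes and modalities are elements of $\mathit{Pr}$, and the primitive formulas $P$ of the multimodal calculus are the elements of $\mathit{Pr}$ of a fixed rank $r$. To each mode $i$ is assigned a hypergraph $G_i(\cdot,\cdot)$ with one hyperedge labeled $i$ and two slots for hyperedges of rank $r$, to each modality $j$ a hypergraph $U_j(\cdot)$ with one hyperedge labeled $j$ and one slot, all of rank $r$. Put $\mu(p)=p$,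 $\mu(X\bullet_iY)=\times(G_i(\mu(X),\mu(Y)))$, $\mu(Y\backslash_iX)=\mu(X)\div G_i(\mu(Y),\$_r)$, $\mu(X/_iY)=\mu(X)\div G_i(\$_r,\mu(Y))$, $\mu(\Diamond_jX)=\times(U_j(\mu(X)))$, $\mu(\Box_jX)=\mu(X)\div U_j(\$_r)$. A structured database is translated by $\tau(X)=\mu(X)^\bullet$, $\tau((\Pi_1,\Pi_2)^i)=G_i$ with its slots replaced by $\tau(\Pi_1),\tau(\Pi_2)$, and $\tau(\langle\Pi\rangle^j)=U_j$ with its slot replaced by $\tau(\Pi)$. We say that $(\tau,\mu)$ *embeds* the calculus in $\mathrm{HL}$ if 1. for all $\Pi,T$: $\Pi\to T$ is derivable if and only if $\mathrm{HL}\vdash\tau(\Pi)\to\mu(T)$; 2. whenever $\mathrm{HL}\vdash G\to X$, where every label of $G$ is a formula $\mu(B)$, a mode or a modality, and $X=\mu(B)$ for some $B$, there are $\Pi,T$ with $G=\tau(\Pi)$, $X=\mu(T)$ and $\Pi\to T$ derivable. **Corollary.** The following calculi are embedded in $\mathrm{HL}$ by the indicated translations, for any choice of the mode and the modality in $\mathit{Pr}$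 with the indicated ranks. * The Lambek calculus with brackets ($I=A=\{o\}$, $C=\emptyset$, $J=\{j\}$), by $\bar\mu$: $r=2$, $\mathrm{rk}(o)=1$, $\mathrm{rk}(j)=4$; $G_o$ has nodes $v_0,v_1,v_2$, slots attached to $v_0v_1$ and $v_1v_2$, the hyperedge $o$ attached to $v_1$, external nodes $v_0v_2$; $U_j$ has nodes $v_0,\dots,v_3$, the hyperedge $j$ attached to $v_0v_1v_2v_3$, the slot attached to $v_2v_3$, external nodes $v_0v_1$. * $\mathrm{NL}$ ($I=\{i\}$, $A=C=J=\emptyset$): $r=1$, $\mathrm{rk}(i)=3$; $G_i$ has nodes $v_0,v_1,v_2$, the hyperedge $i$ attached to $v_0v_1v_2$, slots attached to $v_1$ and $v_2$, external node $v_0$. * $\mathrm{NLP}$ ($I=C=\{c\}$, $A=J=\emptyset$): $r=1$, $\mathrm{rk}(c)=2$; $G_c$ has nodes $v_0,v_1$, the hyperedge $c$ attached to $v_0v_1$, both slots attached to $v_1$, external node $v_0$. * $\mathrm{L}$ ($I=A=\{o\}$, $C=J=\emptyset$): $r=2$, $\mathrm{rk}(o)=1$ and $G_o$ as for the calculus with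 brackets. * $\mathrm{LP}$ ($I=A=C=\{o\}$, $J=\emptyset$): $r=1$, $\mathrm{rk}(o)=2$; $G_o$ has nodes $v_0,v_1$, the hyperedge $o$ attached to $v_0v_1$, both slots attached to $v_1$, external node $v_1$. -/

import Mathlib

universe u v

/-! ## The multimodal Lambek calculus -/

namespace NLM

/-- Formulas built from primitive formulas `P`, binary modes `I` and modalities `J`. -/
inductive Form (P I J : Type*) where
  | prim (p : P)
  /-- the product `A •ᵢ B` -/
  | prod (i : I) (A B : Form P I J)
  /-- the left division `B \ᵢ A` -/
  | under (i : I) (B A : Form P I J)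
  /-- the right division `A /ᵢ B` -/
  | over (i : I) (A B : Form P I J)
  | dia (j : J) (A : Form P I J)
  | box (j : J) (A : Form P I J)

/-- Structured databases: a formula, `(Π₁, Π₂)ⁱ`, or `⟨Π⟩ʲ`. -/
inductive Struct (P I J : Type*) where
  | form (A : Form P I J)
  | pair (i : I) (S T : Struct P I J)
  | brac (j : J) (S : Struct P I J)

/-- Structured databases `Δ[ ]` with one distinguished occurrence of a substructure. -/
inductive Ctx (P I J : Type*) where
  | here
  | pairL (i : I) (D : Ctx P I J) (S : Struct P I J)
  | pairR (i : I) (S : Struct P I J) (D : Ctx P I J)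
  | brac (j : J) (D : Ctx P I J)

/-- `D.plug S` is `Δ[S]`. -/
def Ctx.plug {P I J : Type*} : Ctx P I J → Struct P I J → Struct P I J
  | .here, S => S
  | .pairL i D T, S => .pair i (D.plug S) T
  | .pairR i T D, S => .pair i T (D.plug S)
  | .brac j D, S => .brac j (D.plug S)

/-- Derivability in the multimodal Lambek calculus whose commutative modes are those in `C` and
whose associative modes are those in `A`. -/
inductive Derivable {P I J : Type*} (C A : Set I) : Struct P I J → Form P I J → Prop
  | ax (X : Form P I J) : Derivable C A (.form X) X
  | prodL (i : I) (D : Ctx P I J) (X Y Z : Form P I J) :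
      Derivable C A (D.plug (.pair i (.form X) (.form Y))) Z →
      Derivable C A (D.plug (.form (.prod i X Y))) Z
  | prodR (i : I) (S T : Struct P I J) (X Y : Form P I J) :
      Derivable C A S X → Derivable C A T Y →
      Derivable C A (.pair i S T) (.prod i X Y)
  | underL (i : I) (D : Ctx P I J) (S : Struct P I J) (X Y Z : Form P I J) :
      Derivable C A (D.plug (.form X)) Z → Derivable C A S Y →
      Derivable C A (D.plug (.pair i S (.form (.under i Y X)))) Z
  | underR (i : I) (S : Struct P I J) (X Y : Form P I J) :
      Derivable C A (.pair i (.form Y) S) X →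
      Derivable C A S (.under i Y X)
  | overL (i : I) (D : Ctx P I J) (S : Struct P I J) (X Y Z : Form P I J) :
      Derivable C A (D.plug (.form X)) Z → Derivable C A S Y →
      Derivable C A (D.plug (.pair i (.form (.over i X Y)) S)) Z
  | overR (i : I) (S : Struct P I J) (X Y : Form P I J) :
      Derivable C A (.pair i S (.form Y)) X →
      Derivable C A S (.over i X Y)
  | diaL (j : J) (D : Ctx P I J) (X Z : Form P I J) :
      Derivable C A (D.plug (.brac j (.form X))) Z →
      Derivable C A (D.plug (.form (.dia j X))) Z
  | diaR (j : J) (S : Struct P I J) (X : Form P I J) :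
      Derivable C A S X → Derivable C A (.brac j S) (.dia j X)
  | boxL (j : J) (D : Ctx P I J) (X Z : Form P I J) :
      Derivable C A (D.plug (.form X)) Z →
      Derivable C A (D.plug (.brac j (.form (.box j X)))) Z
  | boxR (j : J) (S : Struct P I J) (X : Form P I J) :
      Derivable C A (.brac j S) X → Derivable C A S (.box j X)
  | comm (c : I) (hc : c ∈ C) (D : Ctx P I J) (S T : Struct P I J) (Z : Form P I J) :
      Derivable C A (D.plug (.pair c S T)) Z →
      Derivable C A (D.plug (.pair c T S)) Z
  | assocL (a : I) (ha : a ∈ A) (D : Ctx P I J) (S T U : Struct P I J) (Z : Form P I J) :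
      Derivable C A (D.plug (.pair a S (.pair a T U))) Z →
      Derivable C A (D.plug (.pair a (.pair a S T) U)) Z
  | assocR (a : I) (ha : a ∈ A) (D : Ctx P I J) (S T U : Struct P I J) (Z : Form P I J) :
      Derivable C A (D.plug (.pair a (.pair a S T) U)) Z →
      Derivable C A (D.plug (.pair a S (.pair a T U))) Z

end NLM

/-! ## Hypergraphs and hyperedge replacement -/

namespace HL

/-- Finite hypergraphs whose hyperedges are labeled by elements of the ranked set `(L, rk)`. -/
structure Hypergraph (L : Type v) (rk : L → ℕ) where
  /-- nodes -/
  V : Type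
  /-- hyperedges -/
  E : Type
  finV : Finite V
  finE : Finite E
  /-- attachment nodes -/
  att : E → List V
  /-- labels -/
  lab : E → L
  /-- external nodes -/
  ext : List V
  rk_lab : ∀ e, rk (lab e) = (att e).length

attribute [instance] Hypergraph.finV Hypergraph.finE

/-- Hypergraphs which, besides the hyperedges in `E` labeled by elements of `L`, have one further
hyperedge for every `s : S`, with attachment nodes `hole s`; the latter hyperedges are those
that are going to be replaced, and the label of such a hyperedge is just its rank: it is
`$ₙ` for `n = (hole s).length`. -/
structure Context (L : Type v) (rk : L → ℕ) (S : Type) extends Hypergraph L rk where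
  hole : S → List V

section
variable {L : Type v} {rk : L → ℕ} {S : Type}

/-- Isomorphism of hypergraphs. -/
def Iso (G H : Hypergraph L rk) : Prop :=
  ∃ (f : G.V ≃ H.V) (g : G.E ≃ H.E), (∀ e, H.att (g e) = (G.att e).map f) ∧
    (∀ e, H.lab (g e) = G.lab e) ∧ H.ext = G.ext.map f

/-- The handle `a•`. -/
def handle (a : L) : Hypergraph L rk where
  V := Fin (rk a)
  E := Unit
  finV := inferInstance
  finE := inferInstance
  att _ := List.finRange (rk a)
  lab _ := a
  ext := List.finRange (rk a)
  rk_lab _ := by simp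

/-- The identifications made when the hyperedge at `hole s` is replaced by `H s`, for all `s`:
the `k`-th attachment node of the hyperedge is identified with the `k`-th external node
of the hypergraph that replaces it. -/
inductive Context.Glue (C : Context L rk S) (H : S → Hypergraph L rk) :
    C.V ⊕ (Σ s, (H s).V) → C.V ⊕ (Σ s, (H s).V) → Prop
  | glue (s : S) (v : C.V) (w : (H s).V) (h : (v, w) ∈ (C.hole s).zip (H s).ext) :
      Context.Glue C H (.inl v) (.inr ⟨s, w⟩)

/-- Simultaneous replacement of the hyperedges at `hole s` by the hypergraphs `H s`. It is
meaningful if `(C.hole s).length = (H s).ext.length` for all `s`.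
`Quot` is the quotient by the least equivalence relation containing the given relation. -/
def Context.fill [Finite S] (C : Context L rk S) (H : S → Hypergraph L rk) :
    Hypergraph L rk where
  V := Quot (C.Glue H)
  E := C.E ⊕ (Σ s, (H s).E)
  finV := inferInstance
  finE := inferInstance
  att
    | .inl e => (C.att e).map fun v => Quot.mk _ (.inl v)
    | .inr ⟨s, e⟩ => ((H s).att e).map fun v => Quot.mk _ (.inr ⟨s, v⟩)
  lab
    | .inl e => C.lab e
    | .inr ⟨s, e⟩ => (H s).lab e
  ext := C.ext.map fun v => Quot.mk _ (.inl v)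
  rk_lab
    | .inl e => by simpa using C.rk_lab e
    | .inr ⟨s, e⟩ => by simpa using (H s).rk_lab e

/-- `M` prepared for the replacement of all of its hyperedges. -/
def Hypergraph.frame (M : Hypergraph L rk) : Context L rk M.E where
  V := M.V
  E := Empty
  finV := M.finV
  finE := inferInstance
  att e := e.elim
  lab e := e.elim
  ext := M.ext
  rk_lab e := e.elim
  hole := M.att

/-- `D`, a hypergraph with one hyperedge `e$` labeled by some `$ₙ`, prepared for the replacement
of all of its hyperedges; `none` stands for `e$`. -/
def Context.frame (D : Context L rk Unit) : Context L rk (Option D.E) where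
  V := D.V
  E := Empty
  finV := D.finV
  finE := inferInstance
  att e := e.elim
  lab e := e.elim
  ext := D.ext
  rk_lab e := e.elim
  hole
    | none => D.hole ()
    | some e => D.att e

/-- The hypergraph obtained from `C` by labeling the hyperedge at `hole s` by `B s`, for all `s`. -/
def Context.label [Finite S] (C : Context L rk S) (B : S → L)
    (hB : ∀ s, rk (B s) = (C.hole s).length) : Hypergraph L rk where
  V := C.V
  E := C.E ⊕ S
  finV := C.finV
  finE := inferInstance
  att
    | .inl e => C.att e
    | .inr s => C.hole s
  lab
    | .inl e => C.lab e
    | .inr s => B s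
  ext := C.ext
  rk_lab
    | .inl e => C.rk_lab e
    | .inr s => hB s

/-- Label the hyperedge at `hole t` by `B`, for all `t ≠ s`, and keep the one at `hole s`. -/
def Context.labelExcept [Finite S] (C : Context L rk S) (s : S) (B : L)
    (hB : ∀ t, rk B = (C.hole t).length) : Context L rk Unit where
  V := C.V
  E := C.E ⊕ {t // t ≠ s}
  finV := C.finV
  finE := inferInstance
  att
    | .inl e => C.att e
    | .inr t => C.hole t
  lab
    | .inl e => C.lab e
    | .inr _ => B
  ext := C.ext
  rk_lab
    | .inl e => C.rk_lab e
    | .inr t => hB t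
  hole _ := C.hole s

end

/-! ## Formulas of the hypergraph Lambek calculus -/

/-- Formulas before ranks are checked and isomorphic hypergraphs are identified. -/
inductive PreFormula (Pr : Type u) : Type (max u 1) where
  | prim (p : Pr)
  | times (V E : Type) (finV : Finite V) (finE : Finite E) (att : E → List V)
      (lab : E → PreFormula Pr) (ext : List V)
  | div (N : PreFormula Pr) (V E : Type) (finV : Finite V) (finE : Finite E) (att : E → List V)
      (lab : E → PreFormula Pr) (ext hole : List V)

namespace PreFormula
variable {Pr : Type u} (rk : Pr → ℕ)

/-- The rank. -/
def rank : PreFormula Pr → ℕ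
  | prim p => rk p
  | times _ _ _ _ _ _ ext => ext.length
  | div _ _ _ _ _ _ _ _ hole => hole.length

/-- The rank conditions hold everywhere in the formula. -/
def WF : PreFormula Pr → Prop
  | prim _ => True
  | times _ _ _ _ att lab _ => ∀ e, (lab e).WF ∧ (lab e).rank rk = (att e).length
  | div N _ _ _ _ att lab ext _ => N.WF ∧ N.rank rk = ext.length ∧
      ∀ e, (lab e).WF ∧ (lab e).rank rk = (att e).length

/-- Identity of formulas when hypergraphs are considered up to isomorphism. -/
inductive Equiv : PreFormula Pr → PreFormula Pr → Prop
  | prim (p : Pr) : Equiv (prim p) (prim p)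
  | times {V E : Type} {finV : Finite V} {finE : Finite E} {att : E → List V}
      {lab : E → PreFormula Pr} {ext : List V}
      {V' E' : Type} {finV' : Finite V'} {finE' : Finite E'} {att' : E' → List V'}
      {lab' : E' → PreFormula Pr} {ext' : List V'} (f : V ≃ V') (g : E ≃ E')
      (hatt : ∀ e, att' (g e) = (att e).map f) (hext : ext' = ext.map f)
      (hlab : ∀ e, Equiv (lab e) (lab' (g e))) :
      Equiv (times V E finV finE att lab ext) (times V' E' finV' finE' att' lab' ext')
  | div {N N' : PreFormula Pr}
      {V E : Type} {finV : Finite V} {finE : Finite E} {att : E → List V}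
      {lab : E → PreFormula Pr} {ext hole : List V}
      {V' E' : Type} {finV' : Finite V'} {finE' : Finite E'} {att' : E' → List V'}
      {lab' : E' → PreFormula Pr} {ext' hole' : List V'} (f : V ≃ V') (g : E ≃ E')
      (hN : Equiv N N')
      (hatt : ∀ e, att' (g e) = (att e).map f) (hext : ext' = ext.map f)
      (hhole : hole' = hole.map f)
      (hlab : ∀ e, Equiv (lab e) (lab' (g e))) :
      Equiv (div N V E finV finE att lab ext hole) (div N' V' E' finV' finE' att' lab' ext' hole')

variable {rk}

theorem Equiv.refl (A : PreFormula Pr) : Equiv A A := by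
  induction A with
  | prim p => exact .prim p
  | times V E _ _ att lab ext ih => exact .times (.refl V) (.refl E) (by simp) (by simp) ih
  | div N V E _ _ att lab ext hole ihN ih =>
    exact .div (.refl V) (.refl E) ihN (by simp) (by simp) (by simp) ih

theorem Equiv.symm {A B : PreFormula Pr} (h : Equiv A B) : Equiv B A := by
  induction h with
  | prim p => exact .prim p
  | times f g hatt hext _ ih =>
    refine .times f.symm g.symm (fun e => ?_) (by simp [hext]) (fun e => ?_)
    · have := hatt (g.symm e); simp_all
    · simpa using ih (g.symm e)
  | div f g _ hatt hext hhole _ ihN ih =>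
    refine .div f.symm g.symm ihN (fun e => ?_) (by simp [hext]) (by simp [hhole]) (fun e => ?_)
    · have := hatt (g.symm e); simp_all
    · simpa using ih (g.symm e)

theorem Equiv.trans {A B C : PreFormula Pr} (h : Equiv A B) (h' : Equiv B C) : Equiv A C := by
  induction h generalizing C with
  | prim p => exact h'
  | times f g hatt hext _ ih =>
    cases h' with
    | times f' g' hatt' hext' hlab' =>
      exact .times (f.trans f') (g.trans g') (fun e => by simp [hatt', hatt])
        (by simp [hext, hext']) (fun e => ih e (hlab' (g e)))
  | div f g _ hatt hext hhole _ ihN ih =>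
    cases h' with
    | div f' g' hN' hatt' hext' hhole' hlab' =>
      exact .div (f.trans f') (g.trans g') (ihN hN') (fun e => by simp [hatt', hatt])
        (by simp [hext, hext']) (by simp [hhole, hhole']) (fun e => ih e (hlab' (g e)))

theorem Equiv.rank_eq {A B : PreFormula Pr} (h : Equiv A B) : A.rank rk = B.rank rk := by
  cases h with
  | prim p => rfl
  | times f g hatt hext hlab => simp [rank, hext]
  | div f g hN hatt hext hhole hlab => simp [rank, hhole]

/-- Well-ranked formulas modulo isomorphism of hypergraphs. -/
instance setoid (rk : Pr → ℕ) : Setoid {A : PreFormula Pr // A.WF rk} where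
  r A B := Equiv A.1 B.1
  iseqv := ⟨fun A => Equiv.refl A.1, fun h => h.symm, fun h h' => h.trans h'⟩

end PreFormula

/-- Formulas of the hypergraph Lambek calculus over the ranked set `(Pr, rk)` of primitive
formulas. -/
def Formula {Pr : Type u} (rk : Pr → ℕ) : Type (max u 1) :=
  Quotient (PreFormula.setoid rk)

namespace Formula
variable {Pr : Type u} {rk : Pr → ℕ}

/-- The rank of a formula. -/
def rank : Formula rk → ℕ :=
  Quotient.lift (fun A => A.1.rank rk) fun _ _ h => PreFormula.Equiv.rank_eq h

theorem rank_out (A : Formula rk) : (Quotient.out A).1.rank rk = A.rank := by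
  conv_rhs => rw [← Quotient.out_eq A]
  rfl

/-- Primitive formulas. -/
def prim (p : Pr) : Formula rk := Quotient.mk _ ⟨.prim p, trivial⟩

theorem rank_prim (p : Pr) : (prim p : Formula rk).rank = rk p := rfl

/-- The formula `×(M)`. -/
noncomputable def times (M : Hypergraph (Formula rk) rank) : Formula rk :=
  Quotient.mk _ ⟨.times M.V M.E M.finV M.finE M.att (fun e => (Quotient.out (M.lab e)).1) M.ext,
    fun e => ⟨(Quotient.out (M.lab e)).2, (rank_out _).trans (M.rk_lab e)⟩⟩

theorem rank_times (M : Hypergraph (Formula rk) rank) : (times M).rank = M.ext.length := rfl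

/-- The formula `N ÷ D`. -/
noncomputable def div (N : Formula rk) (D : Context (Formula rk) rank Unit)
    (h : N.rank = D.ext.length) : Formula rk :=
  Quotient.mk _ ⟨.div (Quotient.out N).1 D.V D.E D.finV D.finE D.att
      (fun e => (Quotient.out (D.lab e)).1) D.ext (D.hole ()),
    (Quotient.out N).2, (rank_out _).trans h,
    fun e => ⟨(Quotient.out (D.lab e)).2, (rank_out _).trans (D.rk_lab e)⟩⟩

theorem rank_div (N : Formula rk) (D : Context (Formula rk) rank Unit)
    (h : N.rank = D.ext.length) : (div N D h).rank = (D.hole ()).length := rfl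

/-- `×(M)` depends precisely on the isomorphism class of `M`. -/
theorem times_eq_times_iff (M M' : Hypergraph (Formula rk) rank) :
    times M = times M' ↔ Iso M M' := by
  constructor
  · intro h
    have h' := Quotient.exact h
    obtain _ | ⟨f, g, hatt, hext, hlab⟩ | _ := (h' : PreFormula.Equiv _ _)
    exact ⟨f, g, hatt, fun e => (Quotient.out_equiv_out.1 (hlab e)).symm, hext⟩
  · rintro ⟨f, g, hatt, hlab, hext⟩
    refine Quotient.sound (PreFormula.Equiv.times f g hatt hext fun e => ?_)
    rw [hlab]
    exact PreFormula.Equiv.refl _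

/-- `N ÷ D` depends precisely on `N` and the isomorphism class of `D`. -/
theorem div_eq_div_iff (N N' : Formula rk) (D D' : Context (Formula rk) rank Unit)
    (h : N.rank = D.ext.length) (h' : N'.rank = D'.ext.length) :
    div N D h = div N' D' h' ↔ N = N' ∧ ∃ (f : D.V ≃ D'.V) (g : D.E ≃ D'.E),
      (∀ e, D'.att (g e) = (D.att e).map f) ∧ (∀ e, D'.lab (g e) = D.lab e) ∧
      D'.ext = D.ext.map f ∧ D'.hole () = (D.hole ()).map f := by
  constructor
  · intro h
    have h' := Quotient.exact h
    obtain _ | _ | ⟨f, g, hN, hatt, hext, hhole, hlab⟩ := (h' : PreFormula.Equiv _ _)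
    exact ⟨Quotient.out_equiv_out.1 hN, f, g, hatt,
      fun e => (Quotient.out_equiv_out.1 (hlab e)).symm, hext, hhole⟩
  · rintro ⟨rfl, f, g, hatt, hlab, hext, hhole⟩
    refine Quotient.sound
      (PreFormula.Equiv.div f g (PreFormula.Equiv.refl _) hatt hext hhole fun e => ?_)
    rw [hlab]
    exact PreFormula.Equiv.refl _

end Formula

/-! ## The hypergraph Lambek calculus -/

section
variable {Pr : Type u} {rk : Pr → ℕ}

/-- Hypergraphs labeled by formulas. -/
abbrev Graph (rk : Pr → ℕ) := Hypergraph (Formula rk) Formula.rank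

/-- Hypergraphs labeled by formulas, with further distinguished hyperedges. -/
abbrev GraphContext (rk : Pr → ℕ) (S : Type) := Context (Formula rk) Formula.rank S

/-- Derivability of the sequent `G → A` in the hypergraph Lambek calculus. A hypergraph `H` with
a distinguished hyperedge `e` whose label does not matter is given as a context `C`, and then
`H[e/F]` is `C.fill fun _ => F`. The last clause says that antecedents are considered up to
isomorphism. -/
inductive Derivable : Graph rk → Formula rk → Prop
  | ax (A : Formula rk) : Derivable (handle A) A
  | timesL (C : GraphContext rk Unit) (M : Graph rk) (A : Formula rk)
      (hC : (C.hole ()).length = M.ext.length) :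
      Derivable (C.fill fun _ => M) A →
      Derivable (C.fill fun _ => handle (Formula.times M)) A
  | timesR (M : Graph rk) (H : M.E → Graph rk) :
      (∀ m, Derivable (H m) (M.lab m)) →
      Derivable (M.frame.fill H) (Formula.times M)
  | divL (C : GraphContext rk Unit) (N : Formula rk) (D : GraphContext rk Unit)
      (hD : N.rank = D.ext.length) (H : D.E → Graph rk) (A : Formula rk)
      (hC : (C.hole ()).length = N.rank) :
      Derivable (C.fill fun _ => handle N) A →
      (∀ d, Derivable (H d) (D.lab d)) →
      Derivable (C.fill fun _ => D.frame.fill fun o =>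
        o.elim (handle (Formula.div N D hD)) H) A
  | divR (N : Formula rk) (D : GraphContext rk Unit) (hD : N.rank = D.ext.length)
      (F : Graph rk) (hF : (D.hole ()).length = F.ext.length) :
      Derivable (D.fill fun _ => F) N →
      Derivable F (Formula.div N D hD)
  | iso (G G' : Graph rk) (A : Formula rk) : Iso G G' → Derivable G A → Derivable G' A

/-! ## Translations -/

/-- A choice of primitive formulas for the modes and the modalities, of hypergraphs with two
free hyperedges (the first one `0` and the second one `1`) for the modes, and of hypergraphs
with one free hyperedge for the modalities. Formulas are going to be translated into formulas of
rank `r`. -/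
structure Shapes (rk : Pr → ℕ) (I J : Type) (r : ℕ) where
  mode : I → Pr
  modality : J → Pr
  bin : I → GraphContext rk (Fin 2)
  un : J → GraphContext rk Unit
  bin_ext : ∀ i, (bin i).ext.length = r
  bin_hole : ∀ i s, ((bin i).hole s).length = r
  un_ext : ∀ j, (un j).ext.length = r
  un_hole : ∀ j s, ((un j).hole s).length = r

namespace Shapes
variable {I J : Type} {r : ℕ}

/-- The translation of formulas. The primitive formulas of the multimodal calculus are the
elements of `Pr` of rank `r`. With `R = σ.bin i` and `U = σ.un j`, it sends
`A • B` to `×(R(A, B))`, `B \ A` to `A ÷ R(B, $)`, `A / B` to `A ÷ R($, B)`,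
`◇A` to `×(U(A))` and `□A` to `A ÷ U($)`. -/
noncomputable def mu (σ : Shapes rk I J r) :
    NLM.Form {p : Pr // rk p = r} I J → {X : Formula rk // X.rank = r}
  | .prim p => ⟨.prim p.1, p.2⟩
  | .prod i A B =>
      ⟨.times ((σ.bin i).label ![(σ.mu A).1, (σ.mu B).1] fun s => by
        rw [σ.bin_hole]; fin_cases s; exacts [(σ.mu A).2, (σ.mu B).2]), σ.bin_ext i⟩
  | .under i B A =>
      ⟨.div (σ.mu A).1 ((σ.bin i).labelExcept 1 (σ.mu B).1
          fun t => (σ.mu B).2.trans (σ.bin_hole i t).symm)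
        ((σ.mu A).2.trans (σ.bin_ext i).symm), σ.bin_hole i 1⟩
  | .over i A B =>
      ⟨.div (σ.mu A).1 ((σ.bin i).labelExcept 0 (σ.mu B).1
          fun t => (σ.mu B).2.trans (σ.bin_hole i t).symm)
        ((σ.mu A).2.trans (σ.bin_ext i).symm), σ.bin_hole i 0⟩
  | .dia j A =>
      ⟨.times ((σ.un j).label (fun _ => (σ.mu A).1)
        fun s => (σ.mu A).2.trans (σ.un_hole j s).symm), σ.un_ext j⟩
  | .box j A =>
      ⟨.div (σ.mu A).1 (σ.un j) ((σ.mu A).2.trans (σ.un_ext j).symm), σ.un_hole j ()⟩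

/-- The translation of structured databases into hypergraphs. -/
noncomputable def tree (σ : Shapes rk I J r) :
    NLM.Struct {p : Pr // rk p = r} I J → Graph rk
  | .form A => handle (σ.mu A).1
  | .pair i S T => (σ.bin i).fill ![σ.tree S, σ.tree T]
  | .brac j S => (σ.un j).fill fun _ => σ.tree S

/-- The translations embed the multimodal Lambek calculus with commutative modes `C` and
associative modes `A` in the hypergraph Lambek calculus: derivability is preserved and
reflected, and every derivable sequent whose antecedent is labeled by translated formulas, modes
and modalities and whose succedent is a translated formula is the translation of a derivable
sequent. -/
def Embeds (σ : Shapes rk I J r) (C A : Set I) : Prop :=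
  (∀ S T, NLM.Derivable C A S T ↔ Derivable (σ.tree S) (σ.mu T).1) ∧
  ∀ (G : Graph rk) (X : Formula rk),
    (∀ e, (∃ B, G.lab e = (σ.mu B).1) ∨ (∃ i, G.lab e = .prim (σ.mode i)) ∨
      ∃ j, G.lab e = .prim (σ.modality j)) →
    (∃ B, X = (σ.mu B).1) → Derivable G X →
    ∃ S T, Iso G (σ.tree S) ∧ X = (σ.mu T).1 ∧ NLM.Derivable C A S T

end Shapes

/-! ## The shapes of modes and modalities -/

/-- Nodes `Fin n`, one hyperedge labeled by the primitive formula `p`, and free hyperedges. -/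
def mkShape {S : Type} (n : ℕ) (p : Pr) (att ext : List (Fin n)) (hole : S → List (Fin n))
    (h : rk p = att.length) : GraphContext rk S where
  V := Fin n
  E := Unit
  finV := inferInstance
  finE := inferInstance
  att _ := att
  lab _ := .prim p
  ext := ext
  rk_lab _ := h
  hole := hole

/-- A non-associative, non-commutative mode: `i` is attached to `0, 1, 2`, the free hyperedges
are attached to `1` and to `2`, and `0` is external. -/
def shapeR (i : Pr) (hi : rk i = 3) : GraphContext rk (Fin 2) :=
  mkShape 3 i [0, 1, 2] [0] ![[1], [2]] hi

/-- A non-associative, commutative mode: `c` is attached to `0, 1`, both free hyperedges are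
attached to `1`, and `0` is external. -/
def shapeK (c : Pr) (hc : rk c = 2) : GraphContext rk (Fin 2) :=
  mkShape 2 c [0, 1] [0] ![[1], [1]] hc

/-- An associative and commutative mode: `o` is attached to `0, 1`, both free hyperedges are
attached to `1`, and `1` is external. -/
def shapeKO (o : Pr) (ho : rk o = 2) : GraphContext rk (Fin 2) :=
  mkShape 2 o [0, 1] [1] ![[1], [1]] ho

/-- An associative, non-commutative mode: the free hyperedges go from `0` to `1` and from `1` to
`2`, the node `1` between them carries `o`, and `0, 2` are external. -/
def shapeRO (o : Pr) (ho : rk o = 1) : GraphContext rk (Fin 2) :=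
  mkShape 3 o [1] [0, 2] ![[0, 1], [1, 2]] ho

/-- A modality: `j` is attached to `0, 1, 2, 3`, the free hyperedge goes from `2` to `3`,
and `0, 1` are external. -/
def shapeU (j : Pr) (hj : rk j = 4) : GraphContext rk Unit :=
  mkShape 4 j [0, 1, 2, 3] [0, 1] (fun _ => [2, 3]) hj

/-- The translation of a calculus with one mode of the shape `R` and no modalities. -/
def shapesNL (i : Pr) (hi : rk i = 3) : Shapes rk Unit Empty 1 where
  mode _ := i
  modality := Empty.elim
  bin _ := shapeR i hi
  un := fun j => j.elim
  bin_ext _ := rfl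
  bin_hole _ s := by fin_cases s <;> rfl
  un_ext j := j.elim
  un_hole j := j.elim

/-- The translation of a calculus with one mode of the shape `K` and no modalities. -/
def shapesNLP (c : Pr) (hc : rk c = 2) : Shapes rk Unit Empty 1 where
  mode _ := c
  modality := Empty.elim
  bin _ := shapeK c hc
  un := fun j => j.elim
  bin_ext _ := rfl
  bin_hole _ s := by fin_cases s <;> rfl
  un_ext j := j.elim
  un_hole j := j.elim

/-- The translation of a calculus with one mode of the shape `KO` and no modalities. -/
def shapesLP (o : Pr) (ho : rk o = 2) : Shapes rk Unit Empty 1 where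
  mode _ := o
  modality := Empty.elim
  bin _ := shapeKO o ho
  un := fun j => j.elim
  bin_ext _ := rfl
  bin_hole _ s := by fin_cases s <;> rfl
  un_ext j := j.elim
  un_hole j := j.elim

/-- The translation of a calculus with one mode of the shape `RO` and no modalities. -/
def shapesL (o : Pr) (ho : rk o = 1) : Shapes rk Unit Empty 2 where
  mode _ := o
  modality := Empty.elim
  bin _ := shapeRO o ho
  un := fun j => j.elim
  bin_ext _ := rfl
  bin_hole _ s := by fin_cases s <;> rfl
  un_ext j := j.elim
  un_hole j := j.elim

/-- The translation of a calculus with one mode of the shape `RO` and one modality of the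
shape `U`. -/
def shapesBrackets (o j : Pr) (ho : rk o = 1) (hj : rk j = 4) : Shapes rk Unit Unit 2 where
  mode _ := o
  modality _ := j
  bin _ := shapeRO o ho
  un _ := shapeU j hj
  bin_ext _ := rfl
  bin_hole _ s := by fin_cases s <;> rfl
  un_ext _ := rfl
  un_hole _ _ := rfl

end

end HL

/-! All five embeddings follow from one criterion, `Shapes.embeds_of_decomposable`, which reduces an
embedding to the combinatorics of the shapes.

Replacement produces quotients of node sets, which are awkward to compare. Translations are
therefore recognized from inside a fixed hypergraph `G`: `Shapes.Rep` says which hyperedges, inner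
nodes and external nodes of `G` form a copy of a structured database. It does not ask the pieces to
be disjoint; that is automatic once they add up to all hyperedges and all inner nodes of `G`,
because these multisets have no repetitions. The version for the whole of `G`, `Shapes.FullRep`,
amounts to `G` being isomorphic to the translation (`Shapes.fullRep_tree`, `Shapes.FullRep.iso`,
`Shapes.FullRep.of_iso`).

Preservation of derivability (`Shapes.derivable_of_derivable`) simulates each logical rule by a rule
for × or ÷. The structural rules need no simulation, since the databases they exchange have
isomorphic translations.

Reflection (`Shapes.reflects_of_derivable`) is an induction on derivations in the hypergraph
calculus. There is no cut rule, so all labels stay among translated formulas, modes and modalities.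
The invariant `Shapes.Reflects` says that the antecedent represents some database from which the
succedent is derivable; for a mode or a modality as succedent it says that the antecedent is a
handle, so that mode hyperedges survive replacement unchanged. The obstacle is that the database
supplied by the induction hypothesis need not display the substructure on which the rule acts.
`Shapes.Decomposable` removes it: hyperedges that look like one constructor can be split off as a
substructure, and two databases represented by one hypergraph are related by `Shapes.StructEq`. That
relation consists of the structural rules and the exchange of formulas with the same translation.
The exchange cannot be avoided, since for a commutative mode a product and its mirror image, or a
left and a right division, are translated to the same formula. It is harmless by an induction on
derivations, `Shapes.derivable_of_leafEq`.

It remains to see that each shape is decomposable. For `NL`, every node is the first attachment node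
of exactly one hyperedge, so the tree can be read off from the root. For `NLP`, every inner node is
the first node of exactly two hyperedges, so it can be read off up to exchanging arguments. For
`LP`, all formulas sit at one node and each mode has a pendant inner node of its own, so only the
multiset of leaves is visible (`rep_shapesLP_iff`). For `L` and the calculus with brackets, formulas
and brackets form directed paths, in which each hyperedge is determined by a node where it starts or
ends (`Threaded`); a path forgets precisely the way in which it is associated. -/

/-- `s` contains every element exactly once. -/
def Multiset.Full {α : Type*} (s : Multiset α) : Prop := s.Nodup ∧ ∀ a, a ∈ s

/-! ### Auxiliary facts on multisets and zipped lists -/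

namespace Multiset

theorem exists_map_eq {α β : Type*} {f : α → β} {t : Multiset β} (h : ∀ b ∈ t, ∃ a, f a = b) :
    ∃ s : Multiset α, s.map f = t := by
  choose g hg using h
  refine ⟨t.pmap g fun _ hb => hb, ?_⟩
  rw [map_pmap]
  simp only [hg, pmap_eq_map, map_id']

theorem Full.map_equiv {α β : Type*} {s : Multiset α} (h : s.Full) (g : α ≃ β) :
    (s.map g).Full :=
  ⟨h.1.map g.injective, fun b => mem_map.2 ⟨g.symm b, h.2 _, by simp⟩⟩

theorem Full.nodup_bind {α β : Type*} {s : Multiset α} {f : α → Multiset β} (hs : s.Nodup)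
    (h1 : ∀ a, (f a).Nodup) (h2 : ∀ a a' b, b ∈ f a → b ∈ f a' → a = a') : (s.bind f).Nodup := by
  rw [Multiset.nodup_bind]
  refine ⟨fun a _ => h1 a, ?_⟩
  refine Multiset.Nodup.pairwise ?_ hs
  intro a _ a' _ hne
  exact Multiset.disjoint_left.2 fun hb hb' => hne (h2 a a' _ hb hb')

end Multiset

namespace List

theorem exists_map_eq {α β : Type*} {f : α → β} {t : List β} (h : ∀ b ∈ t, ∃ a, f a = b) :
    ∃ s : List α, s.map f = t := by
  choose g hg using h
  refine ⟨t.pmap g fun _ hb => hb, ?_⟩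
  rw [map_pmap]
  simp [hg]

theorem exists_mem_zip_of_mem_right {α β : Type*} {l : List α} {l' : List β}
    (h : l.length = l'.length) {w : β} (hw : w ∈ l') : ∃ v, (v, w) ∈ l.zip l' := by
  have : w ∈ (l.zip l').map Prod.snd := by rw [map_snd_zip h.ge]; exact hw
  obtain ⟨⟨v, w'⟩, hv, rfl⟩ := mem_map.1 this
  exact ⟨v, hv⟩

theorem left_unique_of_mem_zip {α β : Type*} {l : List α} {l' : List β} (hl : l'.Nodup)
    {v v' : α} {w : β} (h : (v, w) ∈ l.zip l') (h' : (v', w) ∈ l.zip l') : v = v' := by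
  obtain ⟨i, hi, e⟩ := getElem_of_mem h
  obtain ⟨j, hj, e'⟩ := getElem_of_mem h'
  simp only [getElem_zip, Prod.mk.injEq] at e e'
  have : i = j := by
    simp only [length_zip, lt_inf_iff] at hi hj
    exact (hl.getElem_inj_iff (hi := hi.2) (hj := hj.2)).1 (e.2.trans e'.2.symm)
  subst this
  exact e.1.symm.trans e'.1

theorem right_unique_of_mem_zip {α β : Type*} {l : List α} {l' : List β} (hl : l.Nodup)
    {v : α} {w w' : β} (h : (v, w) ∈ l.zip l') (h' : (v, w') ∈ l.zip l') : w = w' := by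
  obtain ⟨i, hi, e⟩ := getElem_of_mem h
  obtain ⟨j, hj, e'⟩ := getElem_of_mem h'
  simp only [getElem_zip, Prod.mk.injEq] at e e'
  have : i = j := by
    simp only [length_zip, lt_inf_iff] at hi hj
    exact (hl.getElem_inj_iff (hi := hi.1) (hj := hj.1)).1 (e.1.trans e'.1.symm)
  subst this
  exact e.2.symm.trans e'.2

end List

namespace HL

/-! ## Nodes and hyperedges of hypergraphs obtained by replacement -/

section
variable {L : Type v} {rk : L → ℕ} {S : Type}

/-- All hyperedges. -/
noncomputable def Hypergraph.edges (G : Hypergraph L rk) : Multiset G.E :=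
  (Set.finite_univ (α := G.E)).toFinset.val

/-- All nodes that are not external. -/
noncomputable def Hypergraph.inner (G : Hypergraph L rk) : Multiset G.V :=
  (Set.toFinite {v | v ∉ G.ext}).toFinset.val

namespace Hypergraph
variable (G : Hypergraph L rk)

theorem edges_full : G.edges.Full := ⟨Finset.nodup _, fun e => by simp [edges]⟩

theorem mem_edges (e : G.E) : e ∈ G.edges := G.edges_full.2 e

theorem nodup_inner : G.inner.Nodup := Finset.nodup _

@[simp] theorem mem_inner (v : G.V) : v ∈ G.inner ↔ v ∉ G.ext := by simp [inner]

variable {G}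

theorem edges_eq {s : Multiset G.E} (h : s.Full) : G.edges = s :=
  (Multiset.Nodup.ext G.edges_full.1 h.1).2 fun e => by simp [h.2 e, G.mem_edges e]

theorem inner_eq {s : Multiset G.V} (h : s.Nodup) (h' : ∀ v, v ∈ s ↔ v ∉ G.ext) : G.inner = s :=
  (Multiset.Nodup.ext G.nodup_inner h).2 fun v => by simp [h' v]

theorem edges_map_equiv {H : Hypergraph L rk} (g : G.E ≃ H.E) : H.edges = G.edges.map g :=
  edges_eq (G.edges_full.map_equiv g)

theorem inner_map_equiv {H : Hypergraph L rk} (f : G.V ≃ H.V) (h : H.ext = G.ext.map f) :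
    H.inner = G.inner.map f :=
  inner_eq (G.nodup_inner.map f.injective) fun v => by
    obtain ⟨w, rfl⟩ := f.surjective v
    simp [h]

theorem nodup_inner_add_ext (h : G.ext.Nodup) : (G.inner + (G.ext : Multiset G.V)).Nodup := by
  rw [Multiset.nodup_add]
  exact ⟨G.nodup_inner, by simpa using h, Multiset.disjoint_left.2 fun hv => by simpa using hv⟩

end Hypergraph

namespace Context
variable [Finite S] (C : Context L rk S) (H : S → Hypergraph L rk)

/-- The node of `C[H]` given by a node of `C`. -/
def outer (v : C.V) : (C.fill H).V := Quot.mk _ (.inl v)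

/-- The node of `C[H]` given by a node of `H s`. -/
def inserted (s : S) (w : (H s).V) : (C.fill H).V := Quot.mk _ (.inr ⟨s, w⟩)

theorem node_cases (x : (C.fill H).V) :
    (∃ v, C.outer H v = x) ∨ ∃ s w, C.inserted H s w = x := by
  induction x using Quot.ind with
  | mk x => rcases x with v | ⟨s, w⟩
            exacts [.inl ⟨v, rfl⟩, .inr ⟨s, w, rfl⟩]

variable {C H}

theorem outer_eq_inserted {s : S} {v : C.V} {w : (H s).V}
    (h : (v, w) ∈ (C.hole s).zip (H s).ext) : C.outer H v = C.inserted H s w :=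
  Quot.sound (.glue s v w h)

theorem map_hole {s : S} (h : (C.hole s).length = (H s).ext.length) :
    (C.hole s).map (C.outer H) = (H s).ext.map (C.inserted H s) := by
  refine List.ext_getElem (by simpa using h) fun i h1 h2 => ?_
  simp only [List.length_map] at h1 h2
  simp only [List.getElem_map]
  exact outer_eq_inserted (List.mem_iff_getElem.2 ⟨i, by simp [h1, h2], by simp⟩)

variable (C H) in
open Classical in
/-- Replace an external node of `H s` by the corresponding attachment node of the hole. -/
noncomputable def toOuter : C.V ⊕ (Σ s, (H s).V) → C.V ⊕ (Σ s, (H s).V)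
  | .inl v => .inl v
  | .inr ⟨s, w⟩ => if h : ∃ v, (v, w) ∈ (C.hole s).zip (H s).ext then .inl h.choose
      else .inr ⟨s, w⟩

omit [Finite S] in
-- A normal form for the quotient. Each identification joins a node of `C` to an external node of
-- some `H s`; as external nodes are not repeated, the node of `C` is determined, so the choice in
-- `toOuter` is forced and the map is constant on classes. Equalities in the quotient thus become
-- equalities of normal forms.
theorem toOuter_eq (hH : ∀ s, (H s).ext.Nodup) {x y : C.V ⊕ (Σ s, (H s).V)}
    (h : Quot.mk (C.Glue H) x = Quot.mk _ y) : C.toOuter H x = C.toOuter H y := by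
  refine congrArg (Quot.lift (C.toOuter H) ?_) h
  rintro _ _ ⟨s, v, w, h⟩
  have h' : ∃ v, (v, w) ∈ (C.hole s).zip (H s).ext := ⟨v, h⟩
  simp only [toOuter, h', dite_true, Sum.inl.injEq]
  exact List.left_unique_of_mem_zip (hH s) h h'.choose_spec

theorem outer_injective (hH : ∀ s, (H s).ext.Nodup) : Function.Injective (C.outer H) :=
  fun v v' h => by simpa [toOuter] using toOuter_eq hH h

theorem inserted_inj (hH : ∀ s, (H s).ext.Nodup) {s s' : S} {w : (H s).V} {w' : (H s').V}
    (hw : w ∉ (H s).ext) (hw' : w' ∉ (H s').ext)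
    (h : C.inserted H s w = C.inserted H s' w') : (⟨s, w⟩ : Σ s, (H s).V) = ⟨s', w'⟩ := by
  have h1 : ¬ ∃ v, (v, w) ∈ (C.hole s).zip (H s).ext := fun ⟨v, hv⟩ => hw (List.of_mem_zip hv).2
  have h2 : ¬ ∃ v, (v, w') ∈ (C.hole s').zip (H s').ext :=
    fun ⟨v, hv⟩ => hw' (List.of_mem_zip hv).2
  simpa only [toOuter, h1, h2, dite_false, Sum.inr.injEq] using toOuter_eq hH h

theorem outer_ne_inserted (hH : ∀ s, (H s).ext.Nodup) {s : S} {v : C.V} {w : (H s).V}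
    (hw : w ∉ (H s).ext) : C.outer H v ≠ C.inserted H s w := by
  intro h
  have h1 : ¬ ∃ v, (v, w) ∈ (C.hole s).zip (H s).ext := fun ⟨v, hv⟩ => hw (List.of_mem_zip hv).2
  simpa [toOuter, h1] using toOuter_eq hH h

variable (C H) in
/-- The hyperedges of `C[H]` that come from a hyperedge of `C` or from a hypergraph `H s`. -/
noncomputable def slotEdges : C.E ⊕ S → Multiset (C.fill H).E
  | .inl e => {.inl e}
  | .inr s => (H s).edges.map fun e => .inr ⟨s, e⟩

variable (C H) in
/-- The inner nodes of `C[H]` that come from a hyperedge of `C` or from a hypergraph `H s`. -/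
noncomputable def slotInner : C.E ⊕ S → Multiset (C.fill H).V
  | .inl _ => 0
  | .inr s => (H s).inner.map (C.inserted H s)

theorem edges_fill {ts : Multiset (C.E ⊕ S)} (hts : ts.Full) :
    (C.fill H).edges = ts.bind (C.slotEdges H) := by
  refine Hypergraph.edges_eq ⟨Multiset.Full.nodup_bind hts.1 ?_ ?_, ?_⟩
  · rintro (e | s)
    · exact Multiset.nodup_singleton _
    · exact (H s).edges_full.1.map fun e e' h => by
        simpa using (Sum.inr.inj h)
  · rintro (e | s) (e' | s') b h h'
    · obtain rfl := Multiset.mem_singleton.1 h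
      exact congrArg Sum.inl (Sum.inl.inj (Multiset.mem_singleton.1 h'))
    · obtain ⟨_, _, rfl⟩ := Multiset.mem_map.1 h'
      cases Multiset.mem_singleton.1 h
    · obtain ⟨_, _, rfl⟩ := Multiset.mem_map.1 h
      cases Multiset.mem_singleton.1 h'
    · obtain ⟨_, _, rfl⟩ := Multiset.mem_map.1 h
      obtain ⟨_, _, h'⟩ := Multiset.mem_map.1 h'
      have := Sigma.mk.inj_iff.1 (Sum.inr.inj h')
      rw [this.1]
  · rintro (e | ⟨s, e⟩)
    · exact Multiset.mem_bind.2 ⟨.inl e, hts.2 _, Multiset.mem_singleton_self _⟩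
    · exact Multiset.mem_bind.2 ⟨.inr s, hts.2 _, Multiset.mem_map_of_mem _ ((H s).mem_edges e)⟩

theorem nodup_ext_fill (hH : ∀ s, (H s).ext.Nodup) (hC : C.ext.Nodup) : (C.fill H).ext.Nodup :=
  hC.map (outer_injective hH)

/-- The external nodes of an inserted hypergraph are absorbed by the attachment nodes of its hole.
This leaves the nodes of `C`, kept apart by `outer_injective`, and the inner nodes of each `H s`,
which are identified with nothing. -/
theorem inner_fill (hH : ∀ s, (H s).ext.Nodup)
    (hl : ∀ s, (C.hole s).length = (H s).ext.length) {ts : Multiset (C.E ⊕ S)} (hts : ts.Full) :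
    (C.fill H).inner = C.inner.map (C.outer H) + ts.bind (C.slotInner H) := by
  have key : ∀ v t, C.outer H v ∉ C.slotInner H t := by
    rintro v (e | s) h
    · simp [slotInner] at h
    · obtain ⟨w, hw, h⟩ := Multiset.mem_map.1 h
      exact outer_ne_inserted hH ((H s).mem_inner w |>.1 hw) h.symm
  have hext : (C.fill H).ext = C.ext.map (C.outer H) := rfl
  refine Hypergraph.inner_eq ?_ fun x => ?_
  · rw [Multiset.nodup_add]
    refine ⟨C.nodup_inner.map (outer_injective hH), Multiset.Full.nodup_bind hts.1 ?_ ?_, ?_⟩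
    · rintro (e | s)
      · exact Multiset.nodup_zero
      · refine ((Multiset.nodup_map_iff_inj_on (H s).nodup_inner).2 ?_)
        intro w hw w' hw' h
        simpa using inserted_inj hH ((H s).mem_inner w |>.1 hw) ((H s).mem_inner w' |>.1 hw') h
    · rintro (e | s) (e' | s') b h h' <;> simp only [slotInner, Multiset.notMem_zero,
        Multiset.mem_map] at h h'
      obtain ⟨w, hw, rfl⟩ := h
      obtain ⟨w', hw', h'⟩ := h'
      have := inserted_inj hH ((H s').mem_inner w' |>.1 hw') ((H s).mem_inner w |>.1 hw) h'
      rw [(Sigma.mk.inj_iff.1 this).1]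
    · refine Multiset.disjoint_left.2 fun hx hx' => ?_
      obtain ⟨v, _, rfl⟩ := Multiset.mem_map.1 hx
      obtain ⟨t, _, ht⟩ := Multiset.mem_bind.1 hx'
      exact key v t ht
  · have houter : ∀ v, C.outer H v ∈ C.inner.map (C.outer H) + ts.bind (C.slotInner H) ↔
        C.outer H v ∉ (C.fill H).ext := by
      intro v
      have h1 : C.outer H v ∉ ts.bind (C.slotInner H) := fun h => by
        obtain ⟨t, _, ht⟩ := Multiset.mem_bind.1 h
        exact key v t ht
      rw [Multiset.mem_add, or_iff_left h1, hext,
        Multiset.mem_map_of_injective (outer_injective hH),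
        List.mem_map_of_injective (outer_injective hH), Hypergraph.mem_inner]
    obtain ⟨v, rfl⟩ | ⟨s, w, rfl⟩ := C.node_cases H x
    · exact houter v
    -- An external node of `H s` is also a node of `C`, the case already settled; the equality of
    -- lengths ensures that it has a partner in the hole.
    · by_cases hw : w ∈ (H s).ext
      · obtain ⟨v, hv⟩ := List.exists_mem_zip_of_mem_right (hl s) hw
        rw [← outer_eq_inserted hv]
        exact houter v
      · refine iff_of_true (Multiset.mem_add.2 (.inr (Multiset.mem_bind.2
          ⟨.inr s, hts.2 _, Multiset.mem_map_of_mem _ ((H s).mem_inner w |>.2 hw)⟩))) ?_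
        rw [hext]
        intro h
        obtain ⟨v, _, h⟩ := List.mem_map.1 h
        exact outer_ne_inserted hH hw h

end Context

namespace Context
variable (D : Context L rk Unit) (F : Hypergraph L rk)

open Classical in
/-- Replace an attachment node of the hole by the corresponding external node of `F`. -/
noncomputable def toInserted : D.V ⊕ (Σ _ : Unit, F.V) → D.V ⊕ (Σ _ : Unit, F.V)
  | .inr w => .inr w
  | .inl v => if h : ∃ w, (v, w) ∈ (D.hole ()).zip F.ext then .inr ⟨(), h.choose⟩ else .inl v

variable {D F}

/-- The mirror image of `toOuter_eq`: if the hole has no repeated attachment node, the node of `F`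
glued to a node of `D` is unique, so the nodes of `F` are kept apart. -/
theorem toInserted_eq (hD : (D.hole ()).Nodup) {x y : D.V ⊕ (Σ _ : Unit, F.V)}
    (h : Quot.mk (D.Glue fun _ => F) x = Quot.mk _ y) : D.toInserted F x = D.toInserted F y := by
  refine congrArg (Quot.lift (D.toInserted F) ?_) h
  rintro _ _ ⟨s, v, w, h⟩
  have h' : ∃ w, (v, w) ∈ (D.hole ()).zip F.ext := ⟨w, h⟩
  simp only [toInserted, h', dite_true, Sum.inr.injEq, Sigma.mk.injEq, true_and, heq_eq_eq]
  exact List.right_unique_of_mem_zip hD h'.choose_spec h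

theorem inserted_injective (hD : (D.hole ()).Nodup) :
    Function.Injective (D.inserted (fun _ => F) ()) :=
  fun v v' h => by simpa [toInserted] using toInserted_eq hD h

theorem mem_ext_of_inserted_eq_outer (hD : (D.hole ()).Nodup) {w : F.V} {v : D.V}
    (h : D.inserted (fun _ => F) () w = D.outer _ v) : w ∈ F.ext := by
  have h' := toInserted_eq hD h
  simp only [toInserted] at h'
  split_ifs at h' with h1
  have : w = h1.choose := by simpa using h'
  rw [this]
  exact (List.of_mem_zip h1.choose_spec).2

end Context
end
end HL

/-! ### Composition of contexts -/

namespace NLM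
variable {P I J : Type*}

/-- `(D.comp D')[S] = D[D'[S]]`. -/
def Ctx.comp : Ctx P I J → Ctx P I J → Ctx P I J
  | .here, D' => D'
  | .pairL i D S, D' => .pairL i (D.comp D') S
  | .pairR i S D, D' => .pairR i S (D.comp D')
  | .brac j D, D' => .brac j (D.comp D')

theorem Ctx.plug_comp (D D' : Ctx P I J) (S : Struct P I J) :
    (D.comp D').plug S = D.plug (D'.plug S) := by
  induction D <;> simp_all [comp, plug]

end NLM

namespace HL
open NLM (Struct Form Ctx)

/-! ## Representations of structured databases inside a hypergraph -/

section
variable {Pr : Type u} {rk : Pr → ℕ} {I J : Type} {r : ℕ}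

/-- The hyperedge `m` looks like the hyperedges of `K`, the nodes of `K` being placed by `η`. -/
def Places {S : Type} (K : GraphContext rk S) (G : Graph rk) (η : K.V → G.V) (m : G.E) : Prop :=
  ∀ e : K.E, G.lab m = K.lab e ∧ G.att m = (K.att e).map η

/-- `f` and `g` form a morphism of hypergraphs which need not preserve external nodes. -/
def IsHom (G G' : Graph rk) (f : G.V → G'.V) (g : G.E → G'.E) : Prop :=
  ∀ e, G'.lab (g e) = G.lab e ∧ G'.att (g e) = (G.att e).map f

theorem Places.map {S : Type} {K : GraphContext rk S} {G G' : Graph rk} {f : G.V → G'.V}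
    {g : G.E → G'.E} (hfg : IsHom G G' f g) {η : K.V → G.V} {m : G.E} (h : Places K G η m) :
    Places K G' (f ∘ η) (g m) :=
  fun e => ⟨(hfg m).1.trans (h e).1, by rw [(hfg m).2, (h e).2, List.map_map]⟩

theorem Places.comap {S : Type} {K : GraphContext rk S} {G G' : Graph rk} {f : G.V → G'.V}
    {g : G.E → G'.E} (hfg : IsHom G G' f g) (hf : Function.Injective f) {η : K.V → G.V} {m : G.E}
    (h : Places K G' (f ∘ η) (g m)) : Places K G η m :=
  fun e => ⟨(hfg m).1.symm.trans (h e).1, hf.list_map (by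
    rw [← (hfg m).2, (h e).2, List.map_map])⟩

/-- The context consists of one hyperedge labeled by `p` and free hyperedges without repeated
nodes, and every node is external or attached to the hyperedge. -/
structure Pattern {S : Type} (K : GraphContext rk S) (p : Pr) : Prop where
  edge : ∃ e : K.E, (∀ e', e' = e) ∧ K.lab e = .prim p
  cover : ∀ v, v ∈ K.ext ∨ ∃ e, v ∈ K.att e
  ext_nodup : K.ext.Nodup
  hole_nodup : ∀ s, (K.hole s).Nodup

namespace Shapes
variable (σ : Shapes rk I J r) (G : Graph rk)

/-- The part of `G` with hyperedges `es`, inner nodes `vs` and external nodes `x` is, up to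
isomorphism, the translation of the structured database. -/
def Rep : Struct {p : Pr // rk p = r} I J → Multiset G.E → Multiset G.V → List G.V → Prop
  | .form A, es, vs, x => ∃ e, G.lab e = (σ.mu A).1 ∧ G.att e = x ∧ es = {e} ∧ vs = 0
  | .pair i S T, es, vs, x => ∃ m η es₁ vs₁ es₂ vs₂, Places (σ.bin i) G η m ∧
      Rep S es₁ vs₁ (((σ.bin i).hole 0).map η) ∧ Rep T es₂ vs₂ (((σ.bin i).hole 1).map η) ∧
      x = (σ.bin i).ext.map η ∧ es = {m} + es₁ + es₂ ∧ vs = (σ.bin i).inner.map η + vs₁ + vs₂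
  | .brac j S, es, vs, x => ∃ m η es₁ vs₁, Places (σ.un j) G η m ∧
      Rep S es₁ vs₁ (((σ.un j).hole ()).map η) ∧
      x = (σ.un j).ext.map η ∧ es = {m} + es₁ ∧ vs = (σ.un j).inner.map η + vs₁

/-- `Rep` where moreover `m` is the hyperedge of the outermost constructor. -/
def RepTop : Struct {p : Pr // rk p = r} I J → G.E → Multiset G.E → Multiset G.V →
    List G.V → Prop
  | .form A, m, es, vs, x => G.lab m = (σ.mu A).1 ∧ G.att m = x ∧ es = {m} ∧ vs = 0
  | .pair i S T, m, es, vs, x => ∃ η es₁ vs₁ es₂ vs₂, Places (σ.bin i) G η m ∧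
      σ.Rep G S es₁ vs₁ (((σ.bin i).hole 0).map η) ∧
      σ.Rep G T es₂ vs₂ (((σ.bin i).hole 1).map η) ∧
      x = (σ.bin i).ext.map η ∧ es = {m} + es₁ + es₂ ∧ vs = (σ.bin i).inner.map η + vs₁ + vs₂
  | .brac j S, m, es, vs, x => ∃ η es₁ vs₁, Places (σ.un j) G η m ∧
      σ.Rep G S es₁ vs₁ (((σ.un j).hole ()).map η) ∧
      x = (σ.un j).ext.map η ∧ es = {m} + es₁ ∧ vs = (σ.un j).inner.map η + vs₁

/-- The part of `G` with hyperedges `es`, inner nodes `vs`, external nodes `x` and a hole attached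
to `y` is the translation of the structured database with a hole. -/
def RepCtx : Ctx {p : Pr // rk p = r} I J → Multiset G.E → Multiset G.V → List G.V →
    List G.V → Prop
  | .here, es, vs, x, y => es = 0 ∧ vs = 0 ∧ x = y
  | .pairL i D T, es, vs, x, y => ∃ m η es₁ vs₁ es₂ vs₂, Places (σ.bin i) G η m ∧
      RepCtx D es₁ vs₁ (((σ.bin i).hole 0).map η) y ∧
      σ.Rep G T es₂ vs₂ (((σ.bin i).hole 1).map η) ∧
      x = (σ.bin i).ext.map η ∧ es = {m} + es₁ + es₂ ∧ vs = (σ.bin i).inner.map η + vs₁ + vs₂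
  | .pairR i S D, es, vs, x, y => ∃ m η es₁ vs₁ es₂ vs₂, Places (σ.bin i) G η m ∧
      σ.Rep G S es₁ vs₁ (((σ.bin i).hole 0).map η) ∧
      RepCtx D es₂ vs₂ (((σ.bin i).hole 1).map η) y ∧
      x = (σ.bin i).ext.map η ∧ es = {m} + es₁ + es₂ ∧ vs = (σ.bin i).inner.map η + vs₁ + vs₂
  | .brac j D, es, vs, x, y => ∃ m η es₁ vs₁, Places (σ.un j) G η m ∧
      RepCtx D es₁ vs₁ (((σ.un j).hole ()).map η) y ∧
      x = (σ.un j).ext.map η ∧ es = {m} + es₁ ∧ vs = (σ.un j).inner.map η + vs₁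

/-- `G` is, up to isomorphism, the translation of the structured database. -/
def FullRep (Q : Struct {p : Pr // rk p = r} I J) : Prop :=
  G.ext.Nodup ∧ σ.Rep G Q G.edges G.inner G.ext

/-- `K` is, up to isomorphism, the translation of the structured database with a hole. -/
def FullCtx (K : GraphContext rk Unit) (D : Ctx {p : Pr // rk p = r} I J) : Prop :=
  K.ext.Nodup ∧ σ.RepCtx K.toHypergraph D K.edges K.inner K.ext (K.hole ())

variable {σ G}

theorem rep_iff_top {Q : Struct {p : Pr // rk p = r} I J} {es : Multiset G.E} {vs : Multiset G.V}
    {x : List G.V} : σ.Rep G Q es vs x ↔ ∃ m, σ.RepTop G Q m es vs x := by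
  cases Q <;> rfl

theorem RepTop.mem {Q : Struct {p : Pr // rk p = r} I J} {m : G.E} {es : Multiset G.E}
    {vs : Multiset G.V} {x : List G.V} (h : σ.RepTop G Q m es vs x) : m ∈ es := by
  cases Q with
  | form A => obtain ⟨_, _, rfl, _⟩ := h; simp
  | pair i S T => obtain ⟨_, _, _, _, _, _, _, _, _, rfl, _⟩ := h; simp
  | brac j S => obtain ⟨_, _, _, _, _, _, rfl, _⟩ := h; simp

theorem RepTop.rep {Q : Struct {p : Pr // rk p = r} I J} {m : G.E} {es : Multiset G.E}
    {vs : Multiset G.V} {x : List G.V} (h : σ.RepTop G Q m es vs x) : σ.Rep G Q es vs x :=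
  rep_iff_top.2 ⟨m, h⟩

theorem Rep.length {Q : Struct {p : Pr // rk p = r} I J} {es : Multiset G.E} {vs : Multiset G.V}
    {x : List G.V} (h : σ.Rep G Q es vs x) : x.length = r := by
  cases Q with
  | form A =>
    obtain ⟨e, h1, rfl, _⟩ := h
    rw [← G.rk_lab, h1, (σ.mu A).2]
  | pair i S T =>
    obtain ⟨_, _, _, _, _, _, _, _, _, rfl, _⟩ := h
    simp [σ.bin_ext]
  | brac j S =>
    obtain ⟨_, _, _, _, _, _, rfl, _⟩ := h
    simp [σ.un_ext]

theorem FullRep.length {Q : Struct {p : Pr // rk p = r} I J} (h : σ.FullRep G Q) :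
    G.ext.length = r := h.2.length

/-! ### Morphisms -/

section hom
variable {G' : Graph rk} {f : G.V → G'.V} {g : G.E → G'.E}

/-- `Rep` mentions only labels, attachments and sums of multisets, and no distinctness. Hence it is
transported by every morphism, injective or not. -/
theorem Rep.map (hfg : IsHom G G' f g) {Q : Struct {p : Pr // rk p = r} I J} {es : Multiset G.E}
    {vs : Multiset G.V} {x : List G.V} (h : σ.Rep G Q es vs x) :
    σ.Rep G' Q (es.map g) (vs.map f) (x.map f) := by
  induction Q generalizing es vs x with
  | form A =>
    obtain ⟨e, h1, rfl, rfl, rfl⟩ := h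
    exact ⟨g e, (hfg e).1.trans h1, (hfg e).2, by simp, by simp⟩
  | pair i S T ihS ihT =>
    obtain ⟨m, η, es₁, vs₁, es₂, vs₂, h1, h2, h3, rfl, rfl, rfl⟩ := h
    exact ⟨g m, f ∘ η, _, _, _, _, h1.map hfg, by simpa using ihS h2, by simpa using ihT h3,
      by simp, by simp, by simp⟩
  | brac j S ihS =>
    obtain ⟨m, η, es₁, vs₁, h1, h2, rfl, rfl, rfl⟩ := h
    exact ⟨g m, f ∘ η, _, _, h1.map hfg, by simpa using ihS h2,
      by simp, by simp, by simp⟩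

theorem RepCtx.map (hfg : IsHom G G' f g) {D : Ctx {p : Pr // rk p = r} I J} {es : Multiset G.E}
    {vs : Multiset G.V} {x y : List G.V} (h : σ.RepCtx G D es vs x y) :
    σ.RepCtx G' D (es.map g) (vs.map f) (x.map f) (y.map f) := by
  induction D generalizing es vs x with
  | here =>
    obtain ⟨rfl, rfl, rfl⟩ := h
    exact ⟨by simp, by simp, rfl⟩
  | pairL i D T ih =>
    obtain ⟨m, η, es₁, vs₁, es₂, vs₂, h1, h2, h3, rfl, rfl, rfl⟩ := h
    exact ⟨g m, f ∘ η, _, _, _, _, h1.map hfg, by simpa using ih h2, by simpa using h3.map hfg,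
      by simp, by simp, by simp⟩
  | pairR i T D ih =>
    obtain ⟨m, η, es₁, vs₁, es₂, vs₂, h1, h2, h3, rfl, rfl, rfl⟩ := h
    exact ⟨g m, f ∘ η, _, _, _, _, h1.map hfg, by simpa using h2.map hfg, by simpa using ih h3,
      by simp, by simp, by simp⟩
  | brac j D ih =>
    obtain ⟨m, η, es₁, vs₁, h1, h2, rfl, rfl, rfl⟩ := h
    exact ⟨g m, f ∘ η, _, _, h1.map hfg, by simpa using ih h2,
      by simp, by simp, by simp⟩

/-- Every node of `K` is inner or external, so these two conditions cover all values of `η`. -/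
theorem exists_lift {S : Type} {K : GraphContext rk S} {η : K.V → G'.V}
    (h1 : ∀ v ∈ K.inner.map η, v ∈ Set.range f) (h2 : ∀ v ∈ K.ext.map η, v ∈ Set.range f) :
    ∃ η₀, η = f ∘ η₀ := by
  have : ∀ v, ∃ w, f w = η v := fun v => by
    by_cases hv : v ∈ K.ext
    · exact h2 _ (List.mem_map_of_mem hv)
    · exact h1 _ (Multiset.mem_map_of_mem _ (K.mem_inner v |>.2 hv))
  choose η₀ h using this
  exact ⟨η₀, funext fun v => (h v).symm⟩

/-- Used to cut a representation in a composed hypergraph back to one of its components. The range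
condition on external nodes is needed only at the root: the external nodes of an argument are values
of the lifted placement. -/
theorem Rep.comap (hfg : IsHom G G' f g) (hf : Function.Injective f)
    {Q : Struct {p : Pr // rk p = r} I J} {es : Multiset G'.E} {vs : Multiset G'.V}
    {x : List G'.V} (h : σ.Rep G' Q es vs x) (hes : ∀ e ∈ es, e ∈ Set.range g)
    (hvs : ∀ v ∈ vs, v ∈ Set.range f) (hx : ∀ v ∈ x, v ∈ Set.range f) :
    ∃ es₀ vs₀ x₀, es₀.map g = es ∧ vs₀.map f = vs ∧ x₀.map f = x ∧ σ.Rep G Q es₀ vs₀ x₀ := by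
  induction Q generalizing es vs x with
  | form A =>
    obtain ⟨e, h1, rfl, rfl, rfl⟩ := h
    obtain ⟨e, rfl⟩ := hes e (by simp)
    exact ⟨{e}, 0, G.att e, by simp, by simp, ((hfg e).2).symm, e, (hfg e).1.symm.trans h1, rfl,
      rfl, rfl⟩
  | pair i S T ihS ihT =>
    obtain ⟨m, η, es₁, vs₁, es₂, vs₂, h1, h2, h3, rfl, rfl, rfl⟩ := h
    simp only [Multiset.mem_add, Multiset.mem_singleton] at hes hvs
    obtain ⟨η, rfl⟩ := exists_lift (fun v hv => hvs v (.inl (.inl hv))) hx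
    obtain ⟨m, rfl⟩ := hes _ (.inl (.inl rfl))
    obtain ⟨es₁, vs₁, x₁, rfl, rfl, hx₁, h2⟩ := ihS h2 (fun v hv => hes v (.inl (.inr hv)))
      (fun v hv => hvs v (.inl (.inr hv))) (by simp)
    obtain ⟨es₂, vs₂, x₂, rfl, rfl, hx₂, h3⟩ := ihT h3 (fun v hv => hes v (.inr hv))
      (fun v hv => hvs v (.inr hv)) (by simp)
    rw [← List.map_map] at hx₁ hx₂
    obtain rfl := hf.list_map hx₁
    obtain rfl := hf.list_map hx₂
    exact ⟨{m} + es₁ + es₂, (σ.bin i).inner.map η + vs₁ + vs₂, (σ.bin i).ext.map η, by simp,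
      by simp, by simp, m, η, es₁, vs₁, es₂, vs₂, h1.comap hfg hf, h2, h3, rfl, rfl, rfl⟩
  | brac j S ihS =>
    obtain ⟨m, η, es₁, vs₁, h1, h2, rfl, rfl, rfl⟩ := h
    simp only [Multiset.mem_add, Multiset.mem_singleton] at hes hvs
    obtain ⟨η, rfl⟩ := exists_lift (fun v hv => hvs v (.inl hv)) hx
    obtain ⟨m, rfl⟩ := hes _ (.inl rfl)
    obtain ⟨es₁, vs₁, x₁, rfl, rfl, hx₁, h2⟩ := ihS h2 (fun v hv => hes v (.inr hv))
      (fun v hv => hvs v (.inr hv)) (by simp)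
    rw [← List.map_map] at hx₁
    obtain rfl := hf.list_map hx₁
    exact ⟨{m} + es₁, (σ.un j).inner.map η + vs₁, (σ.un j).ext.map η, by simp,
      by simp, by simp, m, η, es₁, vs₁, h1.comap hfg hf, h2, rfl, rfl, rfl⟩

theorem RepCtx.comap (hfg : IsHom G G' f g) (hf : Function.Injective f)
    {D : Ctx {p : Pr // rk p = r} I J} {es : Multiset G'.E} {vs : Multiset G'.V}
    {x y : List G'.V} (h : σ.RepCtx G' D es vs x y) (hes : ∀ e ∈ es, e ∈ Set.range g)
    (hvs : ∀ v ∈ vs, v ∈ Set.range f) (hx : ∀ v ∈ x, v ∈ Set.range f) :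
    ∃ es₀ vs₀ x₀ y₀, es₀.map g = es ∧ vs₀.map f = vs ∧ x₀.map f = x ∧ y₀.map f = y ∧
      σ.RepCtx G D es₀ vs₀ x₀ y₀ := by
  induction D generalizing es vs x with
  | here =>
    obtain ⟨rfl, rfl, rfl⟩ := h
    obtain ⟨x, rfl⟩ := List.exists_map_eq hx
    exact ⟨0, 0, x, x, by simp, by simp, rfl, rfl, rfl, rfl, rfl⟩
  | pairL i D T ih =>
    obtain ⟨m, η, es₁, vs₁, es₂, vs₂, h1, h2, h3, rfl, rfl, rfl⟩ := h
    simp only [Multiset.mem_add, Multiset.mem_singleton] at hes hvs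
    obtain ⟨η, rfl⟩ := exists_lift (fun v hv => hvs v (.inl (.inl hv))) hx
    obtain ⟨m, rfl⟩ := hes _ (.inl (.inl rfl))
    obtain ⟨es₁, vs₁, x₁, y, rfl, rfl, hx₁, rfl, h2⟩ := ih h2 (fun v hv => hes v (.inl (.inr hv)))
      (fun v hv => hvs v (.inl (.inr hv))) (by simp)
    obtain ⟨es₂, vs₂, x₂, rfl, rfl, hx₂, h3⟩ := h3.comap hfg hf (fun v hv => hes v (.inr hv))
      (fun v hv => hvs v (.inr hv)) (by simp)
    rw [← List.map_map] at hx₁ hx₂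
    obtain rfl := hf.list_map hx₁
    obtain rfl := hf.list_map hx₂
    exact ⟨{m} + es₁ + es₂, (σ.bin i).inner.map η + vs₁ + vs₂, (σ.bin i).ext.map η, y, by simp,
      by simp, by simp, rfl, m, η, es₁, vs₁, es₂, vs₂, h1.comap hfg hf, h2, h3, rfl, rfl, rfl⟩
  | pairR i T D ih =>
    obtain ⟨m, η, es₁, vs₁, es₂, vs₂, h1, h2, h3, rfl, rfl, rfl⟩ := h
    simp only [Multiset.mem_add, Multiset.mem_singleton] at hes hvs
    obtain ⟨η, rfl⟩ := exists_lift (fun v hv => hvs v (.inl (.inl hv))) hx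
    obtain ⟨m, rfl⟩ := hes _ (.inl (.inl rfl))
    obtain ⟨es₁, vs₁, x₁, rfl, rfl, hx₁, h2⟩ := h2.comap hfg hf
      (fun v hv => hes v (.inl (.inr hv))) (fun v hv => hvs v (.inl (.inr hv))) (by simp)
    obtain ⟨es₂, vs₂, x₂, y, rfl, rfl, hx₂, rfl, h3⟩ := ih h3 (fun v hv => hes v (.inr hv))
      (fun v hv => hvs v (.inr hv)) (by simp)
    rw [← List.map_map] at hx₁ hx₂
    obtain rfl := hf.list_map hx₁
    obtain rfl := hf.list_map hx₂
    exact ⟨{m} + es₁ + es₂, (σ.bin i).inner.map η + vs₁ + vs₂, (σ.bin i).ext.map η, y, by simp,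
      by simp, by simp, rfl, m, η, es₁, vs₁, es₂, vs₂, h1.comap hfg hf, h2, h3, rfl, rfl, rfl⟩
  | brac j D ih =>
    obtain ⟨m, η, es₁, vs₁, h1, h2, rfl, rfl, rfl⟩ := h
    simp only [Multiset.mem_add, Multiset.mem_singleton] at hes hvs
    obtain ⟨η, rfl⟩ := exists_lift (fun v hv => hvs v (.inl hv)) hx
    obtain ⟨m, rfl⟩ := hes _ (.inl rfl)
    obtain ⟨es₁, vs₁, x₁, y, rfl, rfl, hx₁, rfl, h2⟩ := ih h2 (fun v hv => hes v (.inr hv))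
      (fun v hv => hvs v (.inr hv)) (by simp)
    rw [← List.map_map] at hx₁
    obtain rfl := hf.list_map hx₁
    exact ⟨{m} + es₁, (σ.un j).inner.map η + vs₁, (σ.un j).ext.map η, y, by simp,
      by simp, by simp, rfl, m, η, es₁, vs₁, h1.comap hfg hf, h2, rfl, rfl, rfl⟩

end hom

/-! ### Contexts -/

/-- The list `y` is the interface: the attachment nodes of the hole of `D` are the external nodes of
`Q`. -/
theorem rep_plug {D : Ctx {p : Pr // rk p = r} I J} {Q : Struct {p : Pr // rk p = r} I J}
    {es : Multiset G.E} {vs : Multiset G.V} {x : List G.V} :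
    σ.Rep G (D.plug Q) es vs x ↔ ∃ es₁ vs₁ es₂ vs₂ y, σ.RepCtx G D es₁ vs₁ x y ∧
      σ.Rep G Q es₂ vs₂ y ∧ es = es₁ + es₂ ∧ vs = vs₁ + vs₂ := by
  induction D generalizing es vs x with
  | here =>
    constructor
    · exact fun h => ⟨0, 0, es, vs, x, ⟨rfl, rfl, rfl⟩, h, by simp, by simp⟩
    · rintro ⟨_, _, es, vs, y, ⟨rfl, rfl, rfl⟩, h, rfl, rfl⟩
      simpa [Ctx.plug] using h
  | pairL i D T ih =>
    constructor
    · rintro ⟨m, η, _, _, es', vs', h1, h2, h3, rfl, rfl, rfl⟩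
      obtain ⟨es₁, vs₁, es₂, vs₂, y, h4, h5, rfl, rfl⟩ := ih.1 h2
      exact ⟨{m} + es₁ + es', (σ.bin i).inner.map η + vs₁ + vs', es₂, vs₂, y,
        ⟨m, η, es₁, vs₁, es', vs', h1, h4, h3, rfl, rfl, rfl⟩, h5, by abel, by abel⟩
    · rintro ⟨_, _, es₂, vs₂, y, ⟨m, η, es₁, vs₁, es', vs', h1, h4, h3, rfl, rfl, rfl⟩, h5, rfl,
        rfl⟩
      exact ⟨m, η, _, _, es', vs', h1, ih.2 ⟨es₁, vs₁, es₂, vs₂, y, h4, h5, rfl, rfl⟩, h3, rfl,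
        by abel, by abel⟩
  | pairR i T D ih =>
    constructor
    · rintro ⟨m, η, es', vs', _, _, h1, h3, h2, rfl, rfl, rfl⟩
      obtain ⟨es₁, vs₁, es₂, vs₂, y, h4, h5, rfl, rfl⟩ := ih.1 h2
      exact ⟨{m} + es' + es₁, (σ.bin i).inner.map η + vs' + vs₁, es₂, vs₂, y,
        ⟨m, η, es', vs', es₁, vs₁, h1, h3, h4, rfl, rfl, rfl⟩, h5, by abel, by abel⟩
    · rintro ⟨_, _, es₂, vs₂, y, ⟨m, η, es', vs', es₁, vs₁, h1, h3, h4, rfl, rfl, rfl⟩, h5, rfl,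
        rfl⟩
      exact ⟨m, η, es', vs', _, _, h1, h3, ih.2 ⟨es₁, vs₁, es₂, vs₂, y, h4, h5, rfl, rfl⟩, rfl,
        by abel, by abel⟩
  | brac j D ih =>
    constructor
    · rintro ⟨m, η, _, _, h1, h2, rfl, rfl, rfl⟩
      obtain ⟨es₁, vs₁, es₂, vs₂, y, h4, h5, rfl, rfl⟩ := ih.1 h2
      exact ⟨{m} + es₁, (σ.un j).inner.map η + vs₁, es₂, vs₂, y,
        ⟨m, η, es₁, vs₁, h1, h4, rfl, rfl, rfl⟩, h5, by abel, by abel⟩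
    · rintro ⟨_, _, es₂, vs₂, y, ⟨m, η, es₁, vs₁, h1, h4, rfl, rfl, rfl⟩, h5, rfl, rfl⟩
      exact ⟨m, η, _, _, h1, ih.2 ⟨es₁, vs₁, es₂, vs₂, y, h4, h5, rfl, rfl⟩, rfl,
        by abel, by abel⟩

theorem repCtx_comp {D D' : Ctx {p : Pr // rk p = r} I J}
    {es es' : Multiset G.E} {vs vs' : Multiset G.V} {x y z : List G.V}
    (h : σ.RepCtx G D es vs x y) (h' : σ.RepCtx G D' es' vs' y z) :
    σ.RepCtx G (D.comp D') (es + es') (vs + vs') x z := by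
  induction D generalizing es vs x with
  | here => obtain ⟨rfl, rfl, rfl⟩ := h; simpa [Ctx.comp] using h'
  | pairL i D T ih =>
    obtain ⟨m, η, es₁, vs₁, es₂, vs₂, h1, h2, h3, rfl, rfl, rfl⟩ := h
    exact ⟨m, η, _, _, _, _, h1, ih h2, h3, rfl, by abel, by abel⟩
  | pairR i T D ih =>
    obtain ⟨m, η, es₁, vs₁, es₂, vs₂, h1, h2, h3, rfl, rfl, rfl⟩ := h
    exact ⟨m, η, _, _, _, _, h1, h2, ih h3, rfl, by abel, by abel⟩
  | brac j D ih =>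
    obtain ⟨m, η, es₁, vs₁, h1, h2, rfl, rfl, rfl⟩ := h
    exact ⟨m, η, _, _, h1, ih h2, rfl, by abel, by abel⟩

/-- Every hyperedge of a representation belongs to a substructure. -/
theorem Rep.locate {Q : Struct {p : Pr // rk p = r} I J} {es : Multiset G.E} {vs : Multiset G.V}
    {x : List G.V} (h : σ.Rep G Q es vs x) {e : G.E} (he : e ∈ es) :
    ∃ D Q' es₁ vs₁ es₂ vs₂ y, Q = Ctx.plug D Q' ∧ σ.RepCtx G D es₁ vs₁ x y ∧
      σ.RepTop G Q' e es₂ vs₂ y ∧ es = es₁ + es₂ ∧ vs = vs₁ + vs₂ := by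
  obtain ⟨m, hm⟩ := rep_iff_top.1 h
  by_cases hem : e = m
  · subst hem
    exact ⟨.here, Q, 0, 0, es, vs, x, rfl, ⟨rfl, rfl, rfl⟩, hm, by simp, by simp⟩
  clear h
  induction Q generalizing es vs x m with
  | form A =>
    obtain ⟨_, _, rfl, _⟩ := hm
    exact absurd (Multiset.mem_singleton.1 he) hem
  | pair i S T ihS ihT =>
    obtain ⟨η, es₁, vs₁, es₂, vs₂, h1, h2, h3, rfl, rfl, rfl⟩ := hm
    simp only [Multiset.mem_add, Multiset.mem_singleton, hem, false_or] at he
    rcases he with he | he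
    -- The induction hypothesis leaves out the topmost hyperedge of `S`; for that one the empty
    -- context serves.
    · obtain ⟨D, Q', es₃, vs₃, es₄, vs₄, y, rfl, h4, h5, rfl, rfl⟩ :
          ∃ D Q' es₃ vs₃ es₄ vs₄ y, S = Ctx.plug D Q' ∧ σ.RepCtx G D es₃ vs₃ _ y ∧
          σ.RepTop G Q' e es₄ vs₄ y ∧ es₁ = es₃ + es₄ ∧ vs₁ = vs₃ + vs₄ := by
        obtain ⟨m', hm'⟩ := rep_iff_top.1 h2
        by_cases hem' : e = m'
        · subst hem'
          exact ⟨.here, S, 0, 0, es₁, vs₁, _, rfl, ⟨rfl, rfl, rfl⟩, hm', by simp, by simp⟩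
        · exact ihS he _ hm' hem'
      exact ⟨.pairL i D T, Q', {m} + es₃ + es₂, (σ.bin i).inner.map η + vs₃ + vs₂, es₄, vs₄, y,
        rfl, ⟨m, η, es₃, vs₃, es₂, vs₂, h1, h4, h3, rfl, rfl, rfl⟩, h5, by abel, by abel⟩
    · obtain ⟨D, Q', es₃, vs₃, es₄, vs₄, y, rfl, h4, h5, rfl, rfl⟩ :
          ∃ D Q' es₃ vs₃ es₄ vs₄ y, T = Ctx.plug D Q' ∧ σ.RepCtx G D es₃ vs₃ _ y ∧
          σ.RepTop G Q' e es₄ vs₄ y ∧ es₂ = es₃ + es₄ ∧ vs₂ = vs₃ + vs₄ := by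
        obtain ⟨m', hm'⟩ := rep_iff_top.1 h3
        by_cases hem' : e = m'
        · subst hem'
          exact ⟨.here, T, 0, 0, es₂, vs₂, _, rfl, ⟨rfl, rfl, rfl⟩, hm', by simp, by simp⟩
        · exact ihT he _ hm' hem'
      exact ⟨.pairR i S D, Q', {m} + es₁ + es₃, (σ.bin i).inner.map η + vs₁ + vs₃, es₄, vs₄, y,
        rfl, ⟨m, η, es₁, vs₁, es₃, vs₃, h1, h2, h4, rfl, rfl, rfl⟩, h5, by abel, by abel⟩
  | brac j S ihS =>
    obtain ⟨η, es₁, vs₁, h1, h2, rfl, rfl, rfl⟩ := hm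
    simp only [Multiset.mem_add, Multiset.mem_singleton, hem, false_or] at he
    obtain ⟨D, Q', es₃, vs₃, es₄, vs₄, y, rfl, h4, h5, rfl, rfl⟩ :
        ∃ D Q' es₃ vs₃ es₄ vs₄ y, S = Ctx.plug D Q' ∧ σ.RepCtx G D es₃ vs₃ _ y ∧
        σ.RepTop G Q' e es₄ vs₄ y ∧ es₁ = es₃ + es₄ ∧ vs₁ = vs₃ + vs₄ := by
      obtain ⟨m', hm'⟩ := rep_iff_top.1 h2
      by_cases hem' : e = m'
      · subst hem'
        exact ⟨.here, S, 0, 0, es₁, vs₁, _, rfl, ⟨rfl, rfl, rfl⟩, hm', by simp, by simp⟩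
      · exact ihS he _ hm' hem'
    exact ⟨.brac j D, Q', {m} + es₃, (σ.un j).inner.map η + vs₃, es₄, vs₄, y,
      rfl, ⟨m, η, es₃, vs₃, h1, h4, rfl, rfl, rfl⟩, h5, by abel, by abel⟩

end Shapes
end
end HL

/-! ### Uniqueness of the hypergraph that represents a structured database -/

theorem List.exists_map_eq_of_nodup {α β : Type*} [Nonempty β] {l : List α} {l' : List β}
    (hl : l.Nodup) (h : l.length = l'.length) : ∃ f : α → β, l.map f = l' := by
  classical
  -- Positions in `l` are unambiguous. The default value is returned only for elements outside `l`.
  refine ⟨fun a => l'.getD (l.idxOf a) (Classical.arbitrary β), ?_⟩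
  refine List.ext_getElem (by simpa using h) fun i h1 h2 => ?_
  simp [hl.idxOf_getElem, h2]

namespace HL
open NLM (Struct Form Ctx)

section
variable {Pr : Type u} {rk : Pr → ℕ} {I J : Type} {r : ℕ}

/-- What `(vs + x).Nodup` means if `vs` and `x` are assembled from a placement of `K`. -/
theorem Pattern.nodup {S : Type} {K : GraphContext rk S} {p : Pr} (hK : Pattern K p) {G : Graph rk}
    {η : K.V → G.V} {vs₁ vs₂ : Multiset G.V}
    (h : (K.inner.map η + vs₁ + vs₂ + (K.ext.map η : List G.V)).Nodup) :
    Function.Injective η ∧ (∀ w, η w ∉ vs₁) ∧ (∀ w, η w ∉ vs₂) ∧ (∀ v ∈ vs₁, v ∉ vs₂) ∧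
    (∀ s, (vs₁ + ((K.hole s).map η : List G.V)).Nodup) ∧
    (∀ s, (vs₂ + ((K.hole s).map η : List G.V)).Nodup) := by
  -- Regrouped, the images of inner and external nodes form the image under `η` of a multiset
  -- containing every node of `K`. Its having no repetitions is then the injectivity of `η`.
  have h' : ((K.inner + (K.ext : Multiset K.V)).map η + (vs₁ + vs₂)).Nodup := by
    convert h using 1
    rw [Multiset.map_add, Multiset.map_coe]
    abel
  rw [Multiset.nodup_add, Multiset.nodup_add] at h'
  obtain ⟨ha, ⟨hb, hc, hd⟩, he⟩ := h'
  have hall : ∀ w, w ∈ K.inner + (K.ext : Multiset K.V) := fun w => by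
    by_cases hw : w ∈ K.ext <;> simp [hw]
  have hη : Function.Injective η := fun v w hvw =>
    Multiset.inj_on_of_nodup_map ha v (hall v) w (hall w) hvw
  have h12 : ∀ w, η w ∉ vs₁ + vs₂ := fun w hw =>
    Multiset.disjoint_left.1 he (Multiset.mem_map_of_mem _ (hall w)) hw
  have h1 : ∀ w, η w ∉ vs₁ := fun w hw => h12 w (Multiset.mem_add.2 (.inl hw))
  have h2 : ∀ w, η w ∉ vs₂ := fun w hw => h12 w (Multiset.mem_add.2 (.inr hw))
  refine ⟨hη, h1, h2, fun v hv hv' => Multiset.disjoint_left.1 hd hv hv', fun s => ?_, fun s => ?_⟩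
  · rw [Multiset.nodup_add]
    refine ⟨hb, by simpa using (hK.hole_nodup s).map hη, Multiset.disjoint_left.2 fun hv hv' => ?_⟩
    obtain ⟨w, _, rfl⟩ := List.mem_map.1 (Multiset.mem_coe.1 hv')
    exact h1 w hv
  · rw [Multiset.nodup_add]
    refine ⟨hc, by simpa using (hK.hole_nodup s).map hη, Multiset.disjoint_left.2 fun hv hv' => ?_⟩
    obtain ⟨w, _, rfl⟩ := List.mem_map.1 (Multiset.mem_coe.1 hv')
    exact h2 w hv

theorem mem_inner_or_ext {S : Type} (K : GraphContext rk S) {G : Graph rk} (η : K.V → G.V)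
    (v : K.V) : η v ∈ K.inner.map η ∨ η v ∈ K.ext.map η := by
  by_cases hv : v ∈ K.ext
  · exact .inr (List.mem_map_of_mem hv)
  · exact .inl (Multiset.mem_map_of_mem _ (K.mem_inner v |>.2 hv))

namespace Shapes

/-- All modes and modalities are given by patterns, the modes in `C` by those with two
interchangeable holes. -/
structure Regular (σ : Shapes rk I J r) (C : Set I) : Prop where
  pos : 0 < r
  bin : ∀ i, Pattern (σ.bin i) (σ.mode i)
  un : ∀ j, Pattern (σ.un j) (σ.modality j)
  comm : ∀ i, i ∈ C ↔ (σ.bin i).hole 0 = (σ.bin i).hole 1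
  mode_rank : ∀ i, rk (σ.mode i) ≠ r
  modality_rank : ∀ j, rk (σ.modality j) ≠ r
  mode_inj : Function.Injective σ.mode
  modality_inj : Function.Injective σ.modality
  mode_ne : ∀ i j, σ.mode i ≠ σ.modality j

variable {σ : Shapes rk I J r} {C : Set I} {G G' : Graph rk}

/-- A represented part is closed under taking attachment nodes. This is what allows maps defined on
the parts to be pasted together in `Rep.exists_map`. -/
theorem Rep.att_mem (hσ : σ.Regular C) {Q : Struct {p : Pr // rk p = r} I J} {es : Multiset G.E}
    {vs : Multiset G.V} {x : List G.V} (h : σ.Rep G Q es vs x) :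
    ∀ e ∈ es, ∀ v ∈ G.att e, v ∈ vs ∨ v ∈ x := by
  induction Q generalizing es vs x with
  | form A =>
    obtain ⟨e, h1, rfl, rfl, rfl⟩ := h
    intro e' he' v hv
    obtain rfl := Multiset.mem_singleton.1 he'
    exact .inr hv
  | pair i S T ihS ihT =>
    obtain ⟨m, η, es₁, vs₁, es₂, vs₂, h1, h2, h3, rfl, rfl, rfl⟩ := h
    have key : ∀ w, η w ∈ (σ.bin i).inner.map η + vs₁ + vs₂ ∨ η w ∈ (σ.bin i).ext.map η := fun w =>
      (mem_inner_or_ext (σ.bin i) η w).imp (fun h => Multiset.mem_add.2 (.inl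
        (Multiset.mem_add.2 (.inl h)))) id
    intro e he v hv
    simp only [Multiset.mem_add, Multiset.mem_singleton] at he ⊢
    obtain ⟨e₀, -⟩ := (hσ.bin i).edge
    rcases he with (rfl | he) | he
    · rw [(h1 e₀).2] at hv
      obtain ⟨w, _, rfl⟩ := List.mem_map.1 hv
      simpa using key w
    · rcases ihS h2 e he v hv with h | h
      · exact .inl (.inl (.inr h))
      · obtain ⟨w, _, rfl⟩ := List.mem_map.1 h
        simpa using key w
    · rcases ihT h3 e he v hv with h | h
      · exact .inl (.inr h)
      · obtain ⟨w, _, rfl⟩ := List.mem_map.1 h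
        simpa using key w
  | brac j S ihS =>
    obtain ⟨m, η, es₁, vs₁, h1, h2, rfl, rfl, rfl⟩ := h
    have key : ∀ w, η w ∈ (σ.un j).inner.map η + vs₁ ∨ η w ∈ (σ.un j).ext.map η := fun w =>
      (mem_inner_or_ext (σ.un j) η w).imp (fun h => Multiset.mem_add.2 (.inl h)) id
    intro e he v hv
    simp only [Multiset.mem_add, Multiset.mem_singleton] at he ⊢
    obtain ⟨e₀, -⟩ := (hσ.un j).edge
    rcases he with rfl | he
    · rw [(h1 e₀).2] at hv
      obtain ⟨w, _, rfl⟩ := List.mem_map.1 hv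
      simpa using key w
    · rcases ihS h2 e he v hv with h | h
      · exact .inl (.inr h)
      · obtain ⟨w, _, rfl⟩ := List.mem_map.1 h
        simpa using key w

/-- Two representations of the same structured database are isomorphic. -/
theorem Rep.exists_map (hσ : σ.Regular C) {Q : Struct {p : Pr // rk p = r} I J}
    {es : Multiset G.E} {vs : Multiset G.V} {x : List G.V} {es' : Multiset G'.E}
    {vs' : Multiset G'.V} {x' : List G'.V} (h : σ.Rep G Q es vs x) (h' : σ.Rep G' Q es' vs' x')
    (hes : es.Nodup) (hvs : (vs + (x : Multiset G.V)).Nodup) :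
    ∃ (f : G.V → G'.V) (g : G.E → G'.E), es.map g = es' ∧ vs.map f = vs' ∧ x.map f = x' ∧
      ∀ e ∈ es, G'.lab (g e) = G.lab e ∧ G'.att (g e) = (G.att e).map f := by
  classical
  -- Since `r` is positive, an external node exists; it supplies the irrelevant values of the maps.
  have hne : Nonempty G'.V := by
    have := h'.length
    obtain ⟨v, _⟩ := List.exists_mem_of_length_pos (by rw [this]; exact hσ.pos)
    exact ⟨v⟩
  induction Q generalizing es vs x es' vs' x' with
  | form A =>
    obtain ⟨e, h1, rfl, rfl, rfl⟩ := h
    obtain ⟨e', h1', rfl, rfl, rfl⟩ := h'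
    obtain ⟨f, hf⟩ := List.exists_map_eq_of_nodup (l := G.att e) (l' := G'.att e')
      (by simpa using hvs) (by rw [← G.rk_lab, ← G'.rk_lab, h1, h1'])
    exact ⟨f, fun _ => e', by simp, by simp, hf, fun a ha => by
      obtain rfl := Multiset.mem_singleton.1 ha
      exact ⟨h1'.trans h1.symm, hf.symm⟩⟩
  | pair i S T ihS ihT =>
    obtain ⟨m, η, es₁, vs₁, es₂, vs₂, h1, h2, h3, rfl, rfl, rfl⟩ := h
    obtain ⟨m', η', es₁', vs₁', es₂', vs₂', h1', h2', h3', rfl, rfl, rfl⟩ := h'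
    obtain ⟨hη, n1, n2, n12, n1', n2'⟩ := (hσ.bin i).nodup hvs
    rw [Multiset.nodup_add, Multiset.nodup_add] at hes
    obtain ⟨⟨_, hes₁, hd₁⟩, hes₂, hd₂⟩ := hes
    obtain ⟨f₁, g₁, e1, e2, e3, e4⟩ := ihS h2 h2' hes₁ (n1' 0)
    obtain ⟨f₂, g₂, e1', e2', e3', e4'⟩ := ihT h3 h3' hes₂ (n2' 1)
    rw [List.map_map, List.map_inj_left] at e3 e3'
    -- The inner nodes of the two arguments and the image of `η` are pairwise disjoint, so `f` may
    -- be prescribed on each. On the attachment nodes of the holes, which both an argument and the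
    -- mode see, `e3` and `e3'` say that the prescriptions agree.
    let f : G.V → G'.V := fun v => if v ∈ vs₁ then f₁ v else if v ∈ vs₂ then f₂ v else
      if h : ∃ w, η w = v then η' h.choose else Classical.arbitrary _
    let g : G.E → G'.E := fun e => if e ∈ es₁ then g₁ e else if e ∈ es₂ then g₂ e else m'
    have fη : ∀ w, f (η w) = η' w := fun w => by
      have hw : ∃ w', η w' = η w := ⟨w, rfl⟩
      simp only [f, n1, n2, if_false, hw, dite_true]
      rw [hη hw.choose_spec]
    have f1 : ∀ v ∈ vs₁, f v = f₁ v := fun v hv => if_pos hv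
    have f2 : ∀ v ∈ vs₂, f v = f₂ v := fun v hv => by
      have : v ∉ vs₁ := fun h => n12 v h hv
      simp [f, this, hv]
    have g1 : ∀ e ∈ es₁, g e = g₁ e := fun v hv => if_pos hv
    have g2 : ∀ e ∈ es₂, g e = g₂ e := fun v hv => by
      have : v ∉ es₁ := fun h => Multiset.disjoint_left.1 hd₂ (Multiset.mem_add.2 (.inr h)) hv
      simp [g, this, hv]
    have gm : g m = m' := by
      have hm1 : m ∉ es₁ := fun h => Multiset.disjoint_left.1 hd₁ (Multiset.mem_singleton_self m) h
      have hm2 : m ∉ es₂ := fun h => Multiset.disjoint_left.1 hd₂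
        (Multiset.mem_add.2 (.inl (Multiset.mem_singleton_self m))) h
      simp [g, hm1, hm2]
    refine ⟨f, g, ?_, ?_, ?_, ?_⟩
    · simp [gm, Multiset.map_congr rfl g1, Multiset.map_congr rfl g2, e1, e1']
    · have : f ∘ η = η' := funext fη
      simp only [Multiset.map_add, Multiset.map_map, Multiset.map_congr rfl f1,
        Multiset.map_congr rfl f2, e2, e2', this]
    · simp [fη]
    · obtain ⟨e₀, -⟩ := (hσ.bin i).edge
      intro e he
      simp only [Multiset.mem_add, Multiset.mem_singleton] at he
      rcases he with (rfl | he) | he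
      · rw [gm, (h1 e₀).1, (h1' e₀).1, (h1 e₀).2, (h1' e₀).2]
        simp [fη]
      · rw [g1 e he]
        refine ⟨(e4 e he).1, (e4 e he).2.trans (List.map_congr_left fun v hv => ?_)⟩
        rcases h2.att_mem hσ e he v hv with hv | hv
        · rw [f1 v hv]
        · obtain ⟨w, hw, rfl⟩ := List.mem_map.1 hv
          exact (e3 w hw).trans (fη w).symm
      · rw [g2 e he]
        refine ⟨(e4' e he).1, (e4' e he).2.trans (List.map_congr_left fun v hv => ?_)⟩
        rcases h3.att_mem hσ e he v hv with hv | hv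
        · rw [f2 v hv]
        · obtain ⟨w, hw, rfl⟩ := List.mem_map.1 hv
          exact (e3' w hw).trans (fη w).symm
  | brac j S ihS =>
    obtain ⟨m, η, es₁, vs₁, h1, h2, rfl, rfl, rfl⟩ := h
    obtain ⟨m', η', es₁', vs₁', h1', h2', rfl, rfl, rfl⟩ := h'
    obtain ⟨hη, n1, -, -, n1', -⟩ := (hσ.un j).nodup (vs₂ := 0) (by simpa using hvs)
    rw [Multiset.nodup_add] at hes
    obtain ⟨_, hes₁, hd₁⟩ := hes
    obtain ⟨f₁, g₁, e1, e2, e3, e4⟩ := ihS h2 h2' hes₁ (n1' ())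
    rw [List.map_map, List.map_inj_left] at e3
    let f : G.V → G'.V := fun v => if v ∈ vs₁ then f₁ v else
      if h : ∃ w, η w = v then η' h.choose else Classical.arbitrary _
    let g : G.E → G'.E := fun e => if e ∈ es₁ then g₁ e else m'
    have fη : ∀ w, f (η w) = η' w := fun w => by
      have hw : ∃ w', η w' = η w := ⟨w, rfl⟩
      simp only [f, n1, if_false, hw, dite_true]
      rw [hη hw.choose_spec]
    have f1 : ∀ v ∈ vs₁, f v = f₁ v := fun v hv => if_pos hv
    have g1 : ∀ e ∈ es₁, g e = g₁ e := fun v hv => if_pos hv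
    have gm : g m = m' := by
      have hm1 : m ∉ es₁ := fun h => Multiset.disjoint_left.1 hd₁ (Multiset.mem_singleton_self m) h
      simp [g, hm1]
    refine ⟨f, g, ?_, ?_, ?_, ?_⟩
    · simp [gm, Multiset.map_congr rfl g1, e1]
    · have : f ∘ η = η' := funext fη
      simp only [Multiset.map_add, Multiset.map_map, Multiset.map_congr rfl f1, e2, this]
    · simp [fη]
    · obtain ⟨e₀, -⟩ := (hσ.un j).edge
      intro e he
      simp only [Multiset.mem_add, Multiset.mem_singleton] at he
      rcases he with rfl | he
      · rw [gm, (h1 e₀).1, (h1' e₀).1, (h1 e₀).2, (h1' e₀).2]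
        simp [fη]
      · rw [g1 e he]
        refine ⟨(e4 e he).1, (e4 e he).2.trans (List.map_congr_left fun v hv => ?_)⟩
        rcases h2.att_mem hσ e he v hv with hv | hv
        · rw [f1 v hv]
        · obtain ⟨w, hw, rfl⟩ := List.mem_map.1 hv
          exact (e3 w hw).trans (fη w).symm

/-- For a representation of everything the domains of the maps from `Rep.exists_map` are exhausted:
all nodes and all hyperedges occur exactly once on both sides, and a map between two such
enumerations is bijective. -/
theorem FullRep.iso (hσ : σ.Regular C) {Q : Struct {p : Pr // rk p = r} I J}
    (h : σ.FullRep G Q) (h' : σ.FullRep G' Q) : Iso G G' := by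
  have hn := G.nodup_inner_add_ext h.1
  have hn' := G'.nodup_inner_add_ext h'.1
  obtain ⟨f, g, h1, h2, h3, h4⟩ := h.2.exists_map hσ h'.2 G.edges_full.1 hn
  have hall : ∀ (H : Graph rk) v, v ∈ H.inner + (H.ext : Multiset H.V) := fun H v => by
    by_cases hv : v ∈ H.ext <;> simp [hv]
  have hf : (G.inner + (G.ext : Multiset G.V)).map f = G'.inner + (G'.ext : Multiset G'.V) := by
    rw [Multiset.map_add, h2, Multiset.map_coe, h3]
  have bf : Function.Bijective f := by
    refine ⟨fun v w hvw => ?_, fun v => ?_⟩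
    · exact Multiset.inj_on_of_nodup_map (hf ▸ hn') v (hall G v) w (hall G w) hvw
    · obtain ⟨w, _, hw⟩ := Multiset.mem_map.1 (hf ▸ hall G' v)
      exact ⟨w, hw⟩
  have bg : Function.Bijective g := by
    refine ⟨fun v w hvw => ?_, fun v => ?_⟩
    · exact Multiset.inj_on_of_nodup_map (h1 ▸ G'.edges_full.1) v (G.mem_edges v) w (G.mem_edges w)
        hvw
    · obtain ⟨w, _, hw⟩ := Multiset.mem_map.1 (h1 ▸ G'.mem_edges v)
      exact ⟨w, hw⟩
  exact ⟨.ofBijective f bf, .ofBijective g bg, fun e => (h4 e (G.mem_edges e)).2,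
    fun e => (h4 e (G.mem_edges e)).1, h3.symm⟩

theorem FullRep.of_iso {Q : Struct {p : Pr // rk p = r} I J} (h : σ.FullRep G Q) (i : Iso G G') :
    σ.FullRep G' Q := by
  obtain ⟨f, g, h1, h2, h3⟩ := i
  refine ⟨h3 ▸ h.1.map f.injective, ?_⟩
  rw [h3, G.edges_map_equiv g, G.inner_map_equiv f h3]
  exact h.2.map fun e => ⟨h2 e, h1 e⟩

end Shapes

/-! ## Translations and hyperedge replacement -/

/-- `G` is isomorphic to the handle of `X`. -/
def IsHandle (G : Graph rk) (X : Formula rk) : Prop :=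
  G.ext.Nodup ∧ G.inner = 0 ∧ ∃ e, G.edges = {e} ∧ G.lab e = X ∧ G.att e = G.ext

theorem isHandle_handle (X : Formula rk) : IsHandle (handle X : Graph rk) X :=
  ⟨List.nodup_finRange _, Hypergraph.inner_eq Multiset.nodup_zero (fun v => iff_of_false
    (Multiset.notMem_zero v)
      (not_not.2 (List.mem_finRange v))),
    (), Hypergraph.edges_eq ⟨Multiset.nodup_singleton _, fun _ => Multiset.mem_singleton_self _⟩,
    rfl, rfl⟩

theorem IsHandle.of_iso {G G' : Graph rk} {X : Formula rk} (h : IsHandle G X) (i : Iso G G') :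
    IsHandle G' X := by
  obtain ⟨f, g, h1, h2, h3⟩ := i
  obtain ⟨h4, h5, e, h6, h7, h8⟩ := h
  refine ⟨h3 ▸ h4.map f.injective, ?_, g e, ?_, (h2 e).trans h7, ?_⟩
  · rw [G.inner_map_equiv f h3, h5, Multiset.map_zero]
  · rw [G.edges_map_equiv g, h6, Multiset.map_singleton]
  · rw [h1, h8, h3]

namespace Context
variable {S : Type} [Finite S] (K : GraphContext rk S) (H : S → Graph rk)

/-- The attachment nodes of a hyperedge or a hole. -/
def slotAtt : K.E ⊕ S → List K.V := Sum.elim K.att K.hole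

variable {K H}

theorem isHom_inserted (s : S) :
    IsHom (H s) (K.fill H) (K.inserted H s) (fun e => .inr ⟨s, e⟩) := fun _ => ⟨rfl, rfl⟩

theorem isHom_outer : IsHom K.toHypergraph (K.fill H) (K.outer H) Sum.inl := fun _ => ⟨rfl, rfl⟩

variable (K H) in
/-- The slot contains just a hyperedge labeled by `X`. -/
def SlotHandle (X : Formula rk) : K.E ⊕ S → Prop
  | .inl e => K.lab e = X
  | .inr s => IsHandle (H s) X

/-- After filling, a hyperedge of the context and a hole filled with a handle look alike. Modes
reach the antecedents of rules in both ways, and this permits a uniform treatment. -/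
theorem SlotHandle.exists_edge (hl : ∀ s, (K.hole s).length = (H s).ext.length) {X : Formula rk}
    {t : K.E ⊕ S} (h : K.SlotHandle H X t) : ∃ m, K.slotEdges H t = {m} ∧ K.slotInner H t = 0 ∧
      (K.fill H).lab m = X ∧ (K.fill H).att m = (K.slotAtt t).map (K.outer H) := by
  rcases t with e | s
  · exact ⟨.inl e, rfl, rfl, h, rfl⟩
  · obtain ⟨h4, h5, e, h6, h7, h8⟩ := h
    refine ⟨.inr ⟨s, e⟩, by
      simp only [slotEdges, h6]
      exact Multiset.map_singleton _ _, by simp [slotInner, h5], h7, ?_⟩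
    change ((H s).att e).map (K.inserted H s) = _
    rw [h8, ← map_hole (hl s)]
    rfl

variable (K H) in
/-- The slot contains the translation of the structured database. -/
def SlotRep (σ : Shapes rk I J r) (Q : Struct {p : Pr // rk p = r} I J) : K.E ⊕ S → Prop
  | .inl e => ∃ A, Q = .form A ∧ K.lab e = (σ.mu A).1
  | .inr s => σ.FullRep (H s) Q

theorem SlotRep.rep {σ : Shapes rk I J r} (hl : ∀ s, (K.hole s).length = (H s).ext.length)
    {Q : Struct {p : Pr // rk p = r} I J}
    {t : K.E ⊕ S} (h : K.SlotRep H σ Q t) : σ.Rep (K.fill H) Q (K.slotEdges H t)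
      (K.slotInner H t) ((K.slotAtt t).map (K.outer H)) := by
  rcases t with e | s
  · obtain ⟨A, rfl, h⟩ := h
    exact ⟨.inl e, h, rfl, rfl, rfl⟩
  · have := h.2.map (K.isHom_inserted (H := H) s)
    rw [← map_hole (hl s)] at this
    exact this

end Context

namespace Shapes
variable {σ : Shapes rk I J r} {C : Set I} {G G' : Graph rk}

/-- The common form of the antecedents built by the rules for binary connectives. Three slots, each
a hyperedge or a hole, exhaust the context, and `f` matches its nodes with those of the shape of
`i`. Which slots are hyperedges depends on the rule. -/
theorem fullRep_fill_pair {S : Type} [Finite S] {K : GraphContext rk S} {H : S → Graph rk}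
    (hσ : σ.Regular C) (hH : ∀ s, (H s).ext.Nodup)
    (hl : ∀ s, (K.hole s).length = (H s).ext.length) {i : I} (f : (σ.bin i).V ≃ K.V)
    (hext : K.ext = (σ.bin i).ext.map f)
    {t t₁ t₂ : K.E ⊕ S} (ht : ({t, t₁, t₂} : Multiset (K.E ⊕ S)).Full)
    (hm : K.SlotHandle H (.prim (σ.mode i)) t) (hma : ∀ e, K.slotAtt t = ((σ.bin i).att e).map f)
    {Q₁ Q₂ : Struct {p : Pr // rk p = r} I J}
    (h₁ : K.SlotRep H σ Q₁ t₁) (ha₁ : K.slotAtt t₁ = ((σ.bin i).hole 0).map f)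
    (h₂ : K.SlotRep H σ Q₂ t₂) (ha₂ : K.slotAtt t₂ = ((σ.bin i).hole 1).map f) :
    σ.FullRep (K.fill H) (.pair i Q₁ Q₂) := by
  have hKe : K.ext.Nodup := hext ▸ (hσ.bin i).ext_nodup.map f.injective
  obtain ⟨m, hm1, hm2, hm3, hm4⟩ := hm.exists_edge hl
  refine ⟨Context.nodup_ext_fill hH hKe, m, K.outer H ∘ f, _, _, _, _, ?_,
    by simpa [ha₁] using h₁.rep hl, by simpa [ha₂] using h₂.rep hl, ?_, ?_, ?_⟩
  · intro e
    obtain ⟨e₀, he₀, he₀'⟩ := (hσ.bin i).edge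
    rw [he₀ e, he₀', hm4, hma e₀, List.map_map]
    exact ⟨hm3, rfl⟩
  · change K.ext.map (K.outer H) = _
    rw [hext, List.map_map]
  · rw [Context.edges_fill ht]
    simp [hm1]
  · rw [Context.inner_fill hH hl ht, (σ.bin i).inner_map_equiv f hext]
    simp [hm2, add_assoc]

theorem fullRep_fill_brac {S : Type} [Finite S] {K : GraphContext rk S} {H : S → Graph rk}
    (hσ : σ.Regular C) (hH : ∀ s, (H s).ext.Nodup)
    (hl : ∀ s, (K.hole s).length = (H s).ext.length) {j : J} (f : (σ.un j).V ≃ K.V)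
    (hext : K.ext = (σ.un j).ext.map f)
    {t t₁ : K.E ⊕ S} (ht : ({t, t₁} : Multiset (K.E ⊕ S)).Full)
    (hm : K.SlotHandle H (.prim (σ.modality j)) t)
    (hma : ∀ e, K.slotAtt t = ((σ.un j).att e).map f)
    {Q₁ : Struct {p : Pr // rk p = r} I J}
    (h₁ : K.SlotRep H σ Q₁ t₁) (ha₁ : K.slotAtt t₁ = ((σ.un j).hole ()).map f) :
    σ.FullRep (K.fill H) (.brac j Q₁) := by
  have hKe : K.ext.Nodup := hext ▸ (hσ.un j).ext_nodup.map f.injective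
  obtain ⟨m, hm1, hm2, hm3, hm4⟩ := hm.exists_edge hl
  refine ⟨Context.nodup_ext_fill hH hKe, m, K.outer H ∘ f, _, _, ?_,
    by simpa [ha₁] using h₁.rep hl, ?_, ?_, ?_⟩
  · intro e
    obtain ⟨e₀, he₀, he₀'⟩ := (hσ.un j).edge
    rw [he₀ e, he₀', hm4, hma e₀, List.map_map]
    exact ⟨hm3, rfl⟩
  · change K.ext.map (K.outer H) = _
    rw [hext, List.map_map]
  · rw [Context.edges_fill ht]
    simp [hm1]
  · rw [Context.inner_fill hH hl ht, (σ.un j).inner_map_equiv f hext]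
    simp [hm2]

theorem fullRep_handle {X : Formula rk} {A : Form {p : Pr // rk p = r} I J}
    (h : X = (σ.mu A).1) : σ.FullRep (handle X) (.form A) := by
  obtain ⟨h1, h2, e, h3, h4, h5⟩ := isHandle_handle X
  exact ⟨h1, e, h4.trans h, h5, h3, h2⟩

theorem fullRep_tree (hσ : σ.Regular C) (Q : Struct {p : Pr // rk p = r} I J) :
    σ.FullRep (σ.tree Q) Q := by
  induction Q with
  | form A => exact fullRep_handle rfl
  | pair i S T ihS ihT =>
    obtain ⟨e₀, he₀, he₀'⟩ := (hσ.bin i).edge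
    have hall : ∀ s : Fin 2, (![σ.tree S, σ.tree T] s).ext.Nodup ∧
        ((σ.bin i).hole s).length = (![σ.tree S, σ.tree T] s).ext.length := by
      intro s
      rw [σ.bin_hole]
      fin_cases s
      exacts [⟨ihS.1, ihS.length.symm⟩, ⟨ihT.1, ihT.length.symm⟩]
    refine fullRep_fill_pair hσ (fun s => (hall s).1) (fun s => (hall s).2) (.refl _) (by simp)
      (t := .inl e₀) (t₁ := .inr 0) (t₂ := .inr 1) ⟨by simp, ?_⟩ he₀'
      (fun e => by rw [he₀ e]; simp [Context.slotAtt]) ihS (by simp [Context.slotAtt]) ihT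
      (by simp [Context.slotAtt])
    rintro (e | s)
    · simp [he₀ e]
    · fin_cases s <;> simp
  | brac j S ihS =>
    obtain ⟨e₀, he₀, he₀'⟩ := (hσ.un j).edge
    refine fullRep_fill_brac hσ (fun s => ihS.1) (fun s => (σ.un_hole j s).trans ihS.length.symm)
      (.refl _) (by simp)
      (t := .inl e₀) (t₁ := .inr ()) ⟨by simp, ?_⟩ he₀'
      (fun e => by rw [he₀ e]; simp [Context.slotAtt]) ihS (by simp [Context.slotAtt])
    rintro (e | s)
    · simp [he₀ e]
    · simp

/-- Together with `FullRep.of_iso` and `fullRep_tree`, this makes representing `Q` the same as being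
isomorphic to its translation. -/
theorem FullRep.iso_tree (hσ : σ.Regular C) {Q : Struct {p : Pr // rk p = r} I J}
    (h : σ.FullRep G Q) : Iso G (σ.tree Q) := h.iso hσ (fullRep_tree hσ Q)

end Shapes
end
end HL

namespace HL
open NLM (Struct Form Ctx)

section
variable {Pr : Type u} {rk : Pr → ℕ} {I J : Type} {r : ℕ}

/-! ## Formulas with the same translation -/

namespace Formula

theorem prim_injective : Function.Injective (prim : Pr → Formula rk) := by
  intro p q h
  cases (Quotient.exact h : PreFormula.Equiv _ _)
  rfl

theorem prim_ne_times (p : Pr) (M : Graph rk) : prim p ≠ times M :=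
  fun h => nomatch (Quotient.exact h : PreFormula.Equiv _ _)

theorem prim_ne_div (p : Pr) (N : Formula rk) (D : GraphContext rk Unit)
    (hD : N.rank = D.ext.length) : prim p ≠ div N D hD :=
  fun h => nomatch (Quotient.exact h : PreFormula.Equiv _ _)

theorem times_ne_div (M : Graph rk) (N : Formula rk) (D : GraphContext rk Unit)
    (hD : N.rank = D.ext.length) : times M ≠ div N D hD :=
  fun h => nomatch (Quotient.exact h : PreFormula.Equiv _ _)

end Formula

/-- Both lists are fixed entry by entry, and by `cover` they contain every node. So an isomorphism
between translated formulas can only permute holes that have the same attachment. -/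
theorem Pattern.eq_id {S : Type} {K : GraphContext rk S} {p : Pr} (hK : Pattern K p)
    {f : K.V → K.V} (h : ∀ e, K.att e = (K.att e).map f) (h' : K.ext = K.ext.map f) (v : K.V) :
    f v = v := by
  have key : ∀ l : List K.V, l = l.map f → v ∈ l → f v = v := fun l hl hv => by
    conv_lhs at hl => rw [← List.map_id l]
    exact (List.map_inj_left.1 hl v hv).symm
  rcases hK.cover v with hv | ⟨e, hv⟩
  exacts [key _ h' hv, key _ (h e) hv]

namespace Shapes
variable {σ : Shapes rk I J r} {C A : Set I}

theorem mu_under (i : I) (X Y : Form {p : Pr // rk p = r} I J) : (σ.mu (.under i Y X)).1 =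
    .div (σ.mu X).1 ((σ.bin i).labelExcept 1 (σ.mu Y).1
      fun t => (σ.mu Y).2.trans (σ.bin_hole i t).symm) ((σ.mu X).2.trans (σ.bin_ext i).symm) := rfl

theorem mu_over (i : I) (X Y : Form {p : Pr // rk p = r} I J) : (σ.mu (.over i X Y)).1 =
    .div (σ.mu X).1 ((σ.bin i).labelExcept 0 (σ.mu Y).1
      fun t => (σ.mu Y).2.trans (σ.bin_hole i t).symm) ((σ.mu X).2.trans (σ.bin_ext i).symm) := rfl

theorem mu_box (j : J) (X : Form {p : Pr // rk p = r} I J) : (σ.mu (.box j X)).1 =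
    .div (σ.mu X).1 (σ.un j) ((σ.mu X).2.trans (σ.un_ext j).symm) := rfl

/-- The ranks differ: translated formulas have rank `r`. -/
theorem Regular.prim_mode_ne (hσ : σ.Regular C) (i : I) (B : Form {p : Pr // rk p = r} I J) :
    .prim (σ.mode i) ≠ (σ.mu B).1 := fun h =>
  hσ.mode_rank i ((congrArg Formula.rank h).trans (σ.mu B).2)

theorem Regular.prim_modality_ne (hσ : σ.Regular C) (j : J) (B : Form {p : Pr // rk p = r} I J) :
    .prim (σ.modality j) ≠ (σ.mu B).1 := fun h =>
  hσ.modality_rank j ((congrArg Formula.rank h).trans (σ.mu B).2)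

theorem mu_prim_eq {p : {p : Pr // rk p = r}} {T : Form {p : Pr // rk p = r} I J}
    (h : (σ.mu (.prim p)).1 = (σ.mu T).1) : T = .prim p := by
  cases T with
  | prim q => rw [Subtype.ext (Formula.prim_injective h)]
  | prod i X Y => exact nomatch (Quotient.exact h : PreFormula.Equiv _ _)
  | dia i X => exact nomatch (Quotient.exact h : PreFormula.Equiv _ _)
  | under i X Y => exact nomatch (Quotient.exact h : PreFormula.Equiv _ _)
  | box i X => exact nomatch (Quotient.exact h : PreFormula.Equiv _ _)
  | _ =>
    rename_i i X Y
    exact nomatch (Quotient.exact h : PreFormula.Equiv _ _)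

/-- An isomorphism must send the mode to the mode, as only that label is not a translated formula.
It then fixes all nodes and permutes the two argument hyperedges; an actual exchange forces the
holes to coincide, which means that the mode is commutative. -/
theorem mu_prod_eq (hσ : σ.Regular C) {i : I} {X Y T : Form {p : Pr // rk p = r} I J}
    (h : (σ.mu (.prod i X Y)).1 = (σ.mu T).1) : ∃ X' Y', T = .prod i X' Y' ∧
      ((σ.mu X).1 = (σ.mu X').1 ∧ (σ.mu Y).1 = (σ.mu Y').1 ∨
        i ∈ C ∧ (σ.mu X).1 = (σ.mu Y').1 ∧ (σ.mu Y).1 = (σ.mu X').1) := by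
  obtain ⟨e₀, he₀, he₀'⟩ := (hσ.bin i).edge
  cases T with
  | prim q => exact nomatch (Quotient.exact h : PreFormula.Equiv _ _)
  | under i X Y => exact nomatch (Quotient.exact h : PreFormula.Equiv _ _)
  | box i X => exact nomatch (Quotient.exact h : PreFormula.Equiv _ _)
  | dia j Z =>
    obtain ⟨e₁, he₁, he₁'⟩ := (hσ.un j).edge
    obtain ⟨f, g, h1, h2, h3⟩ := (Formula.times_eq_times_iff _ _).1 h
    have hl := h2 (.inl e₀)
    generalize g (.inl e₀) = t at hl
    rcases t with e | s
    · rw [he₁ e] at hl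
      exact absurd (Formula.prim_injective (he₀'.symm.trans (hl.symm.trans he₁'))) (hσ.mode_ne i j)
    · exact absurd (he₀'.symm.trans hl.symm) (hσ.prim_mode_ne i Z)
  | prod i' X' Y' =>
    obtain ⟨e₁, he₁, he₁'⟩ := (hσ.bin i').edge
    obtain ⟨f, g, h1, h2, h3⟩ := (Formula.times_eq_times_iff _ _).1 h
    have hlab : ∀ s : Fin 2, ∃ B, (![(σ.mu X').1, (σ.mu Y').1] : Fin 2 → _) s = (σ.mu B).1 := by
      intro s; fin_cases s; exacts [⟨X', rfl⟩, ⟨Y', rfl⟩]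
    have hg : ∃ e, g (.inl e₀) = .inl e := by
      have hl := h2 (.inl e₀)
      generalize g (.inl e₀) = t at hl
      rcases t with e | s
      · exact ⟨e, rfl⟩
      · obtain ⟨B, hB⟩ := hlab s
        exact absurd (he₀'.symm.trans (hl.symm.trans hB)) (hσ.prim_mode_ne i B)
    obtain ⟨e, he⟩ := hg
    obtain rfl : i = i' := by
      have hl := h2 (.inl e₀)
      rw [he, he₁ e] at hl
      exact hσ.mode_inj (Formula.prim_injective (he₀'.symm.trans (hl.symm.trans he₁')))
    have hf : ∀ v, f v = v := (hσ.bin i).eq_id (fun e' => by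
      have := h1 (.inl e₀)
      rw [he, he₀ e] at this
      rwa [he₀ e']) h3
    have hf' : ∀ l : List (σ.bin i).V, l.map f = l := fun l => by
      conv_rhs => rw [← List.map_id l]
      exact List.map_congr_left fun v _ => hf v
    have hg : ∀ s, ∃ s', g (.inr s) = .inr s' := fun s => by
      generalize ht : g (.inr s) = t
      rcases t with e' | s'
      · rw [he₀ e', ← he₀ e, ← he] at ht
        cases g.injective ht
      · exact ⟨s', rfl⟩
    choose π hπ using hg
    have hinj : π 0 ≠ π 1 := fun h => by
      have := (hπ 0).trans ((congrArg Sum.inr h).trans (hπ 1).symm)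
      exact absurd (Sum.inr.inj (g.injective this)) (by decide)
    have a0 := h1 (.inr 0)
    have a1 := h1 (.inr 1)
    have l0 := h2 (.inr 0)
    have l1 := h2 (.inr 1)
    rw [hπ] at a0 a1 l0 l1
    change (σ.bin i).hole (π 0) = ((σ.bin i).hole 0).map f at a0
    change (![(σ.mu X').1, (σ.mu Y').1] : Fin 2 → _) (π 0) = (σ.mu X).1 at l0
    change (![(σ.mu X').1, (σ.mu Y').1] : Fin 2 → _) (π 1) = (σ.mu Y).1 at l1
    rw [hf'] at a0
    refine ⟨X', Y', rfl, ?_⟩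
    have : π 0 = 0 ∧ π 1 = 1 ∨ π 0 = 1 ∧ π 1 = 0 := by omega
    rcases this with ⟨h0, h1⟩ | ⟨h0, h1⟩ <;> rw [h0] at a0 l0 <;> rw [h1] at l1
    · exact .inl ⟨l0.symm, l1.symm⟩
    · exact .inr ⟨(hσ.comm i).2 a0.symm, l0.symm, l1.symm⟩
  | _ =>
    rename_i i X Y
    exact nomatch (Quotient.exact h : PreFormula.Equiv _ _)

theorem mu_dia_eq (hσ : σ.Regular C) {j : J} {X T : Form {p : Pr // rk p = r} I J}
    (h : (σ.mu (.dia j X)).1 = (σ.mu T).1) : ∃ X', T = .dia j X' ∧ (σ.mu X).1 = (σ.mu X').1 := by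
  obtain ⟨e₀, he₀, he₀'⟩ := (hσ.un j).edge
  cases T with
  | prim q => exact nomatch (Quotient.exact h : PreFormula.Equiv _ _)
  | under i X Y => exact nomatch (Quotient.exact h : PreFormula.Equiv _ _)
  | box i X => exact nomatch (Quotient.exact h : PreFormula.Equiv _ _)
  | prod i Z Y =>
    obtain ⟨X', Y', h, _⟩ := mu_prod_eq hσ h.symm
    cases h
  | dia j' Z =>
    obtain ⟨e₁, he₁, he₁'⟩ := (hσ.un j').edge
    obtain ⟨f, g, h1, h2, h3⟩ := (Formula.times_eq_times_iff _ _).1 h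
    have hg : ∃ e, g (.inl e₀) = .inl e := by
      have hl := h2 (.inl e₀)
      generalize g (.inl e₀) = t at hl
      rcases t with e | s
      · exact ⟨e, rfl⟩
      · exact absurd (he₀'.symm.trans hl.symm) (hσ.prim_modality_ne j Z)
    obtain ⟨e, he⟩ := hg
    obtain rfl : j = j' := by
      have hl := h2 (.inl e₀)
      rw [he, he₁ e] at hl
      exact hσ.modality_inj (Formula.prim_injective (he₀'.symm.trans (hl.symm.trans he₁')))
    have l0 := h2 (.inr ())
    generalize ht : g (.inr ()) = t at l0
    rcases t with e' | s'
    · rw [he₀ e', ← he₀ e, ← he] at ht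
      cases g.injective ht
    · exact ⟨Z, rfl, l0.symm⟩
  | _ =>
    rename_i i X Y
    exact nomatch (Quotient.exact h : PreFormula.Equiv _ _)

/-- The denominator of a box contains only a modality, whereas that of a binary division contains a
mode and a formula, so the modality would have nowhere to go. -/
theorem mu_box_eq (hσ : σ.Regular C) {j : J} {X T : Form {p : Pr // rk p = r} I J}
    (h : (σ.mu (.box j X)).1 = (σ.mu T).1) : ∃ X', T = .box j X' ∧ (σ.mu X).1 = (σ.mu X').1 := by
  obtain ⟨e₀, he₀, he₀'⟩ := (hσ.un j).edge
  have key : ∀ i s (B : Form {p : Pr // rk p = r} I J) hB (g : (σ.un j).E ≃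
      ((σ.bin i).labelExcept s (σ.mu B).1 hB).E),
      (∀ e, ((σ.bin i).labelExcept s (σ.mu B).1 hB).lab (g e) = (σ.un j).lab e) → False := by
    intro i s B hB g h2
    obtain ⟨e₁, he₁, he₁'⟩ := (hσ.bin i).edge
    have hl := h2 e₀
    generalize g e₀ = t at hl
    rcases t with e | s
    · rw [he₁ e] at hl
      exact hσ.mode_ne i j (Formula.prim_injective (he₁'.symm.trans (hl.trans he₀')))
    · exact hσ.prim_modality_ne j B (he₀'.symm.trans hl.symm)
  cases T with
  | prim q => exact nomatch (Quotient.exact h : PreFormula.Equiv _ _)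
  | prod i X Y => exact nomatch (Quotient.exact h : PreFormula.Equiv _ _)
  | dia i X => exact nomatch (Quotient.exact h : PreFormula.Equiv _ _)
  | under i Y Z =>
    simp only [mu_under, mu_box] at h
    obtain ⟨h0, f, g, h1, h2, h3, h4⟩ := (Formula.div_eq_div_iff _ _ _ _ _ _).1 h
    exact (key _ _ _ _ g h2).elim
  | box j' Z =>
    obtain ⟨e₁, he₁, he₁'⟩ := (hσ.un j').edge
    simp only [mu_box] at h
    obtain ⟨h0, f, g, h1, h2, h3, h4⟩ := (Formula.div_eq_div_iff _ _ _ _ _ _).1 h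
    have hl := h2 e₀
    rw [he₁ (g e₀)] at hl
    obtain rfl := hσ.modality_inj (Formula.prim_injective (he₁'.symm.trans (hl.trans he₀')))
    exact ⟨Z, rfl, h0⟩
  | _ =>
    rename_i i Z Y
    simp only [mu_over, mu_box] at h
    obtain ⟨h0, f, g, h1, h2, h3, h4⟩ := (Formula.div_eq_div_iff _ _ _ _ _ _).1 h
    exact (key _ _ _ _ g h2).elim

/-- The translations of `B \ A` and `A / B` are the same only if they are translations of the same
formulas, up to the exchange of the holes in a commutative mode. -/
theorem labelExcept_eq (hσ : σ.Regular C) {i i' : I} {s s' : Fin 2}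
    {X Y X' Y' : Form {p : Pr // rk p = r} I J} {h₁ h₂ h₃ h₄}
    (h : Formula.div (σ.mu X).1 ((σ.bin i).labelExcept s (σ.mu Y).1 h₁) h₂ =
      Formula.div (σ.mu X').1 ((σ.bin i').labelExcept s' (σ.mu Y').1 h₃) h₄) :
    i = i' ∧ (σ.mu X).1 = (σ.mu X').1 ∧ (σ.mu Y).1 = (σ.mu Y').1 ∧ (s = s' ∨ i ∈ C) := by
  obtain ⟨e₀, he₀, he₀'⟩ := (hσ.bin i).edge
  obtain ⟨e₁, he₁, he₁'⟩ := (hσ.bin i').edge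
  obtain ⟨h0, f, g, h1, h2, h3, h4⟩ := (Formula.div_eq_div_iff _ _ _ _ _ _).1 h
  have hg : ∃ e, g (.inl e₀) = .inl e := by
    have hl := h2 (.inl e₀)
    generalize g (.inl e₀) = t at hl
    rcases t with e | s
    · exact ⟨e, rfl⟩
    · exact absurd (he₀'.symm.trans hl.symm) (hσ.prim_mode_ne i Y')
  obtain ⟨e, he⟩ := hg
  obtain rfl : i = i' := by
    have hl := h2 (.inl e₀)
    rw [he, he₁ e] at hl
    exact hσ.mode_inj (Formula.prim_injective (he₀'.symm.trans (hl.symm.trans he₁')))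
  have hf : ∀ v, f v = v := (hσ.bin i).eq_id (fun e' => by
    have := h1 (.inl e₀)
    rw [he, he₀ e] at this
    rwa [he₀ e']) h3
  refine ⟨rfl, h0, ?_, ?_⟩
  -- The slot other than `s` carries the label `σ.mu Y`. It cannot be sent to the mode hyperedge,
  -- which is already taken.
  · obtain ⟨t, ht⟩ : ∃ t : Fin 2, t ≠ s := exists_ne s
    have l0 := h2 (.inr ⟨t, ht⟩)
    generalize ht' : g (.inr ⟨t, ht⟩) = t' at l0
    rcases t' with e' | s'
    · rw [he₀ e', ← he₀ e, ← he] at ht'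
      cases g.injective ht'
    · exact l0.symm
  · by_cases hs : s = s'
    · exact .inl hs
    -- The nodes are fixed, so the open holes `s` and `s'` have equal attachments; being different,
    -- they witness commutativity.
    · right
      have h4 : (σ.bin i).hole s' = ((σ.bin i).hole s).map f := h4
      have : ((σ.bin i).hole s).map f = (σ.bin i).hole s := by
        conv_rhs => rw [← List.map_id ((σ.bin i).hole s)]
        exact List.map_congr_left fun v _ => hf v
      rw [this] at h4
      refine (hσ.comm i).2 ?_
      have : s = 0 ∧ s' = 1 ∨ s = 1 ∧ s' = 0 := by omega
      rcases this with ⟨rfl, rfl⟩ | ⟨rfl, rfl⟩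
      exacts [h4.symm, h4]

theorem mu_under_eq (hσ : σ.Regular C) {i : I} {X Y T : Form {p : Pr // rk p = r} I J}
    (h : (σ.mu (.under i Y X)).1 = (σ.mu T).1) : ∃ X' Y', (T = .under i Y' X' ∨
      i ∈ C ∧ T = .over i X' Y') ∧ (σ.mu X).1 = (σ.mu X').1 ∧ (σ.mu Y).1 = (σ.mu Y').1 := by
  cases T with
  | prim q => exact nomatch (Quotient.exact h : PreFormula.Equiv _ _)
  | prod i X Y => exact nomatch (Quotient.exact h : PreFormula.Equiv _ _)
  | dia i X => exact nomatch (Quotient.exact h : PreFormula.Equiv _ _)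
  | under i' Y' X' =>
    simp only [mu_under] at h
    obtain ⟨rfl, h1, h2, -⟩ := labelExcept_eq hσ h
    exact ⟨X', Y', .inl rfl, h1, h2⟩
  | box j' Z =>
    obtain ⟨_, h, _⟩ := mu_box_eq hσ h.symm
    cases h
  | _ =>
    rename_i i' X' Y'
    simp only [mu_under, mu_over] at h
    obtain ⟨rfl, h1, h2, h3⟩ := labelExcept_eq hσ h
    exact ⟨X', Y', .inr ⟨h3.resolve_left (by decide), rfl⟩, h1, h2⟩

theorem mu_over_eq (hσ : σ.Regular C) {i : I} {X Y T : Form {p : Pr // rk p = r} I J}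
    (h : (σ.mu (.over i X Y)).1 = (σ.mu T).1) : ∃ X' Y', (T = .over i X' Y' ∨
      i ∈ C ∧ T = .under i Y' X') ∧ (σ.mu X).1 = (σ.mu X').1 ∧ (σ.mu Y).1 = (σ.mu Y').1 := by
  cases T with
  | prim q => exact nomatch (Quotient.exact h : PreFormula.Equiv _ _)
  | prod i X Y => exact nomatch (Quotient.exact h : PreFormula.Equiv _ _)
  | dia i X => exact nomatch (Quotient.exact h : PreFormula.Equiv _ _)
  | under i' Y' X' =>
    simp only [mu_under, mu_over] at h
    obtain ⟨rfl, h1, h2, h3⟩ := labelExcept_eq hσ h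
    exact ⟨X', Y', .inr ⟨h3.resolve_left (by decide), rfl⟩, h1, h2⟩
  | box j' Z =>
    obtain ⟨_, h, _⟩ := mu_box_eq hσ h.symm
    cases h
  | _ =>
    rename_i i' X' Y'
    simp only [mu_over] at h
    obtain ⟨rfl, h1, h2, h3⟩ := labelExcept_eq hσ h
    exact ⟨X', Y', .inl rfl, h1, h2⟩

/-! ## Structural equivalence -/

/-- The expansion of the identity axiom along the formula, with commutativity inserted wherever the
translation has confused the order of arguments. -/
theorem derivable_of_mu_eq (hσ : σ.Regular C) {X T : Form {p : Pr // rk p = r} I J}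
    (h : (σ.mu X).1 = (σ.mu T).1) :
    NLM.Derivable C A (.form X) T ∧ NLM.Derivable C A (.form T) X := by
  induction X generalizing T with
  | prim p => obtain rfl := mu_prim_eq h; exact ⟨.ax _, .ax _⟩
  | prod i X Y ihX ihY =>
    obtain ⟨X', Y', rfl, ⟨h1, h2⟩ | ⟨hi, h1, h2⟩⟩ := mu_prod_eq hσ h
    · exact ⟨.prodL i .here _ _ _ (.prodR _ _ _ _ _ (ihX h1).1 (ihY h2).1),
        .prodL i .here _ _ _ (.prodR _ _ _ _ _ (ihX h1).2 (ihY h2).2)⟩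
    · exact ⟨.prodL i .here _ _ _ (.comm i hi .here _ _ _ (.prodR _ _ _ _ _ (ihY h2).1 (ihX h1).1)),
        .prodL i .here _ _ _ (.comm i hi .here _ _ _ (.prodR _ _ _ _ _ (ihX h1).2 (ihY h2).2))⟩
  | under i Y X ihY ihX =>
    obtain ⟨X', Y', rfl | ⟨hi, rfl⟩, h1, h2⟩ := mu_under_eq hσ h
    · exact ⟨.underR _ _ _ _ (.underL i .here _ _ _ _ (ihX h1).1 (ihY h2).2),
        .underR _ _ _ _ (.underL i .here _ _ _ _ (ihX h1).2 (ihY h2).1)⟩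
    · exact ⟨.overR _ _ _ _ (.comm i hi .here _ _ _
          (.underL i .here _ _ _ _ (ihX h1).1 (ihY h2).2)),
        .underR _ _ _ _ (.comm i hi .here _ _ _
          (.overL i .here _ _ _ _ (ihX h1).2 (ihY h2).1))⟩
  | dia j X ih =>
    obtain ⟨X', rfl, h1⟩ := mu_dia_eq hσ h
    exact ⟨.diaL j .here _ _ (.diaR _ _ _ (ih h1).1), .diaL j .here _ _ (.diaR _ _ _ (ih h1).2)⟩
  | box j X ih =>
    obtain ⟨X', rfl, h1⟩ := mu_box_eq hσ h
    exact ⟨.boxR _ _ _ (.boxL j .here _ _ (ih h1).1), .boxR _ _ _ (.boxL j .here _ _ (ih h1).2)⟩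
  | _ =>
    rename_i i X Y ihX ihY
    obtain ⟨X', Y', rfl | ⟨hi, rfl⟩, h1, h2⟩ := mu_over_eq hσ h
    · exact ⟨.overR _ _ _ _ (.overL i .here _ _ _ _ (ihX h1).1 (ihY h2).2),
        .overR _ _ _ _ (.overL i .here _ _ _ _ (ihX h1).2 (ihY h2).1)⟩
    · exact ⟨.underR _ _ _ _ (.comm i hi .here _ _ _
          (.overL i .here _ _ _ _ (ihX h1).1 (ihY h2).2)),
        .overR _ _ _ _ (.comm i hi .here _ _ _
          (.underL i .here _ _ _ _ (ihX h1).2 (ihY h2).1))⟩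

variable (σ) in
/-- The structured databases differ only in formulas with the same translation. -/
inductive LeafEq : Struct {p : Pr // rk p = r} I J → Struct {p : Pr // rk p = r} I J → Prop
  | form {X Y} (h : (σ.mu X).1 = (σ.mu Y).1) : LeafEq (.form X) (.form Y)
  | pair {i S T S' T'} : LeafEq S S' → LeafEq T T' → LeafEq (.pair i S T) (.pair i S' T')
  | brac {j S S'} : LeafEq S S' → LeafEq (.brac j S) (.brac j S')

theorem LeafEq.refl (S : Struct {p : Pr // rk p = r} I J) : σ.LeafEq S S := by
  induction S with
  | form X => exact .form rfl
  | pair i S T h h' => exact .pair h h'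
  | brac j S h => exact .brac h

theorem LeafEq.symm {S T : Struct {p : Pr // rk p = r} I J} (h : σ.LeafEq S T) :
    σ.LeafEq T S := by
  induction h with
  | form h => exact .form h.symm
  | pair _ _ h h' => exact .pair h h'
  | brac _ h => exact .brac h

theorem LeafEq.plug {S T : Struct {p : Pr // rk p = r} I J} (h : σ.LeafEq S T)
    (D : Ctx {p : Pr // rk p = r} I J) : σ.LeafEq (D.plug S) (D.plug T) := by
  induction D with
  | here => exact h
  | pairL i D S ih => exact .pair ih (.refl _)
  | pairR i S D ih => exact .pair (.refl _) ih
  | brac j D ih => exact .brac ih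

theorem LeafEq.exists_plug {D : Ctx {p : Pr // rk p = r} I J}
    {S Q : Struct {p : Pr // rk p = r} I J} (h : σ.LeafEq (D.plug S) Q) :
    ∃ D' S', Q = Ctx.plug D' S' ∧ σ.LeafEq S S' ∧
      ∀ R R', σ.LeafEq R R' → σ.LeafEq (D.plug R) (D'.plug R') := by
  induction D generalizing Q with
  | here => exact ⟨.here, Q, rfl, h, fun _ _ h => h⟩
  | pairL i D S ih =>
    cases h with
    | pair h h' =>
      obtain ⟨D', S', rfl, h1, h2⟩ := ih h
      exact ⟨.pairL i D' _, S', rfl, h1, fun R R' h => .pair (h2 _ _ h) h'⟩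
  | pairR i S D ih =>
    cases h with
    | pair h' h =>
      obtain ⟨D', S', rfl, h1, h2⟩ := ih h
      exact ⟨.pairR i _ D', S', rfl, h1, fun R R' h => .pair h' (h2 _ _ h)⟩
  | brac j D ih =>
    cases h with
    | brac h =>
      obtain ⟨D', S', rfl, h1, h2⟩ := ih h
      exact ⟨.brac j D', S', rfl, h1, fun R R' h => .brac (h2 _ _ h)⟩

/-- No cut is needed. A formula with the same translation as the principal formula has the same
connective, or its mirror image in a commutative mode, and components with the same translations.
Thus every rule can be repeated, with an exchange if necessary, and the axioms are handled by
`derivable_of_mu_eq`. -/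
theorem derivable_of_leafEq (hσ : σ.Regular C) {S : Struct {p : Pr // rk p = r} I J}
    {T : Form {p : Pr // rk p = r} I J} (h : NLM.Derivable C A S T) :
    ∀ {S' T'}, σ.LeafEq S S' → (σ.mu T).1 = (σ.mu T').1 → NLM.Derivable C A S' T' := by
  induction h with
  | ax X =>
    intro S' T' h h'
    cases h with
    | form h => exact (derivable_of_mu_eq hσ (h.symm.trans h')).1
  | prodL i D X Y Z _ ih =>
    intro S' T' h h'
    obtain ⟨D', _, rfl, h1, h2⟩ := h.exists_plug
    cases h1 with
    | form h1 =>
      obtain ⟨X', Y', rfl, ⟨h3, h4⟩ | ⟨hi, h3, h4⟩⟩ := mu_prod_eq hσ h1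
      · exact .prodL i D' _ _ _ (ih (h2 _ _ (.pair (.form h3) (.form h4))) h')
      · exact .prodL i D' _ _ _ (.comm i hi _ _ _ _ (ih (h2 _ _ (.pair (.form h3) (.form h4))) h'))
  | prodR i S T X Y _ _ ihX ihY =>
    intro S' T' h h'
    cases h with
    | pair h1 h2 =>
      obtain ⟨X', Y', rfl, ⟨h3, h4⟩ | ⟨hi, h3, h4⟩⟩ := mu_prod_eq hσ h'
      · exact .prodR _ _ _ _ _ (ihX h1 h3) (ihY h2 h4)
      · exact .comm i hi .here _ _ _ (.prodR _ _ _ _ _ (ihY h2 h4) (ihX h1 h3))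
  | underL i D S X Y Z _ _ ih ih' =>
    intro S' T' h h'
    obtain ⟨D', _, rfl, h1, h2⟩ := h.exists_plug
    cases h1 with
    | pair h1 h1' =>
      cases h1' with
      | form h1' =>
        obtain ⟨X', Y', rfl | ⟨hi, rfl⟩, h3, h4⟩ := mu_under_eq hσ h1'
        · exact .underL i D' _ _ _ _ (ih (h2 _ _ (.form h3)) h') (ih' h1 h4)
        · exact .comm i hi _ _ _ _ (.overL i D' _ _ _ _ (ih (h2 _ _ (.form h3)) h') (ih' h1 h4))
  | underR i S X Y _ ih =>
    intro S' T' h h'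
    obtain ⟨X', Y', rfl | ⟨hi, rfl⟩, h3, h4⟩ := mu_under_eq hσ h'
    · exact .underR _ _ _ _ (ih (.pair (.form h4) h) h3)
    · exact .overR _ _ _ _ (.comm i hi .here _ _ _ (ih (.pair (.form h4) h) h3))
  | overL i D S X Y Z _ _ ih ih' =>
    intro S' T' h h'
    obtain ⟨D', _, rfl, h1, h2⟩ := h.exists_plug
    cases h1 with
    | pair h1' h1 =>
      cases h1' with
      | form h1' =>
        obtain ⟨X', Y', rfl | ⟨hi, rfl⟩, h3, h4⟩ := mu_over_eq hσ h1'
        · exact .overL i D' _ _ _ _ (ih (h2 _ _ (.form h3)) h') (ih' h1 h4)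
        · exact .comm i hi _ _ _ _ (.underL i D' _ _ _ _ (ih (h2 _ _ (.form h3)) h') (ih' h1 h4))
  | overR i S X Y _ ih =>
    intro S' T' h h'
    obtain ⟨X', Y', rfl | ⟨hi, rfl⟩, h3, h4⟩ := mu_over_eq hσ h'
    · exact .overR _ _ _ _ (ih (.pair h (.form h4)) h3)
    · exact .underR _ _ _ _ (.comm i hi .here _ _ _ (ih (.pair h (.form h4)) h3))
  | diaL j D X Z _ ih =>
    intro S' T' h h'
    obtain ⟨D', _, rfl, h1, h2⟩ := h.exists_plug
    cases h1 with
    | form h1 =>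
      obtain ⟨X', rfl, h3⟩ := mu_dia_eq hσ h1
      exact .diaL j D' _ _ (ih (h2 _ _ (.brac (.form h3))) h')
  | diaR j S X _ ih =>
    intro S' T' h h'
    cases h with
    | brac h =>
      obtain ⟨X', rfl, h3⟩ := mu_dia_eq hσ h'
      exact .diaR _ _ _ (ih h h3)
  | boxL j D X Z _ ih =>
    intro S' T' h h'
    obtain ⟨D', _, rfl, h1, h2⟩ := h.exists_plug
    cases h1 with
    | brac h1 =>
      cases h1 with
      | form h1 =>
        obtain ⟨X', rfl, h3⟩ := mu_box_eq hσ h1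
        exact .boxL j D' _ _ (ih (h2 _ _ (.form h3)) h')
  | boxR j S X _ ih =>
    intro S' T' h h'
    obtain ⟨X', rfl, h3⟩ := mu_box_eq hσ h'
    exact .boxR _ _ _ (ih (.brac h) h3)
  | comm c hc D S T Z _ ih =>
    intro S' T' h h'
    obtain ⟨D', _, rfl, h1, h2⟩ := h.exists_plug
    cases h1 with
    | pair h1 h1' => exact .comm c hc _ _ _ _ (ih (h2 _ _ (.pair h1' h1)) h')
  | assocL a ha D S T U Z _ ih =>
    intro S' T' h h'
    obtain ⟨D', _, rfl, h1, h2⟩ := h.exists_plug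
    cases h1 with
    | pair h1 h1' =>
      cases h1 with
      | pair h1 h1'' =>
        exact .assocL a ha _ _ _ _ _ (ih (h2 _ _ (.pair h1 (.pair h1'' h1'))) h')
  | assocR a ha D S T U Z _ ih =>
    intro S' T' h h'
    obtain ⟨D', _, rfl, h1, h2⟩ := h.exists_plug
    cases h1 with
    | pair h1 h1' =>
      cases h1' with
      | pair h1' h1'' =>
        exact .assocR a ha _ _ _ _ _ (ih (h2 _ _ (.pair (.pair h1 h1') h1'')) h')

variable (σ C A) in
/-- Equivalence up to the structural rules and to formulas with the same translation. -/
inductive StructEq : Struct {p : Pr // rk p = r} I J → Struct {p : Pr // rk p = r} I J → Prop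
  | form {X Y} (h : (σ.mu X).1 = (σ.mu Y).1) : StructEq (.form X) (.form Y)
  | pair {i S T S' T'} : StructEq S S' → StructEq T T' → StructEq (.pair i S T) (.pair i S' T')
  | brac {j S S'} : StructEq S S' → StructEq (.brac j S) (.brac j S')
  | comm {i} (hi : i ∈ C) (S T) : StructEq (.pair i S T) (.pair i T S)
  | assoc {i} (hi : i ∈ A) (S T U) :
      StructEq (.pair i S (.pair i T U)) (.pair i (.pair i S T) U)
  | symm {S T} : StructEq S T → StructEq T S
  | trans {S T U} : StructEq S T → StructEq T U → StructEq S U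

theorem StructEq.refl (S : Struct {p : Pr // rk p = r} I J) : σ.StructEq C A S S := by
  induction S with
  | form X => exact .form rfl
  | pair i S T h h' => exact .pair h h'
  | brac j S h => exact .brac h

theorem StructEq.plug {S T : Struct {p : Pr // rk p = r} I J} (h : σ.StructEq C A S T)
    (D : Ctx {p : Pr // rk p = r} I J) : σ.StructEq C A (D.plug S) (D.plug T) := by
  induction D with
  | here => exact h
  | pairL i D S ih => exact .pair ih (.refl _)
  | pairR i S D ih => exact .pair (.refl _) ih
  | brac j D ih => exact .brac ih

/-- The surrounding context is arbitrary so that congruence goes through by induction: the arguments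
of a pair are changed one after the other, the unchanged one being moved into the context. -/
theorem StructEq.derivable_plug_iff (hσ : σ.Regular C) {S T : Struct {p : Pr // rk p = r} I J}
    (h : σ.StructEq C A S T) (D : Ctx {p : Pr // rk p = r} I J)
    (Z : Form {p : Pr // rk p = r} I J) :
    NLM.Derivable C A (D.plug S) Z ↔ NLM.Derivable C A (D.plug T) Z := by
  induction h generalizing D with
  | form h =>
    exact ⟨fun h' => derivable_of_leafEq hσ h' ((LeafEq.form h).plug D) rfl,
      fun h' => derivable_of_leafEq hσ h' ((LeafEq.form h).symm.plug D) rfl⟩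
  | @pair i S T S' T' _ _ h h' =>
    have h1 := h (D.comp (.pairL i .here T))
    have h2 := h' (D.comp (.pairR i S' .here))
    simp only [Ctx.plug_comp, Ctx.plug] at h1 h2
    exact h1.trans h2
  | @brac j S S' _ h =>
    have h1 := h (D.comp (.brac j .here))
    simpa only [Ctx.plug_comp, Ctx.plug] using h1
  | comm hi S T => exact ⟨.comm _ hi _ _ _ _, .comm _ hi _ _ _ _⟩
  | assoc hi S T U => exact ⟨.assocL _ hi _ _ _ _ _, .assocR _ hi _ _ _ _ _⟩
  | symm _ h => exact (h D).symm
  | trans _ _ h h' => exact (h D).trans (h' D)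

theorem StructEq.derivable (hσ : σ.Regular C) {S T : Struct {p : Pr // rk p = r} I J}
    (h : σ.StructEq C A S T) {Z : Form {p : Pr // rk p = r} I J}
    (h' : NLM.Derivable C A S Z) : NLM.Derivable C A T Z :=
  (h.derivable_plug_iff hσ .here Z).1 h'

end Shapes
end
end HL

namespace HL
open NLM (Struct Form Ctx)

section
variable {Pr : Type u} {rk : Pr → ℕ} {I J : Type} {r : ℕ}

/-! ## Replacement of one hyperedge -/

namespace Context
variable {L : Type v} {lrk : L → ℕ} {K : Context L lrk Unit} {H : Hypergraph L lrk}

theorem full_slots : (K.edges.map Sum.inl + {Sum.inr ()} : Multiset (K.E ⊕ Unit)).Full := by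
  refine ⟨?_, ?_⟩
  · rw [Multiset.nodup_add]
    exact ⟨K.edges_full.1.map Sum.inl_injective, Multiset.nodup_singleton _, by simp⟩
  · rintro (e | s)
    · simpa using K.mem_edges e
    · simp

theorem edges_fill_unit : (K.fill fun _ => H).edges =
    K.edges.map Sum.inl + H.edges.map fun e => Sum.inr ⟨(), e⟩ := by
  rw [edges_fill full_slots, Multiset.add_bind, Multiset.singleton_bind]
  congr 1
  rw [Multiset.bind, Multiset.map_map]
  exact Multiset.bind_singleton _ _

theorem inner_fill_unit (hH : H.ext.Nodup) (hl : (K.hole ()).length = H.ext.length) :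
    (K.fill fun _ => H).inner = K.inner.map (K.outer _) + H.inner.map (K.inserted _ ()) := by
  rw [inner_fill (fun _ => hH) (fun _ => hl) full_slots, Multiset.add_bind,
    Multiset.singleton_bind]
  congr 1
  rw [Multiset.bind, Multiset.map_map]
  have : (K.edges.map ((K.slotInner fun _ => H) ∘ Sum.inl)).join = 0 := by
    rw [← Multiset.bind, Multiset.eq_zero_iff_forall_notMem]
    intro x hx
    obtain ⟨e, _, he⟩ := Multiset.mem_bind.1 hx
    simp [slotInner] at he
  rw [this, zero_add]
  rfl

end Context

namespace Shapes
variable {σ : Shapes rk I J r} {C A : Set I} {G : Graph rk}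

theorem FullCtx.fill {K : GraphContext rk Unit} {D : Ctx {p : Pr // rk p = r} I J}
    (hD : σ.FullCtx K D) {H : Graph rk} {Q : Struct {p : Pr // rk p = r} I J}
    (hH : σ.FullRep H Q) (hl : (K.hole ()).length = H.ext.length) :
    σ.FullRep (K.fill fun _ => H) (D.plug Q) := by
  refine ⟨Context.nodup_ext_fill (fun _ => hH.1) hD.1, rep_plug.2 ?_⟩
  refine ⟨_, _, _, _, _, hD.2.map Context.isHom_outer, ?_, Context.edges_fill_unit,
    Context.inner_fill_unit hH.1 hl⟩
  rw [Context.map_hole hl]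
  exact hH.2.map (Context.isHom_inserted ())

/-- The hyperedges and inner nodes of `M` are cancelled from both sides of the multiset equations.
What is left lies in the image of `K`, which is embedded, so the representation can be pulled back.
-/
theorem FullCtx.of_fill {K : GraphContext rk Unit} {D : Ctx {p : Pr // rk p = r} I J}
    {M : Graph rk} (hM : M.ext.Nodup) (hl : (K.hole ()).length = M.ext.length)
    (hK : (K.fill fun _ => M).ext.Nodup)
    {es : Multiset (K.fill fun _ => M).E} {vs : Multiset (K.fill fun _ => M).V}
    {y : List (K.fill fun _ => M).V} (h : σ.RepCtx (K.fill fun _ => M) D es vs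
      (K.fill fun _ => M).ext y) (hy : y = M.ext.map (K.inserted _ ()))
    (hes : (K.fill fun _ => M).edges = es +
      (M.edges.map fun e => Sum.inr ⟨(), e⟩ : Multiset (K.fill fun _ => M).E))
    (hvs : (K.fill fun _ => M).inner = vs + M.inner.map (K.inserted _ ())) : σ.FullCtx K D := by
  rw [Context.edges_fill_unit] at hes
  rw [Context.inner_fill_unit hM hl] at hvs
  obtain rfl := Multiset.add_left_inj.1 hes
  obtain rfl := Multiset.add_left_inj.1 hvs
  have hinj : Function.Injective (K.outer fun _ => M) := Context.outer_injective fun _ => hM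
  subst hy
  rw [← Context.map_hole (H := fun _ => M) hl] at h
  change σ.RepCtx _ D _ _ (K.ext.map (K.outer _)) _ at h
  obtain ⟨es₀, vs₀, x₀, y₀, h1, h2, h3, h4, h5⟩ := h.comap
    (Context.isHom_outer (K := K) (H := fun _ => M)) hinj
    (fun e he => by obtain ⟨e, _, rfl⟩ := Multiset.mem_map.1 he; exact ⟨e, rfl⟩)
    (fun e he => by obtain ⟨e, _, rfl⟩ := Multiset.mem_map.1 he; exact ⟨e, rfl⟩)
    (fun e he => by obtain ⟨e, _, rfl⟩ := List.mem_map.1 he; exact ⟨e, rfl⟩)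
  obtain rfl := Multiset.map_injective Sum.inl_injective h1
  obtain rfl := Multiset.map_injective hinj h2
  obtain rfl := hinj.list_map h3
  obtain rfl := hinj.list_map h4
  exact ⟨List.Nodup.of_map _ hK, h5⟩

/-- The counterpart for the inserted hypergraph. The two conditions comparing `vs` with the outer
nodes say that `vs` consists of the nodes of the filled hypergraph that do not come from `K`; these
are the images of the inner nodes of `F`. -/
theorem FullRep.of_fill {K : GraphContext rk Unit} {F : Graph rk} (hh : (K.hole ()).Nodup)
    (hl : (K.hole ()).length = F.ext.length) {Q : Struct {p : Pr // rk p = r} I J}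
    {vs : Multiset (K.fill fun _ => F).V}
    (h : σ.Rep (K.fill fun _ => F) Q (F.edges.map fun e => Sum.inr ⟨(), e⟩) vs
      ((K.hole ()).map (K.outer _)))
    (hn : vs.Nodup) (hn' : ((K.hole ()).map (K.outer fun _ => F)).Nodup)
    (h1 : ∀ v, K.outer _ v ∉ vs) (h2 : ∀ x, x ∈ vs ∨ x ∈ Set.range (K.outer _)) :
    σ.FullRep F Q := by
  have hinj := Context.inserted_injective (F := F) hh
  rw [Context.map_hole hl] at h hn'
  obtain ⟨es₀, vs₀, x₀, h3, h4, h5, h6⟩ := h.comap (Context.isHom_inserted ()) hinj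
    (fun e he => by obtain ⟨e, _, rfl⟩ := Multiset.mem_map.1 he; exact ⟨e, rfl⟩)
    (fun x hx => by
      obtain ⟨v, rfl⟩ | ⟨s, w, rfl⟩ := K.node_cases _ x
      exacts [absurd hx (h1 v), ⟨w, rfl⟩])
    (fun e he => by obtain ⟨e, _, rfl⟩ := List.mem_map.1 he; exact ⟨e, rfl⟩)
  obtain rfl := Multiset.map_injective (fun e e' h => by simpa using Sum.inr.inj h) h3
  obtain rfl := hinj.list_map h5
  subst h4
  refine ⟨List.Nodup.of_map _ hn', ?_⟩
  rwa [Hypergraph.inner_eq (Multiset.Nodup.of_map _ hn)]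
  intro w
  constructor
  · intro hw hw'
    obtain ⟨v, hv⟩ := List.exists_mem_zip_of_mem_right hl hw'
    refine h1 v ?_
    rw [Context.outer_eq_inserted (H := fun _ => F) hv]
    exact Multiset.mem_map_of_mem _ hw
  · intro hw
    rcases h2 (K.inserted _ () w) with h | ⟨v, h⟩
    · exact (Multiset.mem_map_of_injective hinj).1 h
    · exact absurd (Context.mem_ext_of_inserted_eq_outer hh h.symm) hw

/-- The translation of the database with `W` in the hole has one hyperedge standing for `W`;
removing it and keeping its attachment as a hole gives the context. The formula `W` is only a
placeholder. -/
theorem exists_fullCtx (hσ : σ.Regular C) (D : Ctx {p : Pr // rk p = r} I J)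
    (W : Form {p : Pr // rk p = r} I J) :
    ∃ K : GraphContext rk Unit, σ.FullCtx K D ∧ (K.hole ()).length = r := by
  obtain ⟨hn, h⟩ := fullRep_tree hσ (D.plug (.form W))
  generalize σ.tree (D.plug (.form W)) = G at hn h
  obtain ⟨es, vs, _, _, _, h1, ⟨a, h2, rfl, rfl, rfl⟩, h3, h4⟩ := rep_plug.1 h
  let K : GraphContext rk Unit :=
    { V := G.V
      E := {e : G.E // e ≠ a}
      finV := inferInstance
      finE := inferInstance
      att := fun e => G.att e.1
      lab := fun e => G.lab e.1
      ext := G.ext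
      rk_lab := fun e => G.rk_lab e.1
      hole := fun _ => G.att a }
  have hK : IsHom K.toHypergraph G id Subtype.val := fun e => ⟨rfl, by simp [K]⟩
  have hd := G.edges_full
  rw [h3] at hd
  have hda := (Multiset.nodup_add.1 hd.1).2.2
  obtain ⟨es₀, vs₀, x₀, y₀, e1, e2, e3, e4, h5⟩ := h1.comap hK Function.injective_id
    (fun e he => ⟨⟨e, fun h => Multiset.disjoint_left.1 hda he (by simp [h])⟩, rfl⟩)
    (fun v _ => ⟨v, rfl⟩) (fun v _ => ⟨v, rfl⟩)
  simp only [Multiset.map_id, List.map_id] at e2 e3 e4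
  subst e2 e3 e4 e1
  refine ⟨K, ⟨hn, ?_⟩, ?_⟩
  · rw [K.edges_eq (s := es₀) ⟨Multiset.Nodup.of_map _ (Multiset.nodup_add.1 hd.1).1, fun e => ?_⟩]
    · rw [K.inner_eq (s := vs₀)]
      · exact h5
      · rw [add_zero] at h4
        exact h4 ▸ G.nodup_inner
      · intro v
        rw [add_zero] at h4
        rw [← h4]
        exact G.mem_inner v
    · have := (Multiset.mem_add.1 (hd.2 e.1)).resolve_right (by simpa using e.2)
      exact (Multiset.mem_map_of_injective Subtype.val_injective).1 this
  · change (G.att a).length = r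
    rw [← G.rk_lab, h2, (σ.mu W).2]

/-! ## Replacement of all hyperedges -/

theorem _root_.HL.IsHandle.length {X : Formula rk} (h : IsHandle G X) :
    G.ext.length = X.rank := by
  obtain ⟨_, _, e, _, h1, h2⟩ := h
  rw [← h2, ← G.rk_lab, h1]

/-- The case of `fullRep_fill_pair` in which all hyperedges are replaced, as in the right rule for ×
and in the left rule for ÷. The mode is then present through a handle. -/
theorem fullRep_frame_pair {S : Type} [Finite S] {K : GraphContext rk S} {H : S → Graph rk}
    (hσ : σ.Regular C) {i : I} (f : (σ.bin i).V ≃ K.V)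
    (hext : K.ext = (σ.bin i).ext.map f)
    {s₀ s₁ s₂ : S} (hK : IsEmpty K.E) (hs : ({s₀, s₁, s₂} : Multiset S).Full)
    (hm : IsHandle (H s₀) (.prim (σ.mode i))) (hma : ∀ e, K.hole s₀ = ((σ.bin i).att e).map f)
    {Q₁ Q₂ : Struct {p : Pr // rk p = r} I J}
    (h₁ : σ.FullRep (H s₁) Q₁) (ha₁ : K.hole s₁ = ((σ.bin i).hole 0).map f)
    (h₂ : σ.FullRep (H s₂) Q₂) (ha₂ : K.hole s₂ = ((σ.bin i).hole 1).map f) :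
    σ.FullRep (K.fill H) (.pair i Q₁ Q₂) := by
  have hall : ∀ s, (H s).ext.Nodup ∧ (K.hole s).length = (H s).ext.length := by
    intro s
    have := hs.2 s
    simp only [Multiset.insert_eq_cons, Multiset.mem_cons, Multiset.mem_singleton] at this
    rcases this with rfl | rfl | rfl
    · obtain ⟨e₀, _, he₀⟩ := (hσ.bin i).edge
      refine ⟨hm.1, ?_⟩
      rw [hma e₀, hm.length, List.length_map, ← (σ.bin i).rk_lab, he₀]
    · exact ⟨h₁.1, by rw [ha₁, List.length_map, σ.bin_hole, h₁.length]⟩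
    · exact ⟨h₂.1, by rw [ha₂, List.length_map, σ.bin_hole, h₂.length]⟩
  refine fullRep_fill_pair hσ (fun s => (hall s).1) (fun s => (hall s).2) f hext
    (t := .inr s₀) (t₁ := .inr s₁) (t₂ := .inr s₂) ⟨?_, ?_⟩ hm hma h₁ ha₁ h₂ ha₂
  · exact hs.1.map (f := Sum.inr) Sum.inr_injective
  · rintro (e | s)
    · exact hK.elim e
    · simpa using hs.2 s

theorem fullRep_frame_brac {S : Type} [Finite S] {K : GraphContext rk S} {H : S → Graph rk}
    (hσ : σ.Regular C) {j : J} (f : (σ.un j).V ≃ K.V)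
    (hext : K.ext = (σ.un j).ext.map f)
    {s₀ s₁ : S} (hK : IsEmpty K.E) (hs : ({s₀, s₁} : Multiset S).Full)
    (hm : IsHandle (H s₀) (.prim (σ.modality j)))
    (hma : ∀ e, K.hole s₀ = ((σ.un j).att e).map f)
    {Q₁ : Struct {p : Pr // rk p = r} I J}
    (h₁ : σ.FullRep (H s₁) Q₁) (ha₁ : K.hole s₁ = ((σ.un j).hole ()).map f) :
    σ.FullRep (K.fill H) (.brac j Q₁) := by
  have hall : ∀ s, (H s).ext.Nodup ∧ (K.hole s).length = (H s).ext.length := by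
    intro s
    have := hs.2 s
    simp only [Multiset.insert_eq_cons, Multiset.mem_cons, Multiset.mem_singleton] at this
    rcases this with rfl | rfl
    · obtain ⟨e₀, _, he₀⟩ := (hσ.un j).edge
      refine ⟨hm.1, ?_⟩
      rw [hma e₀, hm.length, List.length_map, ← (σ.un j).rk_lab, he₀]
    · exact ⟨h₁.1, by rw [ha₁, List.length_map, σ.un_hole, h₁.length]⟩
  refine fullRep_fill_brac hσ (fun s => (hall s).1) (fun s => (hall s).2) f hext
    (t := .inr s₀) (t₁ := .inr s₁) ⟨?_, ?_⟩ hm hma h₁ ha₁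
  · exact hs.1.map (f := Sum.inr) Sum.inr_injective
  · rintro (e | s)
    · exact hK.elim e
    · simpa using hs.2 s

section frames
variable (hσ : σ.Regular C)
include hσ

theorem full_bin_slots {i : I} (e₀ : (σ.bin i).E) :
    ({.inl e₀, .inr 0, .inr 1} : Multiset ((σ.bin i).E ⊕ Fin 2)).Full := by
  refine ⟨by simp, ?_⟩
  obtain ⟨e₁, he₁, -⟩ := (hσ.bin i).edge
  rintro (e | s)
  · simp [he₁ e, he₁ e₀]
  · fin_cases s <;> simp

theorem full_un_slots {j : J} (e₀ : (σ.un j).E) :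
    ({.inl e₀, .inr ()} : Multiset ((σ.un j).E ⊕ Unit)).Full := by
  refine ⟨by simp, ?_⟩
  obtain ⟨e₁, he₁, -⟩ := (hσ.un j).edge
  rintro (e | s)
  · simp [he₁ e, he₁ e₀]
  · simp

theorem fullRep_label_bin {i : I} {B : Fin 2 → Formula rk} {hB} {X Y : Form {p : Pr // rk p = r} I
    J}
    (h0 : B 0 = (σ.mu X).1) (h1 : B 1 = (σ.mu Y).1) :
    σ.FullRep ((σ.bin i).label B hB) (.pair i (.form X) (.form Y)) := by
  obtain ⟨e₀, he₀, he₀'⟩ := (hσ.bin i).edge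
  refine ⟨(hσ.bin i).ext_nodup, .inl e₀, id, {.inr 0}, 0, {.inr 1}, 0, ?_,
    ⟨.inr 0, h0, by simp [Context.label], rfl, rfl⟩, ⟨.inr 1, h1, by simp [Context.label], rfl,
      rfl⟩,
    by simp [Context.label], Hypergraph.edges_eq (full_bin_slots hσ e₀), ?_⟩
  · intro e
    rw [he₀ e]
    exact ⟨rfl, by simp [Context.label]⟩
  · simp only [add_zero]
    exact (Multiset.map_id _).symm

theorem fullRep_label_un {j : J} {B : Unit → Formula rk} {hB} {X : Form {p : Pr // rk p = r} I J}
    (h0 : B () = (σ.mu X).1) : σ.FullRep ((σ.un j).label B hB) (.brac j (.form X)) := by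
  obtain ⟨e₀, he₀, he₀'⟩ := (hσ.un j).edge
  refine ⟨(hσ.un j).ext_nodup, .inl e₀, id, {.inr ()}, 0, ?_,
    ⟨.inr (), h0, by simp [Context.label], rfl, rfl⟩,
    by simp [Context.label], Hypergraph.edges_eq (full_un_slots hσ e₀), ?_⟩
  · intro e
    rw [he₀ e]
    exact ⟨rfl, by simp [Context.label]⟩
  · simp only [add_zero]
    exact (Multiset.map_id _).symm

/-- The antecedent of the rule for `×` on the right. -/
theorem fullRep_times_bin {i : I} {B : Fin 2 → Formula rk} {hB} {M : Graph rk} {H : M.E → Graph rk}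
    (f : (σ.bin i).V ≃ M.V) (g : (σ.bin i).E ⊕ Fin 2 ≃ M.E)
    (hatt : ∀ e, M.att (g e) = (((σ.bin i).label B hB).att e).map f)
    (hext : M.ext = (σ.bin i).ext.map f)
    (h₀ : ∀ e, IsHandle (H (g (.inl e))) (.prim (σ.mode i)))
    {Q₁ Q₂ : Struct {p : Pr // rk p = r} I J}
    (h₁ : σ.FullRep (H (g (.inr 0))) Q₁) (h₂ : σ.FullRep (H (g (.inr 1))) Q₂) :
    σ.FullRep (M.frame.fill H) (.pair i Q₁ Q₂) := by
  obtain ⟨e₀, he₀, -⟩ := (hσ.bin i).edge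
  refine fullRep_frame_pair (K := M.frame) hσ f hext (inferInstanceAs (IsEmpty Empty)) ?_ (h₀ e₀)
    (fun e => ?_) h₁ (hatt (.inr 0)) h₂ (hatt (.inr 1))
  · exact (full_bin_slots hσ e₀).map_equiv g
  · rw [he₀ e]; exact hatt _

theorem fullRep_times_un {j : J} {B : Unit → Formula rk} {hB} {M : Graph rk} {H : M.E → Graph rk}
    (f : (σ.un j).V ≃ M.V) (g : (σ.un j).E ⊕ Unit ≃ M.E)
    (hatt : ∀ e, M.att (g e) = (((σ.un j).label B hB).att e).map f)
    (hext : M.ext = (σ.un j).ext.map f)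
    (h₀ : ∀ e, IsHandle (H (g (.inl e))) (.prim (σ.modality j)))
    {Q₁ : Struct {p : Pr // rk p = r} I J} (h₁ : σ.FullRep (H (g (.inr ()))) Q₁) :
    σ.FullRep (M.frame.fill H) (.brac j Q₁) := by
  obtain ⟨e₀, he₀, -⟩ := (hσ.un j).edge
  refine fullRep_frame_brac (K := M.frame) hσ f hext (inferInstanceAs (IsEmpty Empty)) ?_ (h₀ e₀)
    (fun e => ?_) h₁ (hatt (.inr ()))
  · exact (full_un_slots hσ e₀).map_equiv g
  · rw [he₀ e]; exact hatt _

/-- The part of the antecedent of the rule for `÷` on the left that replaces `N`. -/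
theorem fullRep_div_under {i : I} {B : Formula rk} {hB} {D : GraphContext rk Unit}
    {H : Option D.E → Graph rk}
    (f : (σ.bin i).V ≃ D.V) (g : (σ.bin i).E ⊕ {t : Fin 2 // t ≠ 1} ≃ D.E)
    (hatt : ∀ e, D.att (g e) = (((σ.bin i).labelExcept 1 B hB).att e).map f)
    (hext : D.ext = (σ.bin i).ext.map f) (hhole : D.hole () = ((σ.bin i).hole 1).map f)
    (h₀ : ∀ e, IsHandle (H (some (g (.inl e)))) (.prim (σ.mode i)))
    {Q₁ Q₂ : Struct {p : Pr // rk p = r} I J}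
    (h₁ : σ.FullRep (H (some (g (.inr ⟨0, by decide⟩)))) Q₁) (h₂ : σ.FullRep (H none) Q₂) :
    σ.FullRep (D.frame.fill H) (.pair i Q₁ Q₂) := by
  obtain ⟨e₀, he₀, -⟩ := (hσ.bin i).edge
  refine fullRep_frame_pair (K := D.frame) hσ f hext (inferInstanceAs (IsEmpty Empty)) ?_ (h₀ e₀)
    (fun e => ?_) h₁ (hatt (.inr ⟨0, by decide⟩)) h₂ hhole
  · refine ⟨by simp, ?_⟩
    rintro (_ | e)
    · simp
    · obtain ⟨e, rfl⟩ := g.surjective e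
      rcases e with e | ⟨s, hs⟩
      · simp [he₀ e]
      · obtain rfl : s = 0 := by omega
        simp
  · rw [he₀ e]; exact hatt _

theorem fullRep_div_over {i : I} {B : Formula rk} {hB} {D : GraphContext rk Unit}
    {H : Option D.E → Graph rk}
    (f : (σ.bin i).V ≃ D.V) (g : (σ.bin i).E ⊕ {t : Fin 2 // t ≠ 0} ≃ D.E)
    (hatt : ∀ e, D.att (g e) = (((σ.bin i).labelExcept 0 B hB).att e).map f)
    (hext : D.ext = (σ.bin i).ext.map f) (hhole : D.hole () = ((σ.bin i).hole 0).map f)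
    (h₀ : ∀ e, IsHandle (H (some (g (.inl e)))) (.prim (σ.mode i)))
    {Q₁ Q₂ : Struct {p : Pr // rk p = r} I J}
    (h₁ : σ.FullRep (H none) Q₁) (h₂ : σ.FullRep (H (some (g (.inr ⟨1, by decide⟩)))) Q₂) :
    σ.FullRep (D.frame.fill H) (.pair i Q₁ Q₂) := by
  obtain ⟨e₀, he₀, -⟩ := (hσ.bin i).edge
  refine fullRep_frame_pair (K := D.frame) hσ f hext (inferInstanceAs (IsEmpty Empty)) ?_ (h₀ e₀)
    (fun e => ?_) h₁ hhole h₂ (hatt (.inr ⟨1, by decide⟩))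
  · refine ⟨by simp, ?_⟩
    rintro (_ | e)
    · simp
    · obtain ⟨e, rfl⟩ := g.surjective e
      rcases e with e | ⟨s, hs⟩
      · simp [he₀ e]
      · obtain rfl : s = 1 := by omega
        simp
  · rw [he₀ e]; exact hatt _

theorem fullRep_div_box {j : J} {D : GraphContext rk Unit} {H : Option D.E → Graph rk}
    (f : (σ.un j).V ≃ D.V) (g : (σ.un j).E ≃ D.E)
    (hatt : ∀ e, D.att (g e) = ((σ.un j).att e).map f)
    (hext : D.ext = (σ.un j).ext.map f) (hhole : D.hole () = ((σ.un j).hole ()).map f)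
    (h₀ : ∀ e, IsHandle (H (some (g e))) (.prim (σ.modality j)))
    {Q₁ : Struct {p : Pr // rk p = r} I J} (h₁ : σ.FullRep (H none) Q₁) :
    σ.FullRep (D.frame.fill H) (.brac j Q₁) := by
  obtain ⟨e₀, he₀, -⟩ := (hσ.un j).edge
  refine fullRep_frame_brac (K := D.frame) hσ f hext (inferInstanceAs (IsEmpty Empty)) ?_ (h₀ e₀)
    (fun e => ?_) h₁ hhole
  · refine ⟨by simp, ?_⟩
    rintro (_ | e)
    · simp
    · obtain ⟨e, rfl⟩ := g.surjective e
      simp [he₀ e]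
  · rw [he₀ e]; exact hatt _

end frames
end Shapes
end
end HL

namespace HL
open NLM (Struct Form Ctx)

section
variable {Pr : Type u} {rk : Pr → ℕ} {I J : Type} {r : ℕ}

namespace Shapes

/-- Translations can be decomposed along the rules: two translations of the same hypergraph are
structurally equivalent; a part of a translation that looks like a mode or a modality applied to
hyperedges can be made a substructure; and what remains of a translation after removing a mode and
one of its arguments, or a modality, is again a translation. -/
structure Decomposable (σ : Shapes rk I J r) (C A : Set I) : Prop where
  assoc : ∀ i ∈ A, ∀ (G : Graph rk) S T U es vs x,
    σ.Rep G (.pair i S (.pair i T U)) es vs x ↔ σ.Rep G (.pair i (.pair i S T) U) es vs x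
  unique : ∀ (G : Graph rk) Q Q', σ.FullRep G Q → σ.FullRep G Q' → σ.StructEq C A Q Q'
  prod : ∀ (G : Graph rk) Q i η m a b X Y, σ.FullRep G Q → Places (σ.bin i) G η m →
    G.lab a = (σ.mu X).1 → G.att a = ((σ.bin i).hole 0).map η →
    G.lab b = (σ.mu Y).1 → G.att b = ((σ.bin i).hole 1).map η → a ≠ b →
    ∃ D es vs, σ.RepCtx G D es vs G.ext ((σ.bin i).ext.map η) ∧ G.edges = es + {m, a, b} ∧
      G.inner = vs + (σ.bin i).inner.map η
  underSlot : ∀ (G : Graph rk) Q i η m a Y, σ.FullRep G Q → Places (σ.bin i) G η m →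
    G.ext = (σ.bin i).ext.map η → G.lab a = (σ.mu Y).1 → G.att a = ((σ.bin i).hole 0).map η →
    ∃ Q' es vs, σ.Rep G Q' es vs (((σ.bin i).hole 1).map η) ∧ G.edges = {m, a} + es ∧
      G.inner = (σ.bin i).inner.map η + vs
  overSlot : ∀ (G : Graph rk) Q i η m a Y, σ.FullRep G Q → Places (σ.bin i) G η m →
    G.ext = (σ.bin i).ext.map η → G.lab a = (σ.mu Y).1 → G.att a = ((σ.bin i).hole 1).map η →
    ∃ Q' es vs, σ.Rep G Q' es vs (((σ.bin i).hole 0).map η) ∧ G.edges = {m, a} + es ∧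
      G.inner = (σ.bin i).inner.map η + vs
  dia : ∀ (G : Graph rk) Q j η m a X, σ.FullRep G Q → Places (σ.un j) G η m →
    G.lab a = (σ.mu X).1 → G.att a = ((σ.un j).hole ()).map η →
    ∃ D es vs, σ.RepCtx G D es vs G.ext ((σ.un j).ext.map η) ∧ G.edges = es + {m, a} ∧
      G.inner = vs + (σ.un j).inner.map η
  box : ∀ (G : Graph rk) Q j η m, σ.FullRep G Q → Places (σ.un j) G η m →
    G.ext = (σ.un j).ext.map η →
    ∃ Q' es vs, σ.Rep G Q' es vs (((σ.un j).hole ()).map η) ∧ G.edges = {m} + es ∧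
      G.inner = (σ.un j).inner.map η + vs

variable {σ : Shapes rk I J r} {C A : Set I} {G : Graph rk}

/-- Formulas with the same translation carry the same label, the two holes of a commutative mode are
attached to the same nodes, and associativity is part of `Decomposable`. -/
theorem StructEq.rep_iff (hσ : σ.Regular C) (hd : σ.Decomposable C A)
    {Q Q' : Struct {p : Pr // rk p = r} I J} (h : σ.StructEq C A Q Q') {es : Multiset G.E}
    {vs : Multiset G.V} {x : List G.V} : σ.Rep G Q es vs x ↔ σ.Rep G Q' es vs x := by
  induction h generalizing es vs x with
  | form h => simp only [Rep, h]
  | pair _ _ h h' => simp only [Rep, h, h']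
  | brac _ h => simp only [Rep, h]
  | @comm i hi S T =>
    have key : ∀ S T : Struct {p : Pr // rk p = r} I J,
        σ.Rep G (.pair i S T) es vs x → σ.Rep G (.pair i T S) es vs x := by
      rintro S T ⟨m, η, es₁, vs₁, es₂, vs₂, h1, h2, h3, rfl, rfl, rfl⟩
      have := (hσ.comm i).1 hi
      exact ⟨m, η, es₂, vs₂, es₁, vs₁, h1, this ▸ h3, this ▸ h2, rfl, by abel, by abel⟩
    exact ⟨key S T, key T S⟩
  | assoc hi S T U => exact hd.assoc _ hi G S T U es vs x
  | symm _ h => exact h.symm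
  | trans _ _ h h' => exact h.trans h'

theorem StructEq.fullRep (hσ : σ.Regular C) (hd : σ.Decomposable C A)
    {Q Q' : Struct {p : Pr // rk p = r} I J} (h : σ.StructEq C A Q Q') (hQ : σ.FullRep G Q) :
    σ.FullRep G Q' := ⟨hQ.1, (h.rep_iff hσ hd).1 hQ.2⟩

theorem StructEq.derivable_tree (hσ : σ.Regular C) (hd : σ.Decomposable C A)
    {Q Q' : Struct {p : Pr // rk p = r} I J} (h : σ.StructEq C A Q Q') {X : Formula rk}
    (hQ : Derivable (σ.tree Q) X) : Derivable (σ.tree Q') X :=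
  .iso _ _ _ ((h.fullRep hσ hd (fullRep_tree hσ Q)).iso_tree hσ) hQ

theorem FullRep.derivable (hσ : σ.Regular C)
    {Q : Struct {p : Pr // rk p = r} I J} (h : σ.FullRep G Q) {X : Formula rk}
    (hQ : Derivable (σ.tree Q) X) : Derivable G X :=
  .iso _ _ _ ((fullRep_tree hσ Q).iso hσ h) hQ

theorem FullRep.derivable_tree (hσ : σ.Regular C)
    {Q : Struct {p : Pr // rk p = r} I J} (h : σ.FullRep G Q) {X : Formula rk}
    (hQ : Derivable G X) : Derivable (σ.tree Q) X :=
  .iso _ _ _ (h.iso_tree hσ) hQ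

theorem Regular.isHandle_mode (hσ : σ.Regular C) (i : I) (e : (σ.bin i).E) :
    IsHandle (handle ((σ.bin i).lab e) : Graph rk) (.prim (σ.mode i)) := by
  obtain ⟨e₀, he₀, h⟩ := (hσ.bin i).edge
  rw [he₀ e, h]
  exact isHandle_handle _

theorem Regular.isHandle_modality (hσ : σ.Regular C) (j : J) (e : (σ.un j).E) :
    IsHandle (handle ((σ.un j).lab e) : Graph rk) (.prim (σ.modality j)) := by
  obtain ⟨e₀, he₀, h⟩ := (hσ.un j).edge
  rw [he₀ e, h]
  exact isHandle_handle _

/-! ## Derivability is preserved -/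

/-- The antecedent that a hypergraph rule produces and the translated antecedent represent the same
database, so they are isomorphic without any computation in quotients. The structural rules only
replace the antecedent by an isomorphic one. -/
theorem derivable_of_derivable (hσ : σ.Regular C) (hd : σ.Decomposable C A)
    {S : Struct {p : Pr // rk p = r} I J} {T : Form {p : Pr // rk p = r} I J}
    (h : NLM.Derivable C A S T) : Derivable (σ.tree S) (σ.mu T).1 := by
  induction h with
  | ax X => exact .ax _
  | prodL i D X Y Z _ ih =>
    obtain ⟨K, hK, hl⟩ := exists_fullCtx hσ D X
    have hB : ∀ s, (![(σ.mu X).1, (σ.mu Y).1] s).rank = ((σ.bin i).hole s).length := fun s => by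
      rw [σ.bin_hole]; fin_cases s; exacts [(σ.mu X).2, (σ.mu Y).2]
    have h1 : σ.FullRep ((σ.bin i).label ![(σ.mu X).1, (σ.mu Y).1] hB)
        (.pair i (.form X) (.form Y)) := fullRep_label_bin hσ rfl rfl
    have hl' : (K.hole ()).length = (σ.bin i).ext.length := by rw [hl, σ.bin_ext]
    have h2 : σ.FullRep (K.fill fun _ => handle (σ.mu (.prod i X Y)).1)
        (D.plug (.form (.prod i X Y))) := hK.fill (fullRep_handle rfl) (by
      rw [hl, (fullRep_handle (σ := σ) (A := .prod i X Y) rfl).length])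
    exact h2.derivable_tree hσ (.timesL K _ _ hl' ((hK.fill h1 hl').derivable hσ ih))
  | prodR i S T X Y _ _ ihX ihY =>
    have hB : ∀ s, (![(σ.mu X).1, (σ.mu Y).1] s).rank = ((σ.bin i).hole s).length := fun s => by
      rw [σ.bin_hole]; fin_cases s; exacts [(σ.mu X).2, (σ.mu Y).2]
    -- The mode hyperedge is replaced by its own handle, which is justified by an axiom.
    have h1 := Derivable.timesR ((σ.bin i).label ![(σ.mu X).1, (σ.mu Y).1] hB)
      (Sum.elim (fun e => handle ((σ.bin i).lab e)) ![σ.tree S, σ.tree T]) (by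
        rintro (e | s)
        · exact .ax _
        · fin_cases s
          exacts [ihX, ihY])
    refine (FullRep.derivable_tree hσ ?_ h1)
    exact fullRep_times_bin hσ (hB := hB) (M := (σ.bin i).label _ hB)
      (H := Sum.elim (fun e => handle ((σ.bin i).lab e)) ![σ.tree S, σ.tree T]) (.refl _)
        (.refl _) (fun e => (List.map_id _).symm)
      (List.map_id _).symm (hσ.isHandle_mode i) (fullRep_tree hσ S) (fullRep_tree hσ T)
  | underL i D S X Y Z _ _ ih ih' =>
    obtain ⟨K, hK, hl⟩ := exists_fullCtx hσ D X
    have hX : (K.hole ()).length = (σ.mu X).1.rank := hl.trans (σ.mu X).2.symm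
    have h1 := Derivable.divL K (σ.mu X).1
      ((σ.bin i).labelExcept 1 (σ.mu Y).1 fun t => (σ.mu Y).2.trans (σ.bin_hole i t).symm)
      ((σ.mu X).2.trans (σ.bin_ext i).symm)
      (Sum.elim (fun e => handle ((σ.bin i).lab e)) fun _ => σ.tree S) (σ.mu Z).1 hX
      ((hK.fill (fullRep_handle rfl) (by
        rw [hl, (fullRep_handle (σ := σ) (A := X) rfl).length])).derivable hσ ih)
      (by
        rintro (e | s)
        · exact .ax _
        · exact ih')
    refine FullRep.derivable_tree hσ (hK.fill ?_ ?_) h1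
    · exact fullRep_div_under hσ (B := (σ.mu Y).1) (hB := fun t => (σ.mu Y).2.trans
        (σ.bin_hole i t).symm) (D := (σ.bin i).labelExcept 1 (σ.mu Y).1 fun t =>
          (σ.mu Y).2.trans (σ.bin_hole i t).symm) (.refl _) (.refl _) (fun e =>
            (List.map_id _).symm)
        (List.map_id _).symm (List.map_id _).symm (hσ.isHandle_mode i) (fullRep_tree hσ S)
        (fullRep_handle (A := .under i Y X) rfl)
    · exact hl.trans ((σ.bin_ext i).symm.trans (by simp [Context.fill, Context.frame,
        Context.labelExcept]))
  | underR i S X Y _ ih =>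
    obtain ⟨e₀, he₀, he₀'⟩ := (hσ.bin i).edge
    have hS := fullRep_tree hσ S
    refine .divR (σ.mu X).1 _ ((σ.mu X).2.trans (σ.bin_ext i).symm) _
      ((σ.bin_hole i 1).trans hS.length.symm) (FullRep.derivable hσ ?_ ih)
    -- The slots are mixed: the mode and `Y` are hyperedges of the denominator, and only the hole is
    -- filled, by the translation of `S`.
    refine fullRep_fill_pair hσ (S := Unit) (K := (σ.bin i).labelExcept 1 (σ.mu Y).1 fun t =>
      (σ.mu Y).2.trans (σ.bin_hole i t).symm) (H := fun _ => σ.tree S) (i := i) (fun _ => hS.1)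
        (fun _ => (σ.bin_hole i 1).trans hS.length.symm)
      (.refl _) (List.map_id _).symm (t := .inl (.inl e₀)) (t₁ := .inl (.inr ⟨0, by decide⟩))
      (t₂ := .inr ()) ⟨?_, ?_⟩ he₀' (fun e => by rw [he₀ e]; exact (List.map_id _).symm)
      ⟨_, rfl, rfl⟩ (List.map_id _).symm hS (List.map_id _).symm
    · simp
      exact fun h => Sum.inl_ne_inr (Sum.inl.inj h)
    · rintro ((e | ⟨s, hs⟩) | _)
      · simp [he₀ e]
      · obtain rfl : s = 0 := by omega
        simp
      · simp
  | overL i D S X Y Z _ _ ih ih' =>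
    obtain ⟨K, hK, hl⟩ := exists_fullCtx hσ D X
    have hX : (K.hole ()).length = (σ.mu X).1.rank := hl.trans (σ.mu X).2.symm
    have h1 := Derivable.divL K (σ.mu X).1
      ((σ.bin i).labelExcept 0 (σ.mu Y).1 fun t => (σ.mu Y).2.trans (σ.bin_hole i t).symm)
      ((σ.mu X).2.trans (σ.bin_ext i).symm)
      (Sum.elim (fun e => handle ((σ.bin i).lab e)) fun _ => σ.tree S) (σ.mu Z).1 hX
      ((hK.fill (fullRep_handle rfl) (by
        rw [hl, (fullRep_handle (σ := σ) (A := X) rfl).length])).derivable hσ ih)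
      (by
        rintro (e | s)
        · exact .ax _
        · exact ih')
    refine FullRep.derivable_tree hσ (hK.fill ?_ ?_) h1
    · exact fullRep_div_over hσ (B := (σ.mu Y).1) (hB := fun t => (σ.mu Y).2.trans
        (σ.bin_hole i t).symm) (D := (σ.bin i).labelExcept 0 (σ.mu Y).1 fun t =>
          (σ.mu Y).2.trans (σ.bin_hole i t).symm) (.refl _) (.refl _) (fun e =>
            (List.map_id _).symm)
        (List.map_id _).symm (List.map_id _).symm (hσ.isHandle_mode i)
        (fullRep_handle (A := .over i X Y) rfl) (fullRep_tree hσ S)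
    · exact hl.trans ((σ.bin_ext i).symm.trans (by simp [Context.fill, Context.frame,
        Context.labelExcept]))
  | overR i S X Y _ ih =>
    obtain ⟨e₀, he₀, he₀'⟩ := (hσ.bin i).edge
    have hS := fullRep_tree hσ S
    refine .divR (σ.mu X).1 _ ((σ.mu X).2.trans (σ.bin_ext i).symm) _
      ((σ.bin_hole i 0).trans hS.length.symm) (FullRep.derivable hσ ?_ ih)
    refine fullRep_fill_pair hσ (S := Unit) (K := (σ.bin i).labelExcept 0 (σ.mu Y).1 fun t =>
      (σ.mu Y).2.trans (σ.bin_hole i t).symm) (H := fun _ => σ.tree S) (i := i) (fun _ => hS.1)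
        (fun _ => (σ.bin_hole i 0).trans hS.length.symm)
      (.refl _) (List.map_id _).symm (t := .inl (.inl e₀)) (t₁ := .inr ())
      (t₂ := .inl (.inr ⟨1, by decide⟩)) ⟨?_, ?_⟩ he₀'
      (fun e => by rw [he₀ e]; exact (List.map_id _).symm)
      hS (List.map_id _).symm ⟨_, rfl, rfl⟩ (List.map_id _).symm
    · simp
      exact fun h => Sum.inl_ne_inr (Sum.inl.inj h)
    · rintro ((e | ⟨s, hs⟩) | _)
      · simp [he₀ e]
      · obtain rfl : s = 1 := by omega
        simp
      · simp
  | diaL j D X Z _ ih =>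
    obtain ⟨K, hK, hl⟩ := exists_fullCtx hσ D X
    have h1 : σ.FullRep ((σ.un j).label (fun _ => (σ.mu X).1)
        fun s => (σ.mu X).2.trans (σ.un_hole j s).symm)
        (.brac j (.form X)) := fullRep_label_un hσ rfl
    have hl' : (K.hole ()).length = (σ.un j).ext.length := by rw [hl, σ.un_ext]
    have h2 : σ.FullRep (K.fill fun _ => handle (σ.mu (.dia j X)).1)
        (D.plug (.form (.dia j X))) := hK.fill (fullRep_handle rfl) (by
      rw [hl, (fullRep_handle (σ := σ) (A := .dia j X) rfl).length])
    exact h2.derivable_tree hσ (.timesL K _ _ hl' ((hK.fill h1 hl').derivable hσ ih))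
  | diaR j S X _ ih =>
    have h1 := Derivable.timesR ((σ.un j).label (fun _ => (σ.mu X).1)
        fun s => (σ.mu X).2.trans (σ.un_hole j s).symm)
      (Sum.elim (fun e => handle ((σ.un j).lab e)) fun _ => σ.tree S) (by
        rintro (e | s)
        · exact .ax _
        · exact ih)
    refine (FullRep.derivable_tree hσ ?_ h1)
    exact fullRep_times_un hσ (B := fun _ => (σ.mu X).1)
      (hB := fun s => (σ.mu X).2.trans (σ.un_hole j s).symm)
      (M := (σ.un j).label (fun _ => (σ.mu X).1) fun s => (σ.mu X).2.trans (σ.un_hole j s).symm)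
      (H := Sum.elim (fun e => handle ((σ.un j).lab e)) fun _ => σ.tree S) (.refl _) (.refl _)
        (fun e => (List.map_id _).symm)
      (List.map_id _).symm (hσ.isHandle_modality j) (fullRep_tree hσ S)
  | boxL j D X Z _ ih =>
    obtain ⟨K, hK, hl⟩ := exists_fullCtx hσ D X
    have hX : (K.hole ()).length = (σ.mu X).1.rank := hl.trans (σ.mu X).2.symm
    have h1 := Derivable.divL K (σ.mu X).1 (σ.un j) ((σ.mu X).2.trans (σ.un_ext j).symm)
      (fun e => handle ((σ.un j).lab e)) (σ.mu Z).1 hX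
      ((hK.fill (fullRep_handle rfl) (by
        rw [hl, (fullRep_handle (σ := σ) (A := X) rfl).length])).derivable hσ ih)
      (fun e => .ax _)
    refine FullRep.derivable_tree hσ (hK.fill ?_ ?_) h1
    · exact fullRep_div_box hσ (D := σ.un j) (.refl _) (.refl _) (fun e => (List.map_id _).symm)
        (List.map_id _).symm (List.map_id _).symm (hσ.isHandle_modality j)
        (fullRep_handle (A := .box j X) rfl)
    · exact hl.trans ((σ.un_ext j).symm.trans (by simp [Context.fill, Context.frame]))
  | boxR j S X _ ih =>
    have hS := fullRep_tree hσ S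
    -- Filling the denominator gives literally the translation of the bracketed database, so no
    -- isomorphism is needed.
    exact .divR (σ.mu X).1 _ ((σ.mu X).2.trans (σ.un_ext j).symm) _
      ((σ.un_hole j ()).trans hS.length.symm) ih
  | comm c hc D S T Z _ ih =>
    exact ((StructEq.comm hc S T).plug D).derivable_tree hσ hd ih
  | assocL a ha D S T U Z _ ih =>
    exact ((StructEq.assoc ha S T U).plug D).derivable_tree hσ hd ih
  | assocR a ha D S T U Z _ ih =>
    exact ((StructEq.assoc ha S T U).symm.plug D).derivable_tree hσ hd ih

end Shapes
end
end HL

/-! ### Derivability is reflected -/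

namespace HL
open NLM (Struct Form Ctx)

section
variable {Pr : Type u} {rk : Pr → ℕ} {I J : Type} {r : ℕ}

theorem IsHandle.edge_unique {G : Graph rk} {X : Formula rk} (h : IsHandle G X) (e e' : G.E) :
    e = e' := by
  obtain ⟨_, _, e₀, h, _⟩ := h
  have h1 := G.mem_edges e
  have h2 := G.mem_edges e'
  rw [h, Multiset.mem_singleton] at h1 h2
  exact h1.trans h2.symm

theorem IsHandle.lab_eq {G : Graph rk} {X : Formula rk} (h : IsHandle G X) (e : G.E) :
    G.lab e = X := by
  obtain ⟨e₀, _, h', _⟩ := h.2.2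
  rw [h.edge_unique e e₀, h']

namespace Shapes
variable {σ : Shapes rk I J r} {C A : Set I} {G : Graph rk}

variable (σ) in
/-- The labels that occur in translations. -/
def Lang (X : Formula rk) : Prop :=
  (∃ B, X = (σ.mu B).1) ∨ (∃ i, X = .prim (σ.mode i)) ∨ ∃ j, X = .prim (σ.modality j)

theorem Lang.times {M : Graph rk} (h : σ.Lang (.times M)) : ∃ B, .times M = (σ.mu B).1 := by
  rcases h with h | ⟨i, h⟩ | ⟨j, h⟩
  exacts [h, absurd h.symm (Formula.prim_ne_times _ _), absurd h.symm (Formula.prim_ne_times _ _)]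

theorem Lang.div {N : Formula rk} {D : GraphContext rk Unit} {hD} (h : σ.Lang (.div N D hD)) :
    ∃ B, .div N D hD = (σ.mu B).1 := by
  rcases h with h | ⟨i, h⟩ | ⟨j, h⟩
  exacts [h, absurd h.symm (Formula.prim_ne_div _ _ _ _), absurd h.symm
    (Formula.prim_ne_div _ _ _ _)]

theorem Regular.lang_bin (hσ : σ.Regular C) (i : I) (e : (σ.bin i).E) :
    σ.Lang ((σ.bin i).lab e) := by
  obtain ⟨e₀, he₀, h⟩ := (hσ.bin i).edge
  exact .inr (.inl ⟨i, by rw [he₀ e, h]⟩)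

theorem Regular.lang_un (hσ : σ.Regular C) (j : J) (e : (σ.un j).E) :
    σ.Lang ((σ.un j).lab e) := by
  obtain ⟨e₀, he₀, h⟩ := (hσ.un j).edge
  exact .inr (.inr ⟨j, by rw [he₀ e, h]⟩)

theorem Rep.lang (hσ : σ.Regular C) {Q : Struct {p : Pr // rk p = r} I J} {es : Multiset G.E}
    {vs : Multiset G.V} {x : List G.V} (h : σ.Rep G Q es vs x) : ∀ e ∈ es, σ.Lang (G.lab e) := by
  induction Q generalizing es vs x with
  | form A =>
    obtain ⟨e, h1, rfl, rfl, rfl⟩ := h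
    intro e' he'
    obtain rfl := Multiset.mem_singleton.1 he'
    exact .inl ⟨A, h1⟩
  | pair i S T ihS ihT =>
    obtain ⟨m, η, es₁, vs₁, es₂, vs₂, h1, h2, h3, rfl, rfl, rfl⟩ := h
    intro e he
    simp only [Multiset.mem_add, Multiset.mem_singleton] at he
    rcases he with (rfl | he) | he
    · obtain ⟨e₀, -⟩ := (hσ.bin i).edge
      rw [(h1 e₀).1]
      exact hσ.lang_bin i e₀
    · exact ihS h2 e he
    · exact ihT h3 e he
  | brac j S ihS =>
    obtain ⟨m, η, es₁, vs₁, h1, h2, rfl, rfl, rfl⟩ := h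
    intro e he
    simp only [Multiset.mem_add, Multiset.mem_singleton] at he
    rcases he with rfl | he
    · obtain ⟨e₀, -⟩ := (hσ.un j).edge
      rw [(h1 e₀).1]
      exact hσ.lang_un j e₀
    · exact ihS h2 e he

variable (σ C A) in
/-- What a derivable sequent with labels from the language of translations amounts to. -/
def Reflects (G : Graph rk) (X : Formula rk) : Prop :=
  (∀ T, X = (σ.mu T).1 → ∃ Q, σ.FullRep G Q ∧ NLM.Derivable C A Q T) ∧
  ∀ p, ((∃ i, p = σ.mode i) ∨ ∃ j, p = σ.modality j) → X = .prim p → IsHandle G X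

theorem RepTop.eq_form (hσ : σ.Regular C) {Q : Struct {p : Pr // rk p = r} I J} {m : G.E}
    {es : Multiset G.E} {vs : Multiset G.V} {x : List G.V} (h : σ.RepTop G Q m es vs x)
    {X : Form {p : Pr // rk p = r} I J} (hm : G.lab m = (σ.mu X).1) :
    ∃ W, Q = .form W := by
  cases Q with
  | form W => exact ⟨W, rfl⟩
  | pair i S T =>
    obtain ⟨η, es₁, vs₁, es₂, vs₂, h1, -⟩ := h
    obtain ⟨e₀, -, he₀⟩ := (hσ.bin i).edge
    exact absurd (((h1 e₀).1.trans he₀).symm.trans hm) (hσ.prim_mode_ne i X)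
  | brac j S =>
    obtain ⟨η, es₁, vs₁, h1, -⟩ := h
    obtain ⟨e₀, -, he₀⟩ := (hσ.un j).edge
    exact absurd (((h1 e₀).1.trans he₀).symm.trans hm) (hσ.prim_modality_ne j X)

section rules
theorem reflects_ax {X : Formula rk} : σ.Reflects C A (handle X) X := by
  refine ⟨fun T h => ⟨.form T, fullRep_handle h, .ax _⟩, fun p _ _ => isHandle_handle _⟩

variable (hσ : σ.Regular C) (hd : σ.Decomposable C A)
include hσ hd

/-- The copy of `M` in the premise consists of a mode with two formulas as arguments. By `prod` the
rest is a context `D`, hence represented by `K` itself. The database from the induction hypothesis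
and the pair inside `D` represent the same hypergraph, so `unique` carries the derivation over, and
the left product rule applies. -/
theorem reflects_timesL_bin {K : GraphContext rk Unit} {M : Graph rk} {Z : Formula rk}
    (hl : (K.hole ()).length = M.ext.length) (ih : σ.Reflects C A (K.fill fun _ => M) Z)
    {i : I} {X Y : Form {p : Pr // rk p = r} I J} (h : .times M = (σ.mu (.prod i X Y)).1) :
    σ.Reflects C A (K.fill fun _ => handle (.times M)) Z := by
  obtain ⟨f, g, hatt, hlab, hext⟩ := (Formula.times_eq_times_iff _ _).1 h.symm
  obtain ⟨e₀, he₀, he₀'⟩ := (hσ.bin i).edge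
  -- Two different hyperedges in the premise: it is not a handle, which rules out a mode or a
  -- modality as succedent.
  have hm : (Sum.inr ⟨(), g (.inl e₀)⟩ : (K.fill fun _ => M).E) ≠ Sum.inr ⟨(), g (.inr 0)⟩ := by
    intro h
    have := Sum.inr.inj h
    simp only [Sigma.mk.injEq, heq_eq_eq, true_and] at this
    exact Sum.inl_ne_inr (g.injective this)
  refine ⟨fun T hT => ?_, fun p hp hp' => absurd ((ih.2 p hp hp').edge_unique _ _) hm⟩
  obtain ⟨Q, hQ, hQT⟩ := ih.1 T hT
  have hMn : M.ext.Nodup := by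
    rw [hext]
    exact (hσ.bin i).ext_nodup.map f.injective
  have hη : ∀ l : List (σ.bin i).V, (l.map f).map (K.inserted (fun _ => M) ()) =
      l.map fun v => K.inserted (fun _ => M) () (f v) := fun l => List.map_map ..
  obtain ⟨D, es, vs, h1, h2, h3⟩ := hd.prod (K.fill fun _ => M) Q i
    (fun v => K.inserted (fun _ => M) () (f v)) (Sum.inr ⟨(), g (.inl e₀)⟩)
    (Sum.inr ⟨(), g (.inr 0)⟩) (Sum.inr ⟨(), g (.inr 1)⟩) X Y hQ
    (fun e => by
      rw [he₀ e]
      exact ⟨hlab (.inl e₀), (congrArg (List.map _) (hatt (.inl e₀))).trans (hη _)⟩)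
    (hlab (.inr 0)) ((congrArg (List.map _) (hatt (.inr 0))).trans (hη _))
    (hlab (.inr 1)) ((congrArg (List.map _) (hatt (.inr 1))).trans (hη _))
    (fun h => by
      have := Sum.inr.inj h
      simp only [Sigma.mk.injEq, heq_eq_eq, true_and] at this
      exact zero_ne_one (Sum.inr.inj (g.injective this)))
  · have hK : σ.FullCtx K D := by
      refine FullCtx.of_fill hMn hl hQ.1 h1 ?_ ?_ ?_
      · rw [hext, List.map_map]
        rfl
      · rw [h2, Hypergraph.edges_map_equiv (H := M) g,
          Hypergraph.edges_eq (full_bin_slots hσ e₀)]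
        rfl
      · rw [h3, Hypergraph.inner_map_equiv (H := M) f hext, Multiset.map_map]
        rfl
    have hM : σ.FullRep M (.pair i (.form X) (.form Y)) :=
      (fullRep_label_bin hσ rfl rfl).of_iso ⟨f, g, hatt, hlab, hext⟩
    refine ⟨_, hK.fill (fullRep_handle h) (by
      rw [hl, hM.length, (fullRep_handle (σ := σ) (A := .prod i X Y) h).length]), .prodL _ _ _ _ _
        ?_⟩
    exact (hd.unique _ _ _ hQ (hK.fill hM hl)).derivable hσ hQT

theorem reflects_timesL_un {K : GraphContext rk Unit} {M : Graph rk} {Z : Formula rk}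
    (hl : (K.hole ()).length = M.ext.length) (ih : σ.Reflects C A (K.fill fun _ => M) Z)
    {j : J} {X : Form {p : Pr // rk p = r} I J} (h : .times M = (σ.mu (.dia j X)).1) :
    σ.Reflects C A (K.fill fun _ => handle (.times M)) Z := by
  obtain ⟨f, g, hatt, hlab, hext⟩ := (Formula.times_eq_times_iff _ _).1 h.symm
  obtain ⟨e₀, he₀, he₀'⟩ := (hσ.un j).edge
  have hm : (Sum.inr ⟨(), g (.inl e₀)⟩ : (K.fill fun _ => M).E) ≠ Sum.inr ⟨(), g (.inr ())⟩ := by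
    intro h
    have := Sum.inr.inj h
    simp only [Sigma.mk.injEq, heq_eq_eq, true_and] at this
    exact Sum.inl_ne_inr (g.injective this)
  refine ⟨fun T hT => ?_, fun p hp hp' => absurd ((ih.2 p hp hp').edge_unique _ _) hm⟩
  obtain ⟨Q, hQ, hQT⟩ := ih.1 T hT
  have hMn : M.ext.Nodup := by
    rw [hext]
    exact (hσ.un j).ext_nodup.map f.injective
  have hη : ∀ l : List (σ.un j).V, (l.map f).map (K.inserted (fun _ => M) ()) =
      l.map fun v => K.inserted (fun _ => M) () (f v) := fun l => List.map_map ..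
  obtain ⟨D, es, vs, h1, h2, h3⟩ := hd.dia (K.fill fun _ => M) Q j
    (fun v => K.inserted (fun _ => M) () (f v)) (Sum.inr ⟨(), g (.inl e₀)⟩)
    (Sum.inr ⟨(), g (.inr ())⟩) X hQ
    (fun e => by
      rw [he₀ e]
      exact ⟨hlab (.inl e₀), (congrArg (List.map _) (hatt (.inl e₀))).trans (hη _)⟩)
    (hlab (.inr ())) ((congrArg (List.map _) (hatt (.inr ()))).trans (hη _))
  · have hK : σ.FullCtx K D := by
      refine FullCtx.of_fill hMn hl hQ.1 h1 ?_ ?_ ?_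
      · rw [hext, List.map_map]
        rfl
      · rw [h2, Hypergraph.edges_map_equiv (H := M) g,
          Hypergraph.edges_eq (full_un_slots hσ e₀)]
        rfl
      · rw [h3, Hypergraph.inner_map_equiv (H := M) f hext, Multiset.map_map]
        rfl
    have hM : σ.FullRep M (.brac j (.form X)) :=
      (fullRep_label_un hσ rfl).of_iso ⟨f, g, hatt, hlab, hext⟩
    refine ⟨_, hK.fill (fullRep_handle h) (by
      rw [hl, hM.length, (fullRep_handle (σ := σ) (A := .dia j X) h).length]), .diaL _ _ _ _ ?_⟩
    exact (hd.unique _ _ _ hQ (hK.fill hM hl)).derivable hσ hQT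

omit hd in
-- Here the second half of `Reflects` is needed: what replaces a mode or modality hyperedge of `M`
-- is a handle, so the result still has the shape of that mode or modality.
theorem reflects_timesR {M : Graph rk} {H : M.E → Graph rk}
    (ih : ∀ m, σ.Reflects C A (H m) (M.lab m)) :
    σ.Reflects C A (M.frame.fill H) (.times M) := by
  refine ⟨fun T h => ?_, fun p _ h => absurd h.symm (Formula.prim_ne_times _ _)⟩
  cases T with
  | prim p => exact absurd h.symm (Formula.prim_ne_times _ _)
  | prod i X Y =>
    obtain ⟨f, g, hatt, hlab, hext⟩ := (Formula.times_eq_times_iff _ _).1 h.symm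
    obtain ⟨e₀, he₀, he₀'⟩ := (hσ.bin i).edge
    obtain ⟨S, hS, hS'⟩ := (ih (g (.inr 0))).1 X (hlab (.inr 0))
    obtain ⟨T, hT, hT'⟩ := (ih (g (.inr 1))).1 Y (hlab (.inr 1))
    refine ⟨_, fullRep_times_bin hσ f g hatt hext (fun e => ?_) hS hT, .prodR _ _ _ _ _ hS' hT'⟩
    have : M.lab (g (.inl e)) = .prim (σ.mode i) := (hlab (.inl e)).trans (he₀ e ▸ he₀')
    exact this ▸ (ih (g (.inl e))).2 _ (.inl ⟨i, rfl⟩) this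
  | dia j X =>
    obtain ⟨f, g, hatt, hlab, hext⟩ := (Formula.times_eq_times_iff _ _).1 h.symm
    obtain ⟨e₀, he₀, he₀'⟩ := (hσ.un j).edge
    obtain ⟨S, hS, hS'⟩ := (ih (g (.inr ()))).1 X (hlab (.inr ()))
    refine ⟨_, fullRep_times_un hσ f g hatt hext (fun e => ?_) hS, .diaR _ _ _ hS'⟩
    have : M.lab (g (.inl e)) = .prim (σ.modality j) := (hlab (.inl e)).trans (he₀ e ▸ he₀')
    exact this ▸ (ih (g (.inl e))).2 _ (.inr ⟨j, rfl⟩) this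
  | under i Y X => rw [mu_under] at h; exact absurd h (Formula.times_ne_div _ _ _ _)
  | box j X => rw [mu_box] at h; exact absurd h (Formula.times_ne_div _ _ _ _)
  | _ => rw [mu_over] at h; exact absurd h (Formula.times_ne_div _ _ _ _)

/-- The hyperedge labeled by the numerator occurs in the database of the premise as a leaf `W`,
which may differ from `X` but has the same translation. By `unique` it can be exchanged for `X`. The
hypothesis `hS` is the left rule of the division in question. -/
theorem reflects_divL {K : GraphContext rk Unit} {F : Graph rk} {Z : Formula rk}
    {X : Form {p : Pr // rk p = r} I J} (hl : (K.hole ()).length = r)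
    (ih : σ.Reflects C A (K.fill fun _ => handle (σ.mu X).1) Z)
    {S : Struct {p : Pr // rk p = r} I J} (hF : σ.FullRep F S)
    (hS : ∀ D T, NLM.Derivable C A (Ctx.plug D (.form X)) T → NLM.Derivable C A (Ctx.plug D S) T) :
    σ.Reflects C A (K.fill fun _ => F) Z := by
  let e : (K.fill fun _ => handle (σ.mu X).1).E := Sum.inr ⟨(), ()⟩
  refine ⟨fun T hT => ?_, fun p hp hp' => ?_⟩
  · obtain ⟨Q, hQ, hQT⟩ := ih.1 T hT
    obtain ⟨D, Q', es₁, vs₁, es₂, vs₂, y, rfl, h1, h2, h3, h4⟩ := hQ.2.locate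
      (Hypergraph.mem_edges _ e)
    obtain ⟨W, rfl⟩ := h2.eq_form hσ (X := X) rfl
    obtain ⟨-, rfl, rfl, rfl⟩ := h2
    have hX := fullRep_handle (σ := σ) (A := X) rfl
    have hlX := hl.trans hX.length.symm
    obtain ⟨hX1, hX2, e', hX3, -⟩ := isHandle_handle (rk := rk) (σ.mu X).1
    have hK : σ.FullCtx K D := by
      refine FullCtx.of_fill hX.1 hlX hQ.1 h1 rfl ?_ ?_
      · rw [h3, hX3]
        rfl
      · rw [h4, hX2]
        rfl
    refine ⟨_, hK.fill hF (hl.trans hF.length.symm), hS _ _ ?_⟩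
    exact (hd.unique _ _ _ hQ (hK.fill hX hlX)).derivable hσ hQT
  · have := (ih.2 p hp hp').lab_eq e
    rw [hp'] at this
    rcases hp with ⟨i, rfl⟩ | ⟨j, rfl⟩
    exacts [absurd this.symm (hσ.prim_mode_ne i X), absurd this.symm (hσ.prim_modality_ne j X)]

omit hσ hd in
/-- The rest of the antecedent of the premise of the right rule for `÷` is a translation. -/
theorem fullRep_of_fill {S : Type} {P : GraphContext rk S} {p : Pr} (hP : Pattern P p)
    {D : GraphContext rk Unit} {F : Graph rk} (hl : (D.hole ()).length = F.ext.length) (s : S)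
    (f : P.V ≃ D.V) (hext : D.ext = P.ext.map f) (hhole : D.hole () = (P.hole s).map f)
    {Q : Struct {p : Pr // rk p = r} I J} {es es' : Multiset (D.fill fun _ => F).E}
    {vs : Multiset (D.fill fun _ => F).V} (hn : (D.fill fun _ => F).ext.Nodup)
    (h : σ.Rep _ Q es vs ((P.hole s).map fun v => D.outer (fun _ => F) (f v)))
    (hes : (D.fill fun _ => F).edges = es' + es) (hes' : es' = D.edges.map Sum.inl)
    (hvs : (D.fill fun _ => F).inner = P.inner.map (fun v => D.outer (fun _ => F) (f v)) + vs) :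
    σ.FullRep F Q := by
  have hfe : (D.fill fun _ => F).ext = P.ext.map fun v => D.outer (fun _ => F) (f v) := by
    change D.ext.map _ = _
    rw [hext, List.map_map]
    rfl
  have hnd := Hypergraph.nodup_inner_add_ext hn
  rw [hvs, hfe] at hnd
  obtain ⟨hη, n1, -, -, n2, -⟩ := hP.nodup (G := D.fill fun _ => F) (vs₂ := 0) (by simpa using hnd)
  rw [Context.edges_fill_unit, hes'] at hes
  obtain rfl := Multiset.add_right_inj.1 hes
  have hh : (D.hole ()).map (D.outer fun _ => F) =
      (P.hole s).map fun v => D.outer (fun _ => F) (f v) := by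
    rw [hhole, List.map_map]
    rfl
  rw [← hh] at h
  refine FullRep.of_fill ?_ hl h ?_ ?_ ?_ ?_
  · rw [hhole]
    exact (hP.hole_nodup s).map f.injective
  · exact (Multiset.nodup_add.1 (n2 s)).1
  · rw [hh]
    exact (hP.hole_nodup s).map hη
  · intro v
    have := n1 (f.symm v)
    simpa using this
  · intro x
    by_cases hx : x ∈ (D.fill fun _ => F).ext
    · obtain ⟨v, _, rfl⟩ := List.mem_map.1 hx
      exact .inr ⟨v, rfl⟩
    · rw [← Hypergraph.mem_inner, hvs, Multiset.mem_add] at hx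
      rcases hx with hx | hx
      · obtain ⟨v, _, rfl⟩ := Multiset.mem_map.1 hx
        exact .inr ⟨_, rfl⟩
      · exact .inl hx

/-- The labels in `D` are known to be admissible only after the division has been identified with a
translated formula, so the induction hypothesis is conditional. The slot conditions of
`Decomposable` then strip the mode or modality, and for binary divisions also `Y`, from the database
of the premise. -/
theorem reflects_divR {N : Formula rk} {D : GraphContext rk Unit} {hD : N.rank = D.ext.length}
    {F : Graph rk} (hl : (D.hole ()).length = F.ext.length)
    (ih : (∀ e, σ.Lang (D.lab e)) → σ.Reflects C A (D.fill fun _ => F) N) :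
    σ.Reflects C A F (.div N D hD) := by
  refine ⟨fun T h => ?_, fun p _ h => absurd h.symm (Formula.prim_ne_div _ _ _ _)⟩
  cases T with
  | prim p => exact absurd h.symm (Formula.prim_ne_div _ _ _ _)
  | prod i X Y => exact absurd h.symm (Formula.times_ne_div _ _ _ _)
  | dia j X => exact absurd h.symm (Formula.times_ne_div _ _ _ _)
  | under i Y X =>
    have h0 := h
    rw [mu_under] at h0
    obtain ⟨hN, f, g, hatt, hlab, hext, hhole⟩ := (Formula.div_eq_div_iff _ _ _ _ _ _).1 h0.symm
    obtain ⟨e₀, he₀, he₀'⟩ := (hσ.bin i).edge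
    obtain ⟨Q, hQ, hQX⟩ := (ih fun e => by
      obtain ⟨e, rfl⟩ := g.surjective e
      rw [hlab]
      rcases e with e | s
      exacts [hσ.lang_bin i e, .inl ⟨Y, rfl⟩]).1 X hN.symm
    have hη : ∀ l : List (σ.bin i).V, (l.map f).map (D.outer fun _ => F) =
        l.map fun v => D.outer (fun _ => F) (f v) := fun l => List.map_map ..
    have hm : Places (σ.bin i) (D.fill fun _ => F) (fun v => D.outer (fun _ => F) (f v))
        (Sum.inl (g (.inl e₀))) := fun e => by
      rw [he₀ e]
      exact ⟨hlab (.inl e₀), (congrArg (List.map _) (hatt (.inl e₀))).trans (hη _)⟩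
    have hG : (D.fill fun _ => F).ext = _ := (congrArg (List.map _) hext).trans (hη _)
    let a : (D.fill fun _ => F).E := Sum.inl (g (.inr ⟨0, by decide⟩))
    have hla : (D.fill fun _ => F).lab a = (σ.mu Y).1 := hlab (.inr ⟨0, by decide⟩)
    have ha : (D.fill fun _ => F).att a =
        ((σ.bin i).hole 0).map fun v => D.outer (fun _ => F) (f v) :=
      (congrArg (List.map (D.outer fun _ => F)) (hatt (.inr ⟨0, by decide⟩))).trans (hη _)
    obtain ⟨Q', es, vs, h1, h2, h3⟩ := hd.underSlot _ Q i _ _ a Y hQ hm hG hla ha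
    refine ⟨Q', fullRep_of_fill (hσ.bin i) hl 1 f hext hhole hQ.1 h1 h2 ?_ h3, .underR _ _ _ _ ?_⟩
    · rw [D.edges_eq (s := {g (.inl e₀), g (.inr ⟨0, by decide⟩)})]
      · rfl
      · refine ⟨by simpa using fun h => Sum.inl_ne_inr (g.injective h), fun e => ?_⟩
        obtain ⟨e | ⟨s, hs⟩, rfl⟩ := g.surjective e
        · simp [he₀ e]
        · obtain rfl : s = 0 := by omega
          simp
    -- Putting `Y` back in front of `Q'` gives another representation of the premise, so the
    -- derivation for `Q` can be transferred to it.
    · refine (hd.unique _ _ _ hQ ⟨hQ.1, ?_⟩).derivable hσ hQX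
      exact ⟨_, _, _, 0, es, vs, hm, ⟨a, hla, ha, rfl, rfl⟩, h1, hG,
        by rw [h2]; rfl, by rw [h3, add_zero]⟩
  | box j X =>
    have h0 := h
    rw [mu_box] at h0
    obtain ⟨hN, f, g, hatt, hlab, hext, hhole⟩ := (Formula.div_eq_div_iff _ _ _ _ _ _).1 h0.symm
    obtain ⟨e₀, he₀, he₀'⟩ := (hσ.un j).edge
    obtain ⟨Q, hQ, hQX⟩ := (ih fun e => by
      obtain ⟨e, rfl⟩ := g.surjective e
      rw [hlab]
      exact hσ.lang_un j e).1 X hN.symm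
    have hη : ∀ l : List (σ.un j).V, (l.map f).map (D.outer fun _ => F) =
        l.map fun v => D.outer (fun _ => F) (f v) := fun l => List.map_map ..
    have hm : Places (σ.un j) (D.fill fun _ => F) (fun v => D.outer (fun _ => F) (f v))
        (Sum.inl (g e₀)) := fun e => by
      rw [he₀ e]
      exact ⟨hlab e₀, (congrArg (List.map _) (hatt e₀)).trans (hη _)⟩
    have hG : (D.fill fun _ => F).ext = _ := (congrArg (List.map _) hext).trans (hη _)
    obtain ⟨Q', es, vs, h1, h2, h3⟩ := hd.box _ Q j _ _ hQ hm hG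
    refine ⟨Q', fullRep_of_fill (hσ.un j) hl () f hext hhole hQ.1 h1 h2 ?_ h3, .boxR _ _ _ ?_⟩
    · rw [D.edges_eq (s := {g e₀})]
      · rfl
      · refine ⟨by simp, fun e => ?_⟩
        obtain ⟨e, rfl⟩ := g.surjective e
        simp [he₀ e]
    · refine (hd.unique _ _ _ hQ ⟨hQ.1, ?_⟩).derivable hσ hQX
      exact ⟨_, _, es, vs, hm, h1, hG, h2, h3⟩
  | _ =>
    rename_i i X Y
    have h0 := h
    rw [mu_over] at h0
    obtain ⟨hN, f, g, hatt, hlab, hext, hhole⟩ := (Formula.div_eq_div_iff _ _ _ _ _ _).1 h0.symm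
    obtain ⟨e₀, he₀, he₀'⟩ := (hσ.bin i).edge
    obtain ⟨Q, hQ, hQX⟩ := (ih fun e => by
      obtain ⟨e, rfl⟩ := g.surjective e
      rw [hlab]
      rcases e with e | s
      exacts [hσ.lang_bin i e, .inl ⟨Y, rfl⟩]).1 X hN.symm
    have hη : ∀ l : List (σ.bin i).V, (l.map f).map (D.outer fun _ => F) =
        l.map fun v => D.outer (fun _ => F) (f v) := fun l => List.map_map ..
    have hm : Places (σ.bin i) (D.fill fun _ => F) (fun v => D.outer (fun _ => F) (f v))
        (Sum.inl (g (.inl e₀))) := fun e => by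
      rw [he₀ e]
      exact ⟨hlab (.inl e₀), (congrArg (List.map _) (hatt (.inl e₀))).trans (hη _)⟩
    have hG : (D.fill fun _ => F).ext = _ := (congrArg (List.map _) hext).trans (hη _)
    let a : (D.fill fun _ => F).E := Sum.inl (g (.inr ⟨1, by decide⟩))
    have hla : (D.fill fun _ => F).lab a = (σ.mu Y).1 := hlab (.inr ⟨1, by decide⟩)
    have ha : (D.fill fun _ => F).att a =
        ((σ.bin i).hole 1).map fun v => D.outer (fun _ => F) (f v) :=
      (congrArg (List.map (D.outer fun _ => F)) (hatt (.inr ⟨1, by decide⟩))).trans (hη _)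
    obtain ⟨Q', es, vs, h1, h2, h3⟩ := hd.overSlot _ Q i _ _ a Y hQ hm hG hla ha
    refine ⟨Q', fullRep_of_fill (hσ.bin i) hl 0 f hext hhole hQ.1 h1 h2 ?_ h3, .overR _ _ _ _ ?_⟩
    · rw [D.edges_eq (s := {g (.inl e₀), g (.inr ⟨1, by decide⟩)})]
      · rfl
      · refine ⟨by simpa using fun h => Sum.inl_ne_inr (g.injective h), fun e => ?_⟩
        obtain ⟨e | ⟨s, hs⟩, rfl⟩ := g.surjective e
        · simp [he₀ e]
        · obtain rfl : s = 1 := by omega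
          simp
    · refine (hd.unique _ _ _ hQ ⟨hQ.1, ?_⟩).derivable hσ hQX
      refine ⟨_, _, es, vs, _, 0, hm, h1, ⟨a, hla, ha, rfl, rfl⟩, hG,
        ?_, by rw [h3, add_zero]⟩
      have : ∀ m a : (D.fill fun _ => F).E, {m, a} + es = {m} + es + {a} := fun m a => by
        rw [Multiset.insert_eq_cons, ← Multiset.singleton_add]
        abel
      exact h2.trans (this _ _)

/-- Derivable sequents in the language of translations are translations of derivable sequents. -/
theorem reflects_of_derivable {X : Formula rk} (h : Derivable G X)
    (hG : ∀ e, σ.Lang (G.lab e)) : σ.Reflects C A G X := by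
  induction h with
  | ax X => exact reflects_ax
  | timesL K M Z hl _ ih =>
    -- The principal formula labels a hyperedge of the conclusion. It is therefore translated, which
    -- fixes `M` up to isomorphism and keeps the labels of the premise in the language.
    obtain ⟨B, hB⟩ := (hG (.inr ⟨(), ()⟩)).times
    cases B with
    | prim p => exact absurd hB.symm (Formula.prim_ne_times _ _)
    | prod i X Y =>
      refine reflects_timesL_bin hσ hd hl (ih ?_) hB
      obtain ⟨f, g, hatt, hlab, hext⟩ := (Formula.times_eq_times_iff _ _).1 hB.symm
      rintro (e | ⟨_, e⟩)
      · exact hG (.inl e)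
      · change σ.Lang (M.lab e)
        obtain ⟨e, rfl⟩ := g.surjective e
        rw [hlab]
        rcases e with e | s
        · exact hσ.lang_bin i e
        · fin_cases s
          exacts [.inl ⟨X, rfl⟩, .inl ⟨Y, rfl⟩]
    | dia j X =>
      refine reflects_timesL_un hσ hd hl (ih ?_) hB
      obtain ⟨f, g, hatt, hlab, hext⟩ := (Formula.times_eq_times_iff _ _).1 hB.symm
      rintro (e | ⟨_, e⟩)
      · exact hG (.inl e)
      · change σ.Lang (M.lab e)
        obtain ⟨e, rfl⟩ := g.surjective e
        rw [hlab]
        rcases e with e | s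
        · exact hσ.lang_un j e
        · exact .inl ⟨X, rfl⟩
    | under i Y X => rw [mu_under] at hB; exact absurd hB (Formula.times_ne_div _ _ _ _)
    | box j X => rw [mu_box] at hB; exact absurd hB (Formula.times_ne_div _ _ _ _)
    | _ => rw [mu_over] at hB; exact absurd hB (Formula.times_ne_div _ _ _ _)
  | timesR M H _ ih => exact reflects_timesR hσ fun m => ih m fun e => hG (.inr ⟨m, e⟩)
  | divL K N D hD H Z hl _ _ ih ih' =>
    replace ih' := fun d => ih' d fun e => hG (.inr ⟨(), .inr ⟨some d, e⟩⟩)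
    obtain ⟨B, hB⟩ := Lang.div (hD := hD) (hG (.inr ⟨(), .inr ⟨none, ()⟩⟩))
    cases B with
    | prim p => exact absurd hB.symm (Formula.prim_ne_div _ _ _ _)
    | prod i X Y => exact absurd hB.symm (Formula.times_ne_div _ _ _ _)
    | dia j X => exact absurd hB.symm (Formula.times_ne_div _ _ _ _)
    | under i Y X =>
      have h0 := hB
      rw [mu_under] at h0
      obtain ⟨rfl, f, g, hatt, hlab, hext, hhole⟩ := (Formula.div_eq_div_iff _ _ _ _ _ _).1 h0.symm
      obtain ⟨e₀, he₀, he₀'⟩ := (hσ.bin i).edge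
      obtain ⟨S, hS, hS'⟩ := (ih' (g (.inr ⟨0, by decide⟩))).1 Y (hlab (.inr ⟨0, by decide⟩))
      refine reflects_divL hσ hd (hl.trans (σ.mu X).2) (ih ?_)
        (fullRep_div_under hσ f g hatt hext hhole (fun e => ?_) hS (fullRep_handle hB))
        fun _ _ h => .underL _ _ _ _ _ _ h hS'
      · rintro (e | ⟨_, e⟩)
        exacts [hG (.inl e), .inl ⟨X, rfl⟩]
      · have : D.lab (g (.inl e)) = .prim (σ.mode i) := (hlab (.inl e)).trans (he₀ e ▸ he₀')
        exact this ▸ (ih' (g (.inl e))).2 _ (.inl ⟨i, rfl⟩) this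
    | box j X =>
      have h0 := hB
      rw [mu_box] at h0
      obtain ⟨rfl, f, g, hatt, hlab, hext, hhole⟩ := (Formula.div_eq_div_iff _ _ _ _ _ _).1 h0.symm
      obtain ⟨e₀, he₀, he₀'⟩ := (hσ.un j).edge
      refine reflects_divL hσ hd (hl.trans (σ.mu X).2) (ih ?_)
        (fullRep_div_box hσ f g hatt hext hhole (fun e => ?_) (fullRep_handle hB))
        fun _ _ h => .boxL _ _ _ _ h
      · rintro (e | ⟨_, e⟩)
        exacts [hG (.inl e), .inl ⟨X, rfl⟩]
      · have : D.lab (g e) = .prim (σ.modality j) := (hlab e).trans (he₀ e ▸ he₀')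
        exact this ▸ (ih' (g e)).2 _ (.inr ⟨j, rfl⟩) this
    | _ =>
      rename_i i X Y
      have h0 := hB
      rw [mu_over] at h0
      obtain ⟨rfl, f, g, hatt, hlab, hext, hhole⟩ := (Formula.div_eq_div_iff _ _ _ _ _ _).1 h0.symm
      obtain ⟨e₀, he₀, he₀'⟩ := (hσ.bin i).edge
      obtain ⟨S, hS, hS'⟩ := (ih' (g (.inr ⟨1, by decide⟩))).1 Y (hlab (.inr ⟨1, by decide⟩))
      refine reflects_divL hσ hd (hl.trans (σ.mu X).2) (ih ?_)
        (fullRep_div_over hσ f g hatt hext hhole (fun e => ?_) (fullRep_handle hB) hS)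
        fun _ _ h => .overL _ _ _ _ _ _ h hS'
      · rintro (e | ⟨_, e⟩)
        exacts [hG (.inl e), .inl ⟨X, rfl⟩]
      · have : D.lab (g (.inl e)) = .prim (σ.mode i) := (hlab (.inl e)).trans (he₀ e ▸ he₀')
        exact this ▸ (ih' (g (.inl e))).2 _ (.inl ⟨i, rfl⟩) this
  | divR N D hD F hl h ih =>
    exact reflects_divR hσ hd hl (fun hD' => ih (by
      rintro (e | ⟨_, e⟩)
      exacts [hD' e, hG e]))
  | iso G G' Z i _ ih =>
    have i' := i
    obtain ⟨f, g, hatt, hlab, hext⟩ := i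
    have := ih fun e => hlab e ▸ hG (g e)
    refine ⟨fun T hT => ?_, fun p hp hp' => (this.2 p hp hp').of_iso i'⟩
    obtain ⟨Q, hQ, hQT⟩ := this.1 T hT
    exact ⟨Q, hQ.of_iso i', hQT⟩

/-- Reflection only yields some database represented by the antecedent. For the translation of a
given `S` that database is related to `S` by `unique`, so `S` derives the succedent too. -/
theorem embeds_of_decomposable : σ.Embeds C A := by
  have key : ∀ (G : Graph rk) T, Derivable G (σ.mu T).1 → (∀ e, σ.Lang (G.lab e)) →
      ∃ Q, σ.FullRep G Q ∧ NLM.Derivable C A Q T := fun G T h hG =>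
    (reflects_of_derivable hσ hd h hG).1 T rfl
  refine ⟨fun S T => ⟨derivable_of_derivable hσ hd, fun h => ?_⟩, ?_⟩
  · have hS := fullRep_tree hσ S
    obtain ⟨Q, hQ, hQT⟩ := key _ T h fun e => hS.2.lang hσ e (Hypergraph.mem_edges _ e)
    exact (hd.unique _ _ _ hQ hS).derivable hσ hQT
  · rintro G _ hG ⟨T, rfl⟩ h
    obtain ⟨Q, hQ, hQT⟩ := key G T h hG
    exact ⟨Q, T, hQ.iso_tree hσ, rfl, hQT⟩

end rules
end Shapes
end
end HL

namespace HL
open NLM (Struct Form Ctx)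

section
variable {Pr : Type u} {rk : Pr → ℕ} {I J : Type} {r : ℕ}

/-! ## Shapes with one hyperedge -/

section mkShape
variable {S : Type} {n : ℕ} {p : Pr} {att ext : List (Fin n)} {hole : S → List (Fin n)}
  {h : rk p = att.length} {G : Graph rk}

theorem pattern_mkShape (hc : ∀ v, v ∈ ext ∨ v ∈ att) (he : ext.Nodup)
    (hh : ∀ s, (hole s).Nodup) : Pattern (mkShape n p att ext hole h) p :=
  ⟨⟨(), fun _ => rfl, rfl⟩, fun v => (hc v).imp id fun hv => ⟨(), hv⟩, he, hh⟩

theorem places_mkShape {η : Fin n → G.V} {m : G.E} :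
    Places (mkShape n p att ext hole h) G η m ↔ G.lab m = .prim p ∧ G.att m = att.map η :=
  ⟨fun H => H (), fun H _ => H⟩

theorem inner_mkShape {l : List (Fin n)} (hl : l.Nodup) (hl' : ∀ v, v ∈ l ↔ v ∉ ext) :
    (mkShape n p att ext hole h : GraphContext rk S).inner = (l : Multiset (Fin n)) :=
  Hypergraph.inner_eq (G := (mkShape n p att ext hole h).toHypergraph) hl hl'

end mkShape

namespace Shapes
variable {σ : Shapes rk I J r} {C A : Set I} {G : Graph rk}

/-- The label of the topmost hyperedge reveals the constructor, since modes, modalities and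
translated formulas are told apart. -/
theorem RepTop.eq_pair (hσ : σ.Regular C) {Q : Struct {p : Pr // rk p = r} I J} {m : G.E}
    {es : Multiset G.E} {vs : Multiset G.V} {x : List G.V} (h : σ.RepTop G Q m es vs x)
    {i : I} (hm : G.lab m = .prim (σ.mode i)) : ∃ S T, Q = .pair i S T := by
  cases Q with
  | form W => exact absurd (hm.symm.trans h.1) (hσ.prim_mode_ne i W)
  | pair i' S T =>
    obtain ⟨η, es₁, vs₁, es₂, vs₂, h1, -⟩ := h
    obtain ⟨e₀, -, he₀⟩ := (hσ.bin i').edge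
    have := ((h1 e₀).1.trans he₀).symm.trans hm
    obtain rfl := hσ.mode_inj (Formula.prim_injective this)
    exact ⟨S, T, rfl⟩
  | brac j S =>
    obtain ⟨η, es₁, vs₁, h1, -⟩ := h
    obtain ⟨e₀, -, he₀⟩ := (hσ.un j).edge
    exact absurd (Formula.prim_injective (((h1 e₀).1.trans he₀).symm.trans hm)).symm
      (hσ.mode_ne i j)

theorem RepTop.eq_brac (hσ : σ.Regular C) {Q : Struct {p : Pr // rk p = r} I J} {m : G.E}
    {es : Multiset G.E} {vs : Multiset G.V} {x : List G.V} (h : σ.RepTop G Q m es vs x)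
    {j : J} (hm : G.lab m = .prim (σ.modality j)) : ∃ S, Q = .brac j S := by
  cases Q with
  | form W => exact absurd (hm.symm.trans h.1) (hσ.prim_modality_ne j W)
  | pair i S T =>
    obtain ⟨η, es₁, vs₁, es₂, vs₂, h1, -⟩ := h
    obtain ⟨e₀, -, he₀⟩ := (hσ.bin i).edge
    exact absurd (Formula.prim_injective (((h1 e₀).1.trans he₀).symm.trans hm)) (hσ.mode_ne i j)
  | brac j' S =>
    obtain ⟨η, es₁, vs₁, h1, -⟩ := h
    obtain ⟨e₀, -, he₀⟩ := (hσ.un j').edge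
    have := ((h1 e₀).1.trans he₀).symm.trans hm
    obtain rfl := hσ.modality_inj (Formula.prim_injective this)
    exact ⟨S, rfl⟩

theorem RepTop.form (hσ : σ.Regular C) {Q : Struct {p : Pr // rk p = r} I J} {m : G.E}
    {es : Multiset G.E} {vs : Multiset G.V} {x : List G.V} (h : σ.RepTop G Q m es vs x)
    {X : Form {p : Pr // rk p = r} I J} (hm : G.lab m = (σ.mu X).1) : es = {m} ∧ vs = 0 := by
  obtain ⟨W, rfl⟩ := h.eq_form hσ hm
  exact h.2.2

end Shapes

/-! ## The non-associative Lambek calculus -/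

theorem regular_shapesNL (i : Pr) (hi : rk i = 3) : (shapesNL i hi).Regular ∅ where
  pos := one_pos
  bin _ := pattern_mkShape (by decide) (by decide) (by decide)
  un j := j.elim
  comm _ := iff_of_false (Set.notMem_empty _)
    (show ¬ (![[1], [2]] : Fin 2 → List (Fin 3)) 0 = (![[1], [2]] : Fin 2 → List (Fin 3)) 1 by
      decide)
  mode_rank _ := show rk i ≠ 1 by omega
  modality_rank j := j.elim
  mode_inj _ _ _ := rfl
  modality_inj j := j.elim
  mode_ne _ j := j.elim

section NL
variable {i : Pr} {hi : rk i = 3} {G : Graph rk} {es : Multiset G.E} {vs : Multiset G.V}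
  {x : List G.V} {S T Q : Struct {p : Pr // rk p = 1} Unit Empty}

theorem inner_shapesNL (η : Fin 3 → G.V) :
    ((shapesNL i hi).bin ()).inner.map η = {η 1, η 2} := by
  change (Context.toHypergraph (mkShape ..)).inner.map η = _
  rw [inner_mkShape (l := [1, 2]) (by decide) (by decide)]
  rfl

theorem repTop_shapesNL {m : G.E} : (shapesNL i hi).RepTop G (.pair () S T) m es vs x ↔
    ∃ a b c es₁ vs₁ es₂ vs₂, G.lab m = .prim i ∧ G.att m = [a, b, c] ∧
      (shapesNL i hi).Rep G S es₁ vs₁ [b] ∧ (shapesNL i hi).Rep G T es₂ vs₂ [c] ∧ x = [a] ∧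
      es = {m} + es₁ + es₂ ∧ vs = {b, c} + vs₁ + vs₂ := by
  constructor
  · rintro ⟨η, es₁, vs₁, es₂, vs₂, h1, h2, h3, rfl, rfl, rfl⟩
    obtain ⟨h4, h5⟩ := places_mkShape.1 h1
    exact ⟨_, _, _, es₁, vs₁, es₂, vs₂, h4, h5, h2, h3, rfl, rfl,
      congrArg (· + vs₁ + vs₂) (inner_shapesNL η)⟩
  · rintro ⟨a, b, c, es₁, vs₁, es₂, vs₂, h4, h5, h2, h3, rfl, rfl, rfl⟩
    exact ⟨![a, b, c], es₁, vs₁, es₂, vs₂, places_mkShape.2 ⟨h4, h5⟩, h2, h3, rfl, rfl,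
      congrArg (· + vs₁ + vs₂) (inner_shapesNL ![a, b, c]).symm⟩

/-- A mode starts at the external node of its pair and contributes two inner nodes, at which its
arguments start. Thus each inner node and the external node are counted once as first nodes. -/
theorem rep_shapesNL_head (h : (shapesNL i hi).Rep G Q es vs x) :
    es.map (fun e => (G.att e).head?) = vs.map some + {x.head?} := by
  induction Q generalizing es vs x with
  | form A =>
    obtain ⟨e, h1, rfl, rfl, rfl⟩ := h
    simp
  | pair _ S T ihS ihT =>
    obtain ⟨m, h⟩ := Shapes.rep_iff_top.1 h
    obtain ⟨a, b, c, es₁, vs₁, es₂, vs₂, h4, h5, h2, h3, rfl, rfl, rfl⟩ := repTop_shapesNL.1 h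
    simp only [Multiset.map_add, ihS h2, ihT h3, h5, Multiset.map_singleton, List.head?_cons,
      Multiset.insert_eq_cons, ← Multiset.singleton_add]
    abel
  | brac j => exact j.elim

theorem repTop_shapesNL_head {m : G.E} (h : (shapesNL i hi).RepTop G Q m es vs x) :
    (G.att m).head? = x.head? := by
  cases Q with
  | form A => rw [h.2.1]
  | pair _ S T =>
    obtain ⟨a, b, c, es₁, vs₁, es₂, vs₂, h4, h5, h2, h3, rfl, rfl, rfl⟩ := repTop_shapesNL.1 h
    rw [h5]
    rfl
  | brac j => exact j.elim

/-- Both databases are read from the root downwards. The hyperedge starting at the root is unique,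
its label fixes the constructor, and its attachment fixes the roots of the arguments. -/
theorem structEq_shapesNL (hG : Function.Injective fun e => (G.att e).head?)
    {Q' : Struct {p : Pr // rk p = 1} Unit Empty} {es' : Multiset G.E} {vs' : Multiset G.V}
    (h : (shapesNL i hi).Rep G Q es vs x) (h' : (shapesNL i hi).Rep G Q' es' vs' x) :
    (shapesNL i hi).StructEq ∅ ∅ Q Q' := by
  have hσ := regular_shapesNL i hi
  induction Q generalizing Q' es vs x es' vs' with
  | form A =>
    obtain ⟨m, h⟩ := Shapes.rep_iff_top.1 h
    obtain ⟨m', h'⟩ := Shapes.rep_iff_top.1 h'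
    obtain rfl : m = m' := hG ((repTop_shapesNL_head h).trans (repTop_shapesNL_head h').symm)
    obtain ⟨W, rfl⟩ := h'.eq_form hσ h.1
    exact .form (h.1.symm.trans h'.1)
  | pair _ S T ihS ihT =>
    obtain ⟨m, h⟩ := Shapes.rep_iff_top.1 h
    obtain ⟨m', h'⟩ := Shapes.rep_iff_top.1 h'
    obtain rfl : m = m' := hG ((repTop_shapesNL_head h).trans (repTop_shapesNL_head h').symm)
    obtain ⟨a, b, c, es₁, vs₁, es₂, vs₂, h4, h5, h2, h3, rfl, rfl, rfl⟩ := repTop_shapesNL.1 h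
    obtain ⟨S', T', rfl⟩ := h'.eq_pair hσ (i := ()) h4
    obtain ⟨a', b', c', es₁', vs₁', es₂', vs₂', h4', h5', h2', h3', -⟩ := repTop_shapesNL.1 h'
    rw [h5] at h5'
    cases h5'
    exact .pair (ihS h2 h2') (ihT h3 h3')
  | brac j => exact j.elim

theorem fullRep_shapesNL_head (h : (shapesNL i hi).FullRep G Q) :
    Function.Injective fun e => (G.att e).head? := by
  have h1 := rep_shapesNL_head h.2
  obtain ⟨v, hv⟩ := List.length_eq_one_iff.1 h.length
  have h2 := G.nodup_inner_add_ext h.1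
  rw [hv] at h1 h2
  have h3 := h2.map (Option.some_injective _)
  refine fun e e' => Multiset.inj_on_of_nodup_map (s := G.edges)
    (f := fun e => (G.att e).head?) ?_ e (G.mem_edges e) e'
    (G.mem_edges e')
  rw [h1]
  simpa using h3

/-- The hyperedge found at the second or third node of a mode is unique. If a formula sits there,
the corresponding argument is that single leaf. -/
theorem decomposable_shapesNL (i : Pr) (hi : rk i = 3) : (shapesNL i hi).Decomposable ∅ ∅ where
  assoc _ h := absurd h (Set.notMem_empty _)
  unique G Q Q' h h' := structEq_shapesNL (fullRep_shapesNL_head h) h.2 h'.2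
  prod G Q _ η m a b X Y h hm hX ha hY hb hab := by
    have hσ := regular_shapesNL i hi
    have hG := fullRep_shapesNL_head h
    obtain ⟨hm1, hm2⟩ := places_mkShape.1 hm
    obtain ⟨D, Q', es₁, vs₁, es₂, vs₂, y, rfl, h1, h2, h3, h4⟩ := h.2.locate (G.mem_edges m)
    obtain ⟨S, T, rfl⟩ := h2.eq_pair hσ (i := ()) hm1
    obtain ⟨_, _, _, es₃, vs₃, es₄, vs₄, h5, h6, h7, h8, rfl, rfl, rfl⟩ := repTop_shapesNL.1 h2
    rw [hm2] at h6
    cases h6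
    obtain ⟨s, h7⟩ := Shapes.rep_iff_top.1 h7
    obtain ⟨t, h8⟩ := Shapes.rep_iff_top.1 h8
    obtain rfl : s = a := hG ((repTop_shapesNL_head h7).trans (congrArg List.head? ha).symm)
    obtain rfl : t = b := hG ((repTop_shapesNL_head h8).trans (congrArg List.head? hb).symm)
    obtain ⟨rfl, rfl⟩ := h7.form hσ hX
    obtain ⟨rfl, rfl⟩ := h8.form hσ hY
    exact ⟨D, es₁, vs₁, h1, h3.trans (by rfl), h4.trans (by
      simp only [add_zero]
      exact congrArg (vs₁ + ·) (inner_shapesNL η).symm)⟩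
  underSlot G Q _ η m a Y h hm hx hY ha := by
    have hσ := regular_shapesNL i hi
    have hG := fullRep_shapesNL_head h
    obtain ⟨hm1, hm2⟩ := places_mkShape.1 hm
    obtain ⟨m', h1⟩ := Shapes.rep_iff_top.1 h.2
    obtain rfl : m' = m := hG ((repTop_shapesNL_head h1).trans ((congrArg List.head? hx).trans
      (congrArg List.head? hm2).symm))
    obtain ⟨S, T, rfl⟩ := h1.eq_pair hσ (i := ()) hm1
    obtain ⟨_, _, _, es₃, vs₃, es₄, vs₄, h5, h6, h7, h8, h9, h10, h11⟩ := repTop_shapesNL.1 h1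
    rw [hm2] at h6
    cases h6
    obtain ⟨s, h7⟩ := Shapes.rep_iff_top.1 h7
    obtain rfl : s = a := hG ((repTop_shapesNL_head h7).trans (congrArg List.head? ha).symm)
    obtain ⟨rfl, rfl⟩ := h7.form hσ hY
    refine ⟨T, es₄, vs₄, h8, h10, h11.trans ?_⟩
    rw [add_zero]
    exact congrArg (· + vs₄) (inner_shapesNL η).symm
  overSlot G Q _ η m a Y h hm hx hY ha := by
    have hσ := regular_shapesNL i hi
    have hG := fullRep_shapesNL_head h
    obtain ⟨hm1, hm2⟩ := places_mkShape.1 hm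
    obtain ⟨m', h1⟩ := Shapes.rep_iff_top.1 h.2
    obtain rfl : m' = m := hG ((repTop_shapesNL_head h1).trans ((congrArg List.head? hx).trans
      (congrArg List.head? hm2).symm))
    obtain ⟨S, T, rfl⟩ := h1.eq_pair hσ (i := ()) hm1
    obtain ⟨_, _, _, es₃, vs₃, es₄, vs₄, h5, h6, h7, h8, h9, h10, h11⟩ := repTop_shapesNL.1 h1
    rw [hm2] at h6
    cases h6
    obtain ⟨t, h8⟩ := Shapes.rep_iff_top.1 h8
    obtain rfl : t = a := hG ((repTop_shapesNL_head h8).trans (congrArg List.head? ha).symm)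
    obtain ⟨rfl, rfl⟩ := h8.form hσ hY
    refine ⟨S, es₃, vs₃, h7, h10.trans (add_right_comm _ _ _), h11.trans ?_⟩
    rw [add_zero]
    exact congrArg (· + vs₃) (inner_shapesNL η).symm
  dia _ _ j := j.elim
  box _ _ j := j.elim

end NL
end
end HL

theorem Multiset.card_le_count_map {α β : Type*} [DecidableEq β] {s t : Multiset α} {f : α → β}
    {b : β} (hs : s.Nodup) (hst : s ⊆ t) (h : ∀ a ∈ s, f a = b) : s.card ≤ (t.map f).count b := by
  have h1 : s.map f = Multiset.replicate s.card b := by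
    rw [Multiset.map_congr rfl h, Multiset.map_const']
  calc s.card = (s.map f).count b := by rw [h1, Multiset.count_replicate_self]
    _ ≤ _ := Multiset.count_le_of_le _ (Multiset.map_le_map ((Multiset.le_iff_subset hs).2 hst))

namespace HL
open NLM (Struct Form Ctx)

section
variable {Pr : Type u} {rk : Pr → ℕ}

/-! ## The non-associative Lambek calculus with permutation -/

theorem regular_shapesNLP (c : Pr) (hc : rk c = 2) : (shapesNLP c hc).Regular Set.univ where
  pos := one_pos
  bin _ := pattern_mkShape (by decide) (by decide) (by decide)
  un j := j.elim
  comm _ := iff_of_true (Set.mem_univ _) rfl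
  mode_rank _ := show rk c ≠ 1 by omega
  modality_rank j := j.elim
  mode_inj _ _ _ := rfl
  modality_inj j := j.elim
  mode_ne _ j := j.elim

section NLP
variable {c : Pr} {hc : rk c = 2} {G : Graph rk} {es es' : Multiset G.E} {vs vs' : Multiset G.V}
  {x x' : List G.V} {S T Q Q' : Struct {p : Pr // rk p = 1} Unit Empty} {m : G.E}

theorem inner_shapesNLP (η : Fin 2 → G.V) :
    ((shapesNLP c hc).bin ()).inner.map η = {η 1} := by
  change (Context.toHypergraph (mkShape ..)).inner.map η = _
  rw [inner_mkShape (l := [1]) (by decide) (by decide)]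
  rfl

theorem repTop_shapesNLP : (shapesNLP c hc).RepTop G (.pair () S T) m es vs x ↔
    ∃ v w es₁ vs₁ es₂ vs₂, G.lab m = .prim c ∧ G.att m = [v, w] ∧
      (shapesNLP c hc).Rep G S es₁ vs₁ [w] ∧ (shapesNLP c hc).Rep G T es₂ vs₂ [w] ∧ x = [v] ∧
      es = {m} + es₁ + es₂ ∧ vs = {w} + vs₁ + vs₂ := by
  constructor
  · rintro ⟨η, es₁, vs₁, es₂, vs₂, h1, h2, h3, rfl, rfl, rfl⟩
    obtain ⟨h4, h5⟩ := places_mkShape.1 h1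
    exact ⟨_, _, es₁, vs₁, es₂, vs₂, h4, h5, h2, h3, rfl, rfl,
      congrArg (· + vs₁ + vs₂) (inner_shapesNLP η)⟩
  · rintro ⟨v, w, es₁, vs₁, es₂, vs₂, h4, h5, h2, h3, rfl, rfl, rfl⟩
    exact ⟨![v, w], es₁, vs₁, es₂, vs₂, places_mkShape.2 ⟨h4, h5⟩, h2, h3, rfl, rfl,
      congrArg (· + vs₁ + vs₂) (inner_shapesNLP ![v, w]).symm⟩

/-- Both arguments of a mode start at its second node, its only new inner node. This is the reason
for the factor two. -/
theorem rep_shapesNLP_head (h : (shapesNLP c hc).Rep G Q es vs x) :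
    es.map (fun e => (G.att e).head?) = 2 • vs.map some + {x.head?} := by
  induction Q generalizing es vs x with
  | form A =>
    obtain ⟨e, h1, rfl, rfl, rfl⟩ := h
    simp
  | pair _ S T ihS ihT =>
    obtain ⟨m, h⟩ := Shapes.rep_iff_top.1 h
    obtain ⟨v, w, es₁, vs₁, es₂, vs₂, h4, h5, h2, h3, rfl, rfl, rfl⟩ := repTop_shapesNLP.1 h
    simp only [Multiset.map_add, ihS h2, ihT h3, h5, Multiset.map_singleton, List.head?_cons,
      two_smul]
    abel
  | brac j => exact j.elim

theorem repTop_shapesNLP_head (h : (shapesNLP c hc).RepTop G Q m es vs x) :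
    (G.att m).head? = x.head? := by
  cases Q with
  | form A => rw [h.2.1]
  | pair _ S T =>
    obtain ⟨v, w, es₁, vs₁, es₂, vs₂, h4, h5, h2, h3, rfl, rfl, rfl⟩ := repTop_shapesNLP.1 h
    rw [h5]
    rfl
  | brac j => exact j.elim

/-- No three hyperedges start at the same inner node. -/
def TwoHeads (G : Graph rk) : Prop := ∀ w ∉ G.ext, ∀ e₁ e₂ e₃, (G.att e₁).head? = some w →
  (G.att e₂).head? = some w → (G.att e₃).head? = some w → e₁ ≠ e₂ → e₃ = e₁ ∨ e₃ = e₂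

/-- Counting first nodes: three hyperedges at an inner node would exceed two, and the external node,
not being inner, is counted once. -/
theorem fullRep_shapesNLP_head (h : (shapesNLP c hc).FullRep G Q) : TwoHeads G ∧
    ∀ e e', (G.att e).head? = G.ext.head? → (G.att e').head? = G.ext.head? → e = e' := by
  classical
  have h1 := rep_shapesNLP_head h.2
  obtain ⟨v, hv⟩ := List.length_eq_one_iff.1 h.length
  rw [hv] at h1
  have h3 := G.nodup_inner.map (Option.some_injective _)
  constructor
  · intro w hw e₁ e₂ e₃ h4 h5 h6 h12
    by_contra! hne
    have h7 := Multiset.card_le_count_map (s := {e₁, e₂, e₃}) (t := G.edges)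
      (f := fun e => (G.att e).head?) (b := some w)
      (by simp [h12, hne.1.symm, hne.2.symm]) (fun e _ => G.mem_edges e) (by simp [h4, h5, h6])
    rw [h1, Multiset.count_add, Multiset.count_nsmul, Multiset.count_singleton, if_neg] at h7
    · have := Multiset.nodup_iff_count_le_one.1 h3 (some w)
      simp only [Multiset.insert_eq_cons, Multiset.card_cons, Multiset.card_singleton] at h7
      omega
    · rw [hv] at hw
      simpa using hw
  · intro e e' h4 h5
    by_contra hne
    rw [hv] at h4 h5
    have h7 := Multiset.card_le_count_map (s := {e, e'}) (t := G.edges)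
      (f := fun e => (G.att e).head?) (b := some v)
      (by simp [hne]) (fun e _ => G.mem_edges e) (by simpa using ⟨h4, h5⟩)
    rw [h1, Multiset.count_add, Multiset.count_nsmul, Multiset.count_eq_zero.2] at h7
    · simp at h7
    · simp [hv]

theorem ne_of_repTop {s t : G.E} {es₁ es₂ : Multiset G.E} {vs₁ vs₂ : Multiset G.V} {y : List G.V}
    (hS : (shapesNLP c hc).RepTop G S s es₁ vs₁ x) (hT : (shapesNLP c hc).RepTop G T t es₂ vs₂ y)
    (h : ({m} + es₁ + es₂).Nodup) : s ≠ t := by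
  rintro rfl
  exact Multiset.disjoint_left.1 (Multiset.nodup_add.1 h).2.2 (Multiset.mem_add.2 (.inr hS.mem))
    hT.mem

/-- The topmost hyperedges of the arguments are two different hyperedges starting at the same inner
node, and there is no third. So the two decompositions list them either in the same order or
exchanged, which is one use of commutativity. -/
theorem structEq_shapesNLP (hG : TwoHeads G)
    (h : (shapesNLP c hc).RepTop G Q m es vs x) (h' : (shapesNLP c hc).RepTop G Q' m es' vs' x')
    (hes : es.Nodup) (hes' : es'.Nodup) (hvs : ∀ v ∈ vs, v ∉ G.ext) :
    (shapesNLP c hc).StructEq Set.univ ∅ Q Q' := by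
  have hσ := regular_shapesNLP c hc
  induction Q generalizing Q' es vs x es' vs' x' m with
  | form A =>
    obtain ⟨W, rfl⟩ := h'.eq_form hσ h.1
    exact .form (h.1.symm.trans h'.1)
  | pair _ S T ihS ihT =>
    obtain ⟨v, w, es₁, vs₁, es₂, vs₂, h4, h5, h2, h3, rfl, rfl, rfl⟩ := repTop_shapesNLP.1 h
    obtain ⟨S', T', rfl⟩ := h'.eq_pair hσ (i := ()) h4
    obtain ⟨_, _, es₁', vs₁', es₂', vs₂', h4', h5', h2', h3', rfl, rfl, rfl⟩ :=
      repTop_shapesNLP.1 h'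
    rw [h5] at h5'
    cases h5'
    obtain ⟨s, h2⟩ := Shapes.rep_iff_top.1 h2
    obtain ⟨t, h3⟩ := Shapes.rep_iff_top.1 h3
    obtain ⟨s', h2'⟩ := Shapes.rep_iff_top.1 h2'
    obtain ⟨t', h3'⟩ := Shapes.rep_iff_top.1 h3'
    have hne := ne_of_repTop h2 h3 hes
    have hne' := ne_of_repTop h2' h3' hes'
    have key := fun e he => hG w (hvs w (by simp)) s t e (repTop_shapesNLP_head h2)
      (repTop_shapesNLP_head h3) he hne
    have n1 := (Multiset.nodup_add.1 (Multiset.nodup_add.1 hes).1).2.1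
    have n2 := (Multiset.nodup_add.1 hes).2.1
    have n1' := (Multiset.nodup_add.1 (Multiset.nodup_add.1 hes').1).2.1
    have n2' := (Multiset.nodup_add.1 hes').2.1
    simp only [Multiset.mem_add] at hvs
    rcases key s' (repTop_shapesNLP_head h2') with rfl | rfl
    · obtain rfl := (key t' (repTop_shapesNLP_head h3')).resolve_left hne'.symm
      exact .pair (ihS h2 h2' n1 n1' fun v hv => hvs v (.inl (.inr hv)))
        (ihT h3 h3' n2 n2' fun v hv => hvs v (.inr hv))
    · obtain rfl := (key t' (repTop_shapesNLP_head h3')).resolve_right hne'.symm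
      exact .trans (.comm (Set.mem_univ _) _ _)
        (.pair (ihT h3 h2' n2 n1' fun v hv => hvs v (.inr hv))
          (ihS h2 h3' n1 n2' fun v hv => hvs v (.inl (.inr hv))))
  | brac j => exact j.elim

/-- If `m` stands at the root next to a hyperedge `a` labeled by a formula, then the rest is a
translation. -/
theorem exists_rep_shapesNLP (h : (shapesNLP c hc).FullRep G Q) {v w : G.V} {a : G.E}
    (hm : G.lab m = .prim c) (hm' : G.att m = [v, w]) (hx : G.ext = [v])
    {Y : Form {p : Pr // rk p = 1} Unit Empty}
    (hY : G.lab a = ((shapesNLP c hc).mu Y).1) (ha : G.att a = [w]) :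
    ∃ Q' es vs, (shapesNLP c hc).Rep G Q' es vs [w] ∧ G.edges = {m, a} + es ∧
      G.inner = {w} + vs := by
  have hσ := regular_shapesNLP c hc
  obtain ⟨hG, hG'⟩ := fullRep_shapesNLP_head h
  obtain ⟨m', h1⟩ := Shapes.rep_iff_top.1 h.2
  obtain rfl := hG' m' m (repTop_shapesNLP_head h1) (by rw [hm', hx]; rfl)
  obtain ⟨S, T, rfl⟩ := h1.eq_pair hσ (i := ()) hm
  obtain ⟨_, _, es₃, vs₃, es₄, vs₄, h5, h6, h7, h8, h9, h10, h11⟩ := repTop_shapesNLP.1 h1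
  rw [hm'] at h6
  cases h6
  have hw : w ∉ G.ext := by
    rw [← Hypergraph.mem_inner, h11]
    simp
  obtain ⟨s, h7'⟩ := Shapes.rep_iff_top.1 h7
  obtain ⟨t, h8'⟩ := Shapes.rep_iff_top.1 h8
  have hne := ne_of_repTop h7' h8' (h10 ▸ G.edges_full.1)
  rcases hG w hw s t a (repTop_shapesNLP_head h7') (repTop_shapesNLP_head h8') (by rw [ha]; rfl)
    hne with rfl | rfl
  · obtain ⟨rfl, rfl⟩ := h7'.form hσ hY
    exact ⟨T, es₄, vs₄, h8, h10, by rw [h11, add_zero]⟩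
  · obtain ⟨rfl, rfl⟩ := h8'.form hσ hY
    exact ⟨S, es₃, vs₃, h7, h10.trans (add_right_comm _ _ _), by rw [h11, add_zero]⟩

theorem decomposable_shapesNLP (c : Pr) (hc : rk c = 2) :
    (shapesNLP c hc).Decomposable Set.univ ∅ where
  assoc _ h := absurd h (Set.notMem_empty _)
  unique G Q Q' h h' := by
    obtain ⟨m, h1⟩ := Shapes.rep_iff_top.1 h.2
    obtain ⟨m', h1'⟩ := Shapes.rep_iff_top.1 h'.2
    obtain ⟨hG, hG'⟩ := fullRep_shapesNLP_head h
    obtain rfl := hG' m m' (repTop_shapesNLP_head h1) (repTop_shapesNLP_head h1')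
    exact structEq_shapesNLP hG h1 h1' G.edges_full.1 G.edges_full.1 fun v hv => by simpa using hv
  prod G Q _ η m a b X Y h hm hX ha hY hb hab := by
    have hσ := regular_shapesNLP c hc
    obtain ⟨hG, -⟩ := fullRep_shapesNLP_head h
    obtain ⟨hm1, hm2⟩ := places_mkShape.1 hm
    obtain ⟨D, Q', es₁, vs₁, es₂, vs₂, y, rfl, h1, h2, h3, h4⟩ := h.2.locate (G.mem_edges m)
    obtain ⟨S, T, rfl⟩ := h2.eq_pair hσ (i := ()) hm1
    obtain ⟨_, _, es₃, vs₃, es₄, vs₄, h5, h6, h7, h8, rfl, rfl, rfl⟩ := repTop_shapesNLP.1 h2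
    rw [hm2] at h6
    cases h6
    obtain ⟨s, h7⟩ := Shapes.rep_iff_top.1 h7
    obtain ⟨t, h8⟩ := Shapes.rep_iff_top.1 h8
    have hw : η (1 : Fin 2) ∉ G.ext := by
      rw [← Hypergraph.mem_inner, h4]
      simp
    have hne := ne_of_repTop h7 h8 (Multiset.nodup_add.1 (h3 ▸ G.edges_full.1)).2.1
    have key := fun e he => hG _ hw s t e (repTop_shapesNLP_head h7) (repTop_shapesNLP_head h8) he
      hne
    refine ⟨D, es₁, vs₁, h1, ?_⟩
    have hin : ({η (1 : Fin 2)} : Multiset G.V) = _ := (inner_shapesNLP (hc := hc) η).symm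
    rcases key a (congrArg List.head? ha) with rfl | rfl
    · obtain rfl := (key b (congrArg List.head? hb)).resolve_left hab.symm
      obtain ⟨rfl, rfl⟩ := h7.form hσ hX
      obtain ⟨rfl, rfl⟩ := h8.form hσ hY
      refine ⟨h3, h4.trans ?_⟩
      rw [add_zero, add_zero]
      exact congrArg (vs₁ + ·) hin
    -- The arguments appear in the other order. The context `D` is unaffected, as only the multisets
    -- matter.
    · obtain rfl := (key b (congrArg List.head? hb)).resolve_right hab.symm
      obtain ⟨rfl, rfl⟩ := h8.form hσ hX
      obtain ⟨rfl, rfl⟩ := h7.form hσ hY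
      refine ⟨h3.trans (congrArg _ (add_right_comm _ _ _)), h4.trans ?_⟩
      rw [add_zero, add_zero]
      exact congrArg (vs₁ + ·) hin
  underSlot G Q _ η m a Y h hm hx hY ha := by
    obtain ⟨hm1, hm2⟩ := places_mkShape.1 hm
    obtain ⟨Q', es, vs, h1, h2, h3⟩ := exists_rep_shapesNLP h hm1 hm2 hx hY ha
    exact ⟨Q', es, vs, h1, h2, h3.trans (congrArg (· + vs) (inner_shapesNLP (hc := hc) η).symm)⟩
  overSlot G Q _ η m a Y h hm hx hY ha := by
    obtain ⟨hm1, hm2⟩ := places_mkShape.1 hm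
    obtain ⟨Q', es, vs, h1, h2, h3⟩ := exists_rep_shapesNLP h hm1 hm2 hx hY ha
    exact ⟨Q', es, vs, h1, h2, h3.trans (congrArg (· + vs) (inner_shapesNLP (hc := hc) η).symm)⟩
  dia _ _ j := j.elim
  box _ _ j := j.elim

end NLP
end
end HL

/-! ### Splitting multisets -/

namespace Multiset
variable {α β : Type*}

theorem exists_add_of_map_eq_add {f : α → β} {s : Multiset α} {t u : Multiset β}
    (h : s.map f = t + u) : ∃ s₁ s₂, s = s₁ + s₂ ∧ s₁.map f = t ∧ s₂.map f = u := by
  classical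
  induction t using Multiset.induction generalizing s with
  | empty => exact ⟨0, s, by simp, rfl, by simpa using h⟩
  | cons b t ih =>
    rw [Multiset.cons_add, ← Multiset.map_eq_cons] at h
    obtain ⟨a, ha, rfl, h⟩ := h
    obtain ⟨s₁, s₂, h1, rfl, rfl⟩ := ih h
    exact ⟨a ::ₘ s₁, s₂, by rw [Multiset.cons_add, ← h1, Multiset.cons_erase ha], by simp, rfl⟩

theorem exists_add_of_card_eq_add {s : Multiset α} {m n : ℕ} (h : s.card = m + n) :
    ∃ s₁ s₂, s = s₁ + s₂ ∧ s₁.card = m ∧ s₂.card = n := by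
  induction s using Quot.inductionOn with
  | h l =>
    simp only [quot_mk_to_coe'', coe_card] at h
    refine ⟨(l.take m : List α), (l.drop m : List α), ?_, by simp [h], by simp [h]⟩
    rw [coe_add, List.take_append_drop]
    rfl

end Multiset

/-! ### Leaves of structured databases -/

namespace NLM

/-- The formulas in a structured database. -/
def Struct.leaves {P I J : Type*} : Struct P I J → Multiset (Form P I J)
  | .form A => {A}
  | .pair _ S T => S.leaves + T.leaves
  | .brac _ S => S.leaves

theorem Struct.card_leaves_pos {P I J : Type*} (Q : Struct P I J) : 0 < Q.leaves.card := by
  induction Q with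
  | form A => simp [leaves]
  | pair i S T hS hT => simp [leaves, hS]
  | brac j S hS => exact hS

theorem Struct.exists_leaves {P I J : Type*} (i : I) {s : Multiset (Form P I J)} (hs : s ≠ 0) :
    ∃ Q : Struct P I J, Q.leaves = s := by
  induction s using Multiset.induction with
  | empty => exact absurd rfl hs
  | cons A s ih =>
    by_cases h : s = 0
    · exact ⟨.form A, by simp [h, leaves]⟩
    · obtain ⟨Q, rfl⟩ := ih h
      exact ⟨.pair i (.form A) Q, by simp [leaves]⟩

end NLM

namespace HL
open NLM (Struct Form Ctx)

section
variable {Pr : Type u} {rk : Pr → ℕ}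

/-! ## The Lambek calculus with permutation -/

theorem regular_shapesLP (o : Pr) (ho : rk o = 2) : (shapesLP o ho).Regular Set.univ where
  pos := one_pos
  bin _ := pattern_mkShape (by decide) (by decide) (by decide)
  un j := j.elim
  comm _ := iff_of_true (Set.mem_univ _) rfl
  mode_rank _ := show rk o ≠ 1 by omega
  modality_rank j := j.elim
  mode_inj _ _ _ := rfl
  modality_inj j := j.elim
  mode_ne _ j := j.elim

section LP
variable {o : Pr} {ho : rk o = 2} {G : Graph rk} {es es' : Multiset G.E} {vs vs' : Multiset G.V}
  {x : List G.V} {S T Q Q' : Struct {p : Pr // rk p = 1} Unit Empty} {m : G.E}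

theorem inner_shapesLP (η : Fin 2 → G.V) :
    ((shapesLP o ho).bin ()).inner.map η = {η 0} := by
  change (Context.toHypergraph (mkShape ..)).inner.map η = _
  rw [inner_mkShape (l := [0]) (by decide) (by decide)]
  rfl

theorem repTop_shapesLP : (shapesLP o ho).RepTop G (.pair () S T) m es vs x ↔
    ∃ u v es₁ vs₁ es₂ vs₂, G.lab m = .prim o ∧ G.att m = [u, v] ∧
      (shapesLP o ho).Rep G S es₁ vs₁ [v] ∧ (shapesLP o ho).Rep G T es₂ vs₂ [v] ∧ x = [v] ∧
      es = {m} + es₁ + es₂ ∧ vs = {u} + vs₁ + vs₂ := by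
  constructor
  · rintro ⟨η, es₁, vs₁, es₂, vs₂, h1, h2, h3, rfl, rfl, rfl⟩
    obtain ⟨h4, h5⟩ := places_mkShape.1 h1
    exact ⟨_, _, es₁, vs₁, es₂, vs₂, h4, h5, h2, h3, rfl, rfl,
      congrArg (· + vs₁ + vs₂) (inner_shapesLP η)⟩
  · rintro ⟨u, v, es₁, vs₁, es₂, vs₂, h4, h5, h2, h3, rfl, rfl, rfl⟩
    exact ⟨![u, v], es₁, vs₁, es₂, vs₂, places_mkShape.2 ⟨h4, h5⟩, h2, h3, rfl, rfl,
      congrArg (· + vs₁ + vs₂) (inner_shapesLP ![u, v]).symm⟩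

/-- All formula hyperedges sit at the external node, and each mode joins it to a private inner node.
The bracketing leaves no trace apart from there being one mode fewer than formulas. Conversely, the
modes can be dealt out to the subtrees in any way that respects the numbers of leaves. -/
theorem rep_shapesLP_iff : (shapesLP o ho).Rep G Q es vs x ↔ ∃ v fe me, x = [v] ∧ es = fe + me ∧
    (∀ e ∈ fe, G.att e = [v]) ∧ fe.map G.lab = Q.leaves.map (fun A => ((shapesLP o ho).mu A).1) ∧
    (∀ e ∈ me, G.lab e = .prim o) ∧ me.map G.att = vs.map (fun u => [u, v]) ∧
    fe.card = me.card + 1 := by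
  constructor
  · intro h
    induction Q generalizing es vs x with
    | form A =>
      obtain ⟨v, hv⟩ := List.length_eq_one_iff.1 h.length
      obtain ⟨e, h1, h2, rfl, rfl⟩ := h
      exact ⟨v, {e}, 0, hv, by simp, by simpa [hv] using h2, by simpa [Struct.leaves] using h1,
        by simp, by simp, by simp⟩
    | pair _ S T ihS ihT =>
      obtain ⟨m, h⟩ := Shapes.rep_iff_top.1 h
      obtain ⟨u, v, es₁, vs₁, es₂, vs₂, h4, h5, h2, h3, rfl, rfl, rfl⟩ := repTop_shapesLP.1 h
      obtain ⟨v₁, f₁, m₁, hv₁, rfl, a1, a2, a3, a4, a5⟩ := ihS h2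
      obtain ⟨v₂, f₂, m₂, hv₂, rfl, b1, b2, b3, b4, b5⟩ := ihT h3
      obtain rfl : v = v₁ := by simpa using hv₁
      obtain rfl : v = v₂ := by simpa using hv₂
      refine ⟨v, f₁ + f₂, {m} + m₁ + m₂, rfl, by abel, ?_, ?_, ?_, ?_, ?_⟩
      · intro e he
        exact (Multiset.mem_add.1 he).elim (a1 e) (b1 e)
      · simp [Struct.leaves, a2, b2]
      · intro e he
        simp only [Multiset.mem_add, Multiset.mem_singleton] at he
        rcases he with (rfl | he) | he
        exacts [h4, a3 e he, b3 e he]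
      · simp [h5, a4, b4]
      · simp [a5, b5]
        omega
    | brac j => exact j.elim
  · rintro ⟨v, fe, me, rfl, rfl, h1, h2, h3, h4, h5⟩
    induction Q generalizing fe me vs with
    | form A =>
      obtain ⟨e, rfl, h6⟩ := Multiset.map_eq_singleton.1 h2
      obtain rfl : me = 0 := by simpa using h5
      exact ⟨e, h6, h1 e (by simp), by simp, by simpa [eq_comm] using h4⟩
    | pair _ S T ihS ihT =>
      rw [Struct.leaves, Multiset.map_add] at h2
      obtain ⟨f₁, f₂, rfl, a2, b2⟩ := Multiset.exists_add_of_map_eq_add h2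
      have c1 := congrArg Multiset.card a2
      have c2 := congrArg Multiset.card b2
      have p1 := S.card_leaves_pos
      have p2 := T.card_leaves_pos
      simp only [Multiset.card_map, Multiset.card_add] at c1 c2 h5
      -- One mode for the top pair, and one fewer than its leaves for each argument. Both arguments
      -- have leaves, so the truncated subtractions are exact.
      obtain ⟨m₀, m₃, rfl, d0, d3⟩ := Multiset.exists_add_of_card_eq_add (s := me) (m := 1)
        (n := (f₁.card - 1) + (f₂.card - 1)) (by omega)
      obtain ⟨m₁, m₂, rfl, d1, d2⟩ := Multiset.exists_add_of_card_eq_add d3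
      obtain ⟨m, rfl⟩ := Multiset.card_eq_one.1 d0
      rw [Multiset.map_add, Multiset.map_add] at h4
      obtain ⟨vs₀, vs₃, rfl, e0, e3⟩ := Multiset.exists_add_of_map_eq_add h4.symm
      obtain ⟨vs₁, vs₂, rfl, e1, e2⟩ := Multiset.exists_add_of_map_eq_add e3
      rw [Multiset.map_singleton] at e0
      obtain ⟨u, rfl, e4⟩ := Multiset.map_eq_singleton.1 e0
      simp only [Multiset.mem_add] at h1 h3
      refine (repTop_shapesLP.2 ⟨u, v, f₁ + m₁, vs₁, f₂ + m₂, vs₂, h3 m (.inl (by simp)), e4.symm,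
        ihS f₁ m₁ (fun e he => h1 e (.inl he)) a2 (fun e he => h3 e (.inr (.inl he))) e1.symm
          (by omega),
        ihT f₂ m₂ (fun e he => h1 e (.inr he)) b2 (fun e he => h3 e (.inr (.inr he))) e2.symm
          (by omega), rfl, by abel, by abel⟩ : (shapesLP o ho).RepTop G _ m _ _ _).rep
    | brac j => exact j.elim

/-- Commutativity and associativity bring any chosen leaf to the front. -/
theorem exists_structEq_pair {A : Form {p : Pr // rk p = 1} Unit Empty} (hA : A ∈ Q.leaves) :
    Q = .form A ∨ ∃ Q', Q.leaves = A ::ₘ Q'.leaves ∧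
      (shapesLP o ho).StructEq Set.univ Set.univ Q (.pair () (.form A) Q') := by
  induction Q with
  | form B =>
    rw [Multiset.mem_singleton.1 hA]
    exact .inl rfl
  | pair _ S T ihS ihT =>
    rcases Multiset.mem_add.1 hA with hA | hA
    · rcases ihS hA with rfl | ⟨S', h1, h2⟩
      · exact .inr ⟨T, by simp [Struct.leaves], .refl _⟩
      · exact .inr ⟨.pair () S' T, by simp [Struct.leaves, h1],
          .trans (.pair h2 (.refl _)) (.symm (.assoc (Set.mem_univ _) _ _ _))⟩
    · rcases ihT hA with rfl | ⟨T', h1, h2⟩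
      · exact .inr ⟨S, by simp [Struct.leaves, add_comm], .comm (Set.mem_univ _) _ _⟩
      · exact .inr ⟨.pair () T' S, by simp [Struct.leaves, h1, add_comm],
          .trans (.comm (Set.mem_univ _) _ _) (.trans (.pair h2 (.refl _))
            (.symm (.assoc (Set.mem_univ _) _ _ _)))⟩
  | brac j => exact j.elim

/-- Induction on the number of leaves, removing a leaf and a partner with the same translation from
the two databases. A single leaf cannot face a pair, because the numbers of leaves agree. -/
theorem structEq_shapesLP
    (h : Q.leaves.map (fun A => ((shapesLP o ho).mu A).1) =
      Q'.leaves.map fun A => ((shapesLP o ho).mu A).1) :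
    (shapesLP o ho).StructEq Set.univ Set.univ Q Q' := by
  induction hn : Q.leaves.card using Nat.strong_induction_on generalizing Q Q' with
  | _ n ih =>
  obtain ⟨A, hA⟩ := Multiset.card_pos_iff_exists_mem.1 Q.card_leaves_pos
  obtain ⟨B, hB, hAB⟩ := Multiset.mem_map.1 (h ▸ Multiset.mem_map_of_mem _ hA)
  have hp := Q.card_leaves_pos
  have hp' := Q'.card_leaves_pos
  have hc := congrArg Multiset.card h
  simp only [Multiset.card_map] at hc
  rcases exists_structEq_pair (o := o) (ho := ho) hA with rfl | ⟨Q₁, h1, h2⟩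
  · rcases exists_structEq_pair (o := o) (ho := ho) hB with rfl | ⟨Q₁', h1', h2'⟩
    · exact .form hAB.symm
    · have := Q₁'.card_leaves_pos
      rw [h1'] at hc
      simp [Struct.leaves] at hc
      simp [hc] at this
  · rcases exists_structEq_pair (o := o) (ho := ho) hB with rfl | ⟨Q₁', h1', h2'⟩
    · have := Q₁.card_leaves_pos
      rw [h1] at hc
      simp [Struct.leaves] at hc
      simp [hc] at this
    · refine .trans h2 (.trans (.pair (.form hAB.symm) (ih _ ?_ ?_ rfl)) h2'.symm)
      · rw [← hn, h1]
        simp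
      · rw [h1, h1', Multiset.map_cons, Multiset.map_cons, hAB] at h
        exact (Multiset.cons_inj_right _).1 h

theorem lab_ne_of_map_eq {fe : Multiset G.E} {s : Multiset (Form {p : Pr // rk p = 1} Unit Empty)}
    (h : fe.map G.lab = s.map fun A => ((shapesLP o ho).mu A).1) :
    ∀ e ∈ fe, ∃ A, ((shapesLP o ho).mu A).1 = G.lab e := by
  intro e he
  obtain ⟨A, _, hA⟩ := Multiset.mem_map.1 (h ▸ Multiset.mem_map_of_mem _ he)
  exact ⟨A, hA⟩

/-- Hyperedges at `v` that are labeled by translations of formulas, with the right number of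
modes, form a translation. -/
theorem exists_rep_shapesLP {fe me : Multiset G.E} {v : G.V} (h1 : ∀ e ∈ fe, G.att e = [v])
    (h2 : ∀ e ∈ fe, ∃ A, ((shapesLP o ho).mu A).1 = G.lab e) (h3 : ∀ e ∈ me, G.lab e = .prim o)
    (h4 : me.map G.att = vs.map fun u => [u, v]) (h5 : fe.card = me.card + 1) :
    ∃ Q', (shapesLP o ho).Rep G Q' (fe + me) vs [v] := by
  obtain ⟨s, hs⟩ := Multiset.exists_map_eq (f := fun A => ((shapesLP o ho).mu A).1)
    (t := fe.map G.lab) (by simpa using h2)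
  obtain ⟨Q', rfl⟩ := Struct.exists_leaves () (s := s) (by
    rintro rfl
    have := congrArg Multiset.card hs
    simp at this
    omega)
  exact ⟨Q', rep_shapesLP_iff.2 ⟨v, fe, me, rfl, rfl, h1, hs.symm, h3, h4, h5⟩⟩

/-- Besides a mode `m` and a hyperedge `a` labeled by a formula, a translation consists of formulas
at the external node and modes, one fewer of the latter. -/
theorem exists_decomposition_shapesLP (h : (shapesLP o ho).FullRep G Q) {u w : G.V} {a : G.E}
    (hm : G.lab m = .prim o) (hm' : G.att m = [u, w])
    {Y : Form {p : Pr // rk p = 1} Unit Empty} (hY : G.lab a = ((shapesLP o ho).mu Y).1) :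
    G.ext = [w] ∧ ∃ fe me vs, G.edges = {m, a} + (fe + me) ∧ G.inner = {u} + vs ∧
      (∀ e ∈ fe, G.att e = [w]) ∧ (∀ e ∈ fe, ∃ A, ((shapesLP o ho).mu A).1 = G.lab e) ∧
      (∀ e ∈ me, G.lab e = .prim o) ∧ me.map G.att = vs.map (fun u => [u, w]) ∧
      fe.card = me.card + 1 := by
  classical
  have hσ := regular_shapesLP o ho
  obtain ⟨v, fe, me, h0, h1, h2, h3, h4, h5, h6⟩ := rep_shapesLP_iff.1 h.2
  have hl := lab_ne_of_map_eq h3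
  have hm1 : m ∈ me := (Multiset.mem_add.1 (h1 ▸ G.mem_edges m)).resolve_left fun hm1 => by
    obtain ⟨A, hA⟩ := hl m hm1
    exact hσ.prim_mode_ne () A (hm.symm.trans hA.symm)
  have ha1 : a ∈ fe := (Multiset.mem_add.1 (h1 ▸ G.mem_edges a)).resolve_right fun ha1 =>
    hσ.prim_mode_ne () Y ((h4 a ha1).symm.trans hY)
  obtain ⟨fe, rfl⟩ := Multiset.exists_cons_of_mem ha1
  obtain ⟨me, rfl⟩ := Multiset.exists_cons_of_mem hm1
  rw [Multiset.map_cons] at h5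
  obtain ⟨u', hu', hu, h5⟩ := (Multiset.map_eq_cons _ _ _ _).2 h5.symm
  rw [hm'] at hu
  cases hu
  rw [Multiset.card_cons, Multiset.card_cons] at h6
  refine ⟨h0, fe, me, G.inner.erase u, ?_, ?_, fun e he => h2 e (Multiset.mem_cons_of_mem he),
    fun e he => hl e (Multiset.mem_cons_of_mem he), fun e he => h4 e (Multiset.mem_cons_of_mem he),
    h5.symm, by omega⟩
  · rw [h1, Multiset.insert_eq_cons]
    simp only [← Multiset.singleton_add]
    abel
  · rw [Multiset.singleton_add, Multiset.cons_erase hu']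

/-- The formula hyperedges are recovered from all hyperedges as those not labeled by the mode. Hence
two representations have the same ones. -/
theorem filter_lab_shapesLP {fe me : Multiset G.E}
    (h : fe.map G.lab = Q.leaves.map fun A => ((shapesLP o ho).mu A).1)
    (h' : ∀ e ∈ me, G.lab e = .prim o) [DecidablePred fun e => G.lab e = .prim o] :
    (fe + me).filter (fun e => ¬ G.lab e = .prim o) = fe := by
  rw [Multiset.filter_add, Multiset.filter_eq_self.2, Multiset.filter_eq_nil.2, add_zero]
  · exact fun e he => not_not.2 (h' e he)
  · intro e he he'
    obtain ⟨A, hA⟩ := lab_ne_of_map_eq h e he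
    exact (regular_shapesLP o ho).prim_mode_ne () A (he'.symm.trans hA.symm)

theorem decomposable_shapesLP (o : Pr) (ho : rk o = 2) :
    (shapesLP o ho).Decomposable Set.univ Set.univ where
  assoc _ _ G S T U es vs x := by
    simp only [rep_shapesLP_iff, Struct.leaves, add_assoc]
  unique G Q Q' h h' := by
    classical
    obtain ⟨v, fe, me, h0, h1, h2, h3, h4, h5, h6⟩ := rep_shapesLP_iff.1 h.2
    obtain ⟨v', fe', me', h0', h1', h2', h3', h4', h5', h6'⟩ := rep_shapesLP_iff.1 h'.2
    have := filter_lab_shapesLP h3 h4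
    rw [← h1, h1', filter_lab_shapesLP h3' h4'] at this
    subst this
    exact structEq_shapesLP (h3.symm.trans h3')
  prod G Q _ η m a b X Y h hm hX ha hY hb hab := by
    have hσ := regular_shapesLP o ho
    obtain ⟨hm1, hm2⟩ := places_mkShape.1 hm
    obtain ⟨hx, fe, me, vs, h1, h2, h3, h4, h5, h6, h7⟩ :=
      exists_decomposition_shapesLP h hm1 hm2 hX
    have hb1 := h1 ▸ G.mem_edges b
    simp only [Multiset.insert_eq_cons, Multiset.mem_add, Multiset.mem_cons,
      Multiset.mem_singleton, hab.symm, or_false] at hb1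
    have hbo : G.lab b ≠ .prim o := fun hbo => hσ.prim_mode_ne () Y (hbo.symm.trans hY)
    rcases hb1 with rfl | hb1 | hb1
    · exact absurd hm1 hbo
    · obtain ⟨fe, rfl⟩ := Multiset.exists_cons_of_mem hb1
      have hin : ({η (0 : Fin 2)} : Multiset G.V) = _ := (inner_shapesLP (ho := ho) η).symm
      rw [Multiset.card_cons] at h7
      have hes : G.edges = (fe + me) + {m, a, b} := by
        rw [h1, Multiset.insert_eq_cons, Multiset.insert_eq_cons]
        simp only [← Multiset.singleton_add, Multiset.insert_eq_cons]
        abel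
      -- After removing `m`, `a` and `b`, as many formulas as modes remain. If there are none, the
      -- context is empty; otherwise one mode `m'` joins the hole to a database made of everything
      -- else.
      rcases Multiset.empty_or_exists_mem me with rfl | ⟨m', hm'⟩
      · obtain rfl : fe = 0 := by simpa using h7
        obtain rfl : vs = 0 := by simpa [eq_comm] using h6
        exact ⟨.here, 0, 0, ⟨rfl, rfl, hx⟩, hes, h2.trans ((add_comm _ _).trans
          (congrArg (0 + ·) hin))⟩
      · obtain ⟨me, rfl⟩ := Multiset.exists_cons_of_mem hm'
        rw [Multiset.map_cons] at h6
        classical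
        obtain ⟨u, hu, hu', h6⟩ := (Multiset.map_eq_cons _ _ _ _).2 h6.symm
        obtain ⟨Q', hQ'⟩ := exists_rep_shapesLP (ho := ho) (fe := fe) (me := me)
          (fun e he => h3 e (Multiset.mem_cons_of_mem he))
          (fun e he => h4 e (Multiset.mem_cons_of_mem he))
          (fun e he => h5 e (Multiset.mem_cons_of_mem he)) h6.symm (by
            rw [Multiset.card_cons] at h7
            omega)
        refine ⟨.pairL () .here Q', fe + (m' ::ₘ me), vs, ⟨m', ![u, η (1 : Fin 2)], 0, 0, fe + me,
          vs.erase u, places_mkShape.2 ⟨h5 _ (Multiset.mem_cons_self _ _), hu'.symm⟩,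
          ⟨rfl, rfl, rfl⟩, hQ', hx, ?_, ?_⟩, hes, h2.trans ((add_comm _ _).trans
            (congrArg (vs + ·) hin))⟩
        · rw [← Multiset.singleton_add]
          abel
        · rw [add_zero]
          exact (Multiset.cons_erase hu).symm.trans
            (congrArg (· + vs.erase u) (inner_shapesLP (ho := ho) ![u, η (1 : Fin 2)]).symm)
    · exact absurd (h5 b hb1) hbo
  underSlot G Q _ η m a Y h hm hx hY ha := by
    obtain ⟨hm1, hm2⟩ := places_mkShape.1 hm
    obtain ⟨hx, fe, me, vs, h1, h2, h3, h4, h5, h6, h7⟩ :=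
      exists_decomposition_shapesLP h hm1 hm2 hY
    obtain ⟨Q', hQ'⟩ := exists_rep_shapesLP h3 h4 h5 h6 h7
    exact ⟨Q', _, vs, hQ', h1, h2.trans (congrArg (· + vs) (inner_shapesLP (ho := ho) η).symm)⟩
  overSlot G Q _ η m a Y h hm hx hY ha := by
    obtain ⟨hm1, hm2⟩ := places_mkShape.1 hm
    obtain ⟨hx, fe, me, vs, h1, h2, h3, h4, h5, h6, h7⟩ :=
      exists_decomposition_shapesLP h hm1 hm2 hY
    obtain ⟨Q', hQ'⟩ := exists_rep_shapesLP h3 h4 h5 h6 h7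
    exact ⟨Q', _, vs, hQ', h1, h2.trans (congrArg (· + vs) (inner_shapesLP (ho := ho) η).symm)⟩
  dia _ _ j := j.elim
  box _ _ j := j.elim

end LP
end
end HL

theorem Multiset.eq_of_nodup_bind {α β : Type*} {s : Multiset α} {f : α → Multiset β}
    (h : (s.bind f).Nodup) {a a' : α} (ha : a ∈ s) (ha' : a' ∈ s) {b : β} (hb : b ∈ f a)
    (hb' : b ∈ f a') : a = a' := by
  by_contra hne
  obtain ⟨s, rfl⟩ := Multiset.exists_cons_of_mem ha
  have ha' := (Multiset.mem_cons.1 ha').resolve_left (Ne.symm hne)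
  rw [Multiset.cons_bind, Multiset.nodup_add] at h
  exact Multiset.disjoint_left.1 h.2.2 hb (Multiset.mem_bind.2 ⟨a', ha', hb'⟩)

namespace HL
open NLM (Struct Form Ctx)

section
variable {Pr : Type u} {rk : Pr → ℕ} {J : Type}

/-! ## The Lambek calculus and the Lambek calculus with brackets -/

/-- The translation of a calculus with one mode of the shape `RO` and modalities of the
shape `U`. -/
def shapesRO (o : Pr) (ho : rk o = 1) (modality : J → Pr) (hJ : ∀ j, rk (modality j) = 4) :
    Shapes rk Unit J 2 where
  mode _ := o
  modality := modality
  bin _ := shapeRO o ho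
  un j := shapeU (modality j) (hJ j)
  bin_ext _ := rfl
  bin_hole _ s := by fin_cases s <;> rfl
  un_ext _ := rfl
  un_hole _ _ := rfl

/-- The nodes where a hyperedge with this attachment starts or where the inside of a bracket
ends. -/
def outs {α : Type*} : List α → Multiset α
  | [x, _] => {x}
  | [x, _, _, b] => {x, b}
  | _ => 0

/-- The nodes where a hyperedge with this attachment ends or where the inside of a bracket
starts. -/
def ins {α : Type*} : List α → Multiset α
  | [_, y] => {y}
  | [_, y, a, _] => {y, a}
  | _ => 0

/-- The node of a hyperedge of rank one. -/
def mids {α : Type*} : List α → Multiset α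
  | [y] => {y}
  | _ => 0

/-- Hyperedges are determined by each of the nodes in `outs`, in `ins`, and in `mids`. -/
structure Threaded (G : Graph rk) : Prop where
  outs : ∀ e e' v, v ∈ outs (G.att e) → v ∈ outs (G.att e') → e = e'
  ins : ∀ e e' v, v ∈ ins (G.att e) → v ∈ ins (G.att e') → e = e'
  mids : ∀ e e' v, v ∈ mids (G.att e) → v ∈ mids (G.att e') → e = e'

section RO
variable {o : Pr} {ho : rk o = 1} {modality : J → Pr} {hJ : ∀ j, rk (modality j) = 4}
  {G : Graph rk} {es es' : Multiset G.E} {vs vs' : Multiset G.V}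
  {x : List G.V} {u v w z : G.V} {S T Q Q' : Struct {p : Pr // rk p = 2} Unit J} {m : G.E} {j : J}

local notation "σ₀" => shapesRO o ho modality hJ

variable (o ho hJ) in
theorem regular_shapesRO (hinj : Function.Injective modality) :
    (shapesRO o ho modality hJ).Regular ∅ where
  pos := two_pos
  bin _ := pattern_mkShape (by decide) (by decide) (by decide)
  un j := pattern_mkShape (by decide) (by decide) (by decide)
  comm _ := iff_of_false (Set.notMem_empty _)
    (show ¬ (![[0, 1], [1, 2]] : Fin 2 → List (Fin 3)) 0 = (![[0, 1], [1, 2]] : Fin 2 → _) 1 by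
      decide)
  mode_rank _ := show rk o ≠ 2 by omega
  modality_rank j := show rk (modality j) ≠ 2 by rw [hJ]; decide
  mode_inj _ _ _ := rfl
  modality_inj := hinj
  -- The mode has rank one and the modalities have rank four.
  mode_ne _ j h := by
    have : rk o = rk (modality j) := congrArg rk h
    rw [ho, hJ] at this
    omega

theorem inner_bin_shapesRO (η : Fin 3 → G.V) : ((σ₀).bin ()).inner.map η = {η 1} := by
  change (Context.toHypergraph (mkShape ..)).inner.map η = _
  rw [inner_mkShape (l := [1]) (by decide) (by decide)]
  rfl

theorem inner_un_shapesRO (η : Fin 4 → G.V) : ((σ₀).un j).inner.map η = {η 2, η 3} := by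
  change (Context.toHypergraph (mkShape ..)).inner.map η = _
  rw [inner_mkShape (l := [2, 3]) (by decide) (by decide)]
  rfl

theorem repTop_shapesRO_pair : (σ₀).RepTop G (.pair () S T) m es vs x ↔
    ∃ u y v es₁ vs₁ es₂ vs₂, G.lab m = .prim o ∧ G.att m = [y] ∧ (σ₀).Rep G S es₁ vs₁ [u, y] ∧
      (σ₀).Rep G T es₂ vs₂ [y, v] ∧ x = [u, v] ∧ es = {m} + es₁ + es₂ ∧
      vs = {y} + vs₁ + vs₂ := by
  constructor
  · rintro ⟨η, es₁, vs₁, es₂, vs₂, h1, h2, h3, rfl, rfl, rfl⟩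
    obtain ⟨h4, h5⟩ := places_mkShape.1 h1
    exact ⟨_, _, _, es₁, vs₁, es₂, vs₂, h4, h5, h2, h3, rfl, rfl,
      congrArg (· + vs₁ + vs₂) (inner_bin_shapesRO η)⟩
  · rintro ⟨u, y, v, es₁, vs₁, es₂, vs₂, h4, h5, h2, h3, rfl, rfl, rfl⟩
    exact ⟨![u, y, v], es₁, vs₁, es₂, vs₂, places_mkShape.2 ⟨h4, h5⟩, h2, h3, rfl, rfl,
      congrArg (· + vs₁ + vs₂) (inner_bin_shapesRO ![u, y, v]).symm⟩

theorem repTop_shapesRO_brac : (σ₀).RepTop G (.brac j S) m es vs x ↔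
    ∃ u v a b es₁ vs₁, G.lab m = .prim (modality j) ∧ G.att m = [u, v, a, b] ∧
      (σ₀).Rep G S es₁ vs₁ [a, b] ∧ x = [u, v] ∧ es = {m} + es₁ ∧ vs = {a, b} + vs₁ := by
  constructor
  · rintro ⟨η, es₁, vs₁, h1, h2, rfl, rfl, rfl⟩
    obtain ⟨h4, h5⟩ := places_mkShape.1 h1
    exact ⟨_, _, _, _, es₁, vs₁, h4, h5, h2, rfl, rfl, congrArg (· + vs₁) (inner_un_shapesRO η)⟩
  · rintro ⟨u, v, a, b, es₁, vs₁, h4, h5, h2, rfl, rfl, rfl⟩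
    exact ⟨![u, v, a, b], es₁, vs₁, places_mkShape.2 ⟨h4, h5⟩, h2, rfl, rfl,
      congrArg (· + vs₁) (inner_un_shapesRO ![u, v, a, b]).symm⟩

/-- Along a path every intermediate node ends one hyperedge and starts the next. For a bracket, the
end of the inside counts as a start and its beginning as an end, which closes up the inner path and
makes the balance the same. A mode lies at the node between its arguments; the two inner nodes of a
bracket carry none, hence only an inequality. -/
theorem rep_shapesRO_bind (h : (σ₀).Rep G Q es vs [u, v]) :
    es.bind (fun e => outs (G.att e)) = vs + {u} ∧ es.bind (fun e => ins (G.att e)) = vs + {v} ∧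
      es.bind (fun e => mids (G.att e)) ≤ vs := by
  induction Q generalizing es vs u v with
  | form A =>
    obtain ⟨e, h1, h2, rfl, rfl⟩ := h
    simp [h2, outs, ins, mids]
  | pair _ S T ihS ihT =>
    obtain ⟨m, h⟩ := Shapes.rep_iff_top.1 h
    obtain ⟨_, y, _, es₁, vs₁, es₂, vs₂, h4, h5, h2, h3, h6, rfl, rfl⟩ := repTop_shapesRO_pair.1 h
    cases h6
    obtain ⟨a1, a2, a3⟩ := ihS h2
    obtain ⟨b1, b2, b3⟩ := ihT h3
    simp only [Multiset.add_bind, Multiset.singleton_bind, h5, a1, a2, b1, b2]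
    refine ⟨?_, ?_, ?_⟩
    · simp only [outs]
      abel
    · simp only [ins]
      abel
    · exact add_le_add (add_le_add le_rfl a3) b3
  | brac j S ihS =>
    obtain ⟨m, h⟩ := Shapes.rep_iff_top.1 h
    obtain ⟨_, _, a, b, es₁, vs₁, h4, h5, h2, h6, rfl, rfl⟩ := repTop_shapesRO_brac.1 h
    cases h6
    obtain ⟨a1, a2, a3⟩ := ihS h2
    simp only [Multiset.add_bind, Multiset.singleton_bind, h5, a1, a2]
    refine ⟨?_, ?_, ?_⟩
    · simp only [outs, Multiset.insert_eq_cons, ← Multiset.singleton_add]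
      abel
    · simp only [ins, Multiset.insert_eq_cons, ← Multiset.singleton_add]
      abel
    · exact add_le_add (Multiset.zero_le _) a3

/-- The two external nodes are distinct and not inner, so none of the three multisets of nodes has a
repetition. -/
theorem fullRep_shapesRO_threaded (h : (σ₀).FullRep G Q) : Threaded G := by
  obtain ⟨u, v, huv⟩ := List.length_eq_two.1 h.length
  have h1 := h.2
  have h2 := G.nodup_inner_add_ext h.1
  rw [huv] at h1 h2
  obtain ⟨a1, a2, a3⟩ := rep_shapesRO_bind h1
  have h3 : G.inner + ([u, v] : List G.V) = G.inner + {u} + {v} := by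
    rw [add_assoc]
    rfl
  rw [h3] at h2
  have h4 := (Multiset.nodup_add.1 h2).1
  have h5 : (G.inner + {v}).Nodup := by
    rw [add_right_comm] at h2
    exact (Multiset.nodup_add.1 h2).1
  exact ⟨fun e e' w => Multiset.eq_of_nodup_bind (a1 ▸ h4) (G.mem_edges e) (G.mem_edges e'),
    fun e e' w => Multiset.eq_of_nodup_bind (a2 ▸ h5) (G.mem_edges e) (G.mem_edges e'),
    fun e e' w => Multiset.eq_of_nodup_bind (Multiset.nodup_of_le a3 G.nodup_inner)
      (G.mem_edges e) (G.mem_edges e')⟩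

/-- The first hyperedge of a path. -/
theorem exists_first_shapesRO (h : (σ₀).Rep G T es vs [w, z]) :
    ∃ b u Q₀ es₀ vs₀, (σ₀).RepTop G Q₀ b es₀ vs₀ [w, u] ∧ w ∈ outs (G.att b) ∧ u ∈ ins (G.att b) ∧
      ((T = Q₀ ∧ es = es₀ ∧ vs = vs₀ ∧ z = u) ∨
        ∃ m Q' es' vs', G.lab m = .prim o ∧ G.att m = [u] ∧ (σ₀).Rep G Q' es' vs' [u, z] ∧
          es = {m} + es₀ + es' ∧ vs = {u} + vs₀ + vs' ∧
          (σ₀).StructEq ∅ Set.univ T (.pair () Q₀ Q')) := by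
  induction T generalizing es vs w z with
  | form A =>
    obtain ⟨b, hb⟩ := Shapes.rep_iff_top.1 h
    exact ⟨b, z, _, _, _, hb, by simp [hb.2.1, outs], by simp [hb.2.1, ins],
      .inl ⟨rfl, rfl, rfl, rfl⟩⟩
  | pair _ S T ihS ihT =>
    obtain ⟨m, h⟩ := Shapes.rep_iff_top.1 h
    obtain ⟨_, y, _, es₁, vs₁, es₂, vs₂, h4, h5, h2, h3, h6, rfl, rfl⟩ := repTop_shapesRO_pair.1 h
    cases h6
    obtain ⟨b, u, Q₀, es₀, vs₀, h7, h8, h9, ⟨rfl, rfl, rfl, rfl⟩ |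
      ⟨m', Q', es', vs', h10, h11, h12, rfl, rfl, h13⟩⟩ := ihS h2
    · exact ⟨b, y, _, _, _, h7, h8, h9, .inr ⟨m, T, es₂, vs₂, h4, h5, h3, rfl, rfl, .refl _⟩⟩
    · refine ⟨b, u, Q₀, es₀, vs₀, h7, h8, h9, .inr ⟨m', .pair () Q' T, {m} + es' + es₂,
        {y} + vs' + vs₂, h10, h11, (repTop_shapesRO_pair.2 ⟨u, y, z, es', vs', es₂, vs₂, h4, h5,
          h12,
        h3, rfl, rfl, rfl⟩).rep, by abel, by abel, ?_⟩⟩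
      exact .trans (.pair h13 (.refl _)) (.symm (.assoc (Set.mem_univ _) _ _ _))
  | brac j S ih =>
    obtain ⟨b, hb⟩ := Shapes.rep_iff_top.1 h
    obtain ⟨_, _, a, b', es₁, vs₁, h4, h5, h2, h6, rfl, rfl⟩ := repTop_shapesRO_brac.1 hb
    cases h6
    exact ⟨b, z, _, _, _, hb, by simp [h5, outs], by simp [h5, ins],
      .inl ⟨rfl, rfl, rfl, rfl⟩⟩

/-- The last hyperedge of a path. -/
theorem exists_last_shapesRO (h : (σ₀).Rep G T es vs [w, z]) :
    ∃ b u Q₀ es₀ vs₀, (σ₀).RepTop G Q₀ b es₀ vs₀ [u, z] ∧ u ∈ outs (G.att b) ∧ z ∈ ins (G.att b) ∧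
      ((es = es₀ ∧ vs = vs₀ ∧ w = u) ∨
        ∃ m Q' es' vs', G.lab m = .prim o ∧ G.att m = [u] ∧ (σ₀).Rep G Q' es' vs' [w, u] ∧
          es = {m} + es' + es₀ ∧ vs = {u} + vs' + vs₀) := by
  induction T generalizing es vs w z with
  | form A =>
    obtain ⟨b, hb⟩ := Shapes.rep_iff_top.1 h
    exact ⟨b, w, _, _, _, hb, by simp [hb.2.1, outs], by simp [hb.2.1, ins],
      .inl ⟨rfl, rfl, rfl⟩⟩
  | pair _ S T ihS ihT =>
    obtain ⟨m, h⟩ := Shapes.rep_iff_top.1 h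
    obtain ⟨_, y, _, es₁, vs₁, es₂, vs₂, h4, h5, h2, h3, h6, rfl, rfl⟩ := repTop_shapesRO_pair.1 h
    cases h6
    obtain ⟨b, u, Q₀, es₀, vs₀, h7, h8, h9, ⟨rfl, rfl, rfl⟩ |
      ⟨m', Q', es', vs', h10, h11, h12, rfl, rfl⟩⟩ := ihT h3
    · exact ⟨b, y, _, _, _, h7, h8, h9, .inr ⟨m, S, es₁, vs₁, h4, h5, h2, rfl, rfl⟩⟩
    · exact ⟨b, u, Q₀, es₀, vs₀, h7, h8, h9, .inr ⟨m', .pair () S Q', {m} + es₁ + es',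
        {y} + vs₁ + vs', h10, h11, (repTop_shapesRO_pair.2 ⟨w, y, u, es₁, vs₁, es', vs', h4, h5, h2,
        h12, rfl, rfl, rfl⟩).rep, by abel, by abel⟩⟩
  | brac j S ih =>
    obtain ⟨b, hb⟩ := Shapes.rep_iff_top.1 h
    obtain ⟨_, _, a, b', es₁, vs₁, h4, h5, h2, h6, rfl, rfl⟩ := repTop_shapesRO_brac.1 hb
    cases h6
    exact ⟨b, w, _, _, _, hb, by simp [h5, outs], by simp [h5, ins],
      .inl ⟨rfl, rfl, rfl⟩⟩

/-- A path does not return to its first hyperedge. -/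
theorem not_rep_shapesRO_loop (hG : Threaded G) {b : G.E} {Q₀ : Struct {p : Pr // rk p = 2} Unit J}
    {es₀ : Multiset G.E} {vs₀ : Multiset G.V} (h : (σ₀).RepTop G Q₀ b es₀ vs₀ x)
    (hb : u ∈ ins (G.att b)) (h' : (σ₀).Rep G Q es vs [v, u]) (hes : ({m} + es₀ + es).Nodup) :
    False := by
  obtain ⟨b', _, Q₁, es₁, vs₁, h1, -, h3, h4⟩ := exists_last_shapesRO h'
  obtain rfl := hG.ins _ _ _ hb h3
  refine Multiset.disjoint_left.1 (Multiset.nodup_add.1 hes).2.2 (Multiset.mem_add.2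
    (.inr h.mem)) ?_
  rcases h4 with ⟨rfl, -⟩ | ⟨_, _, _, _, _, _, _, rfl, -⟩
  exacts [h1.mem, Multiset.mem_add.2 (.inr h1.mem)]

/-- Both paths are followed from `u`. Only one hyperedge starts there, so the first items agree; if
the item is a bracket, its inside is a path with fewer hyperedges and is compared by induction. The
remaining paths start at the same node, and reassociation to the right is a structural equivalence.
-/
theorem structEq_shapesRO (hinj : Function.Injective modality) (hG : Threaded G)
    (h : (σ₀).Rep G Q es vs [u, v]) (h' : (σ₀).Rep G Q' es' vs' [u, v])
    (hes : es.Nodup) (hes' : es'.Nodup) : (σ₀).StructEq ∅ Set.univ Q Q' := by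
  have hσ := regular_shapesRO o ho hJ hinj
  induction hn : es.card using Nat.strong_induction_on generalizing Q Q' es vs es' vs' u v with
  | _ n ih =>
  subst hn
  obtain ⟨b, w, Q₀, es₀, vs₀, h1, h2, h3, h4⟩ := exists_first_shapesRO h
  obtain ⟨b', w', Q₀', es₀', vs₀', h1', h2', h3', h4'⟩ := exists_first_shapesRO h'
  obtain rfl := hG.outs _ _ _ h2 h2'
  have hle : es₀ ≤ es := by
    rcases h4 with ⟨-, rfl, -⟩ | ⟨m, _, es₁, _, _, _, _, rfl, -⟩
    exacts [le_rfl, (Multiset.le_add_left _ _).trans (Multiset.le_add_right _ _)]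
  have hle' : es₀' ≤ es' := by
    rcases h4' with ⟨-, rfl, -⟩ | ⟨m, _, es₁, _, _, _, _, rfl, -⟩
    exacts [le_rfl, (Multiset.le_add_left _ _).trans (Multiset.le_add_right _ _)]
  obtain ⟨rfl, h5⟩ : w = w' ∧ (σ₀).StructEq ∅ Set.univ Q₀ Q₀' := by
    cases Q₀ with
    | form A =>
      obtain ⟨B, rfl⟩ := h1'.eq_form hσ h1.1
      have := h1.2.1.symm.trans h1'.2.1
      exact ⟨by simpa using this, .form (h1.1.symm.trans h1'.1)⟩
    -- The first item is never a pair, because a mode hyperedge has rank one and starts nowhere.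
    | pair _ S T =>
      obtain ⟨_, y, _, _, _, _, _, _, h6, _⟩ := repTop_shapesRO_pair.1 h1
      simp [h6, outs] at h2
    | brac j S =>
      obtain ⟨_, _, c, d, es₁, vs₁, h6, h7, h8, h9, rfl, rfl⟩ := repTop_shapesRO_brac.1 h1
      obtain ⟨S', rfl⟩ := h1'.eq_brac hσ h6
      obtain ⟨_, _, c', d', es₁', vs₁', h6', h7', h8', h9', rfl, rfl⟩ :=
        repTop_shapesRO_brac.1 h1'
      cases h9
      cases h9'
      rw [h7] at h7'
      cases h7'
      refine ⟨rfl, .brac (ih es₁.card ?_ h8 h8' ?_ ?_ rfl)⟩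
      · have := Multiset.card_le_card hle
        simp at this
        omega
      · exact Multiset.nodup_of_le ((Multiset.le_add_left _ _).trans hle) hes
      · exact Multiset.nodup_of_le ((Multiset.le_add_left _ _).trans hle') hes'
  rcases h4 with ⟨rfl, rfl, rfl, rfl⟩ | ⟨m, Q₁, es₁, vs₁, h6, h7, h8, rfl, rfl, h9⟩
  -- If one path stops here and the other goes on, the latter must come back to the node where its
  -- first hyperedge ends.
  · rcases h4' with ⟨rfl, rfl, rfl, h10⟩ | ⟨m', Q₁', es₁', vs₁', h6', h7', h8', rfl, rfl, h9'⟩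
    · exact h5
    · exact (not_rep_shapesRO_loop hG h1' h3' h8' hes').elim
  · rcases h4' with ⟨rfl, rfl, rfl, rfl⟩ | ⟨m', Q₁', es₁', vs₁', h6', h7', h8', rfl, rfl, h9'⟩
    · exact (not_rep_shapesRO_loop hG h1 h3 h8 hes).elim
    · refine .trans h9 (.trans (.pair h5 (ih es₁.card ?_ h8 h8' ?_ ?_ rfl)) h9'.symm)
      · simp
      · exact (Multiset.nodup_add.1 hes).2.1
      · exact (Multiset.nodup_add.1 hes').2.1

/-- Removing the last formula of a path leaves a context that does not see the old end `z`. The new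
end `y` is therefore free, and it will be chosen so that this context can be composed with another
one. -/
theorem exists_last_ctx_shapesRO (hσ : (σ₀).Regular ∅) (hG : Threaded G) {a : G.E}
    {X : Form {p : Pr // rk p = 2} Unit J} (h : (σ₀).Rep G S es vs [w, z])
    (hX : G.lab a = ((σ₀).mu X).1) (ha : G.att a = [u, z]) :
    ∃ D es', es = es' + {a} ∧ ∀ y, (σ₀).RepCtx G D es' vs [w, y] [u, y] := by
  obtain ⟨b, u', Q₀, es₀, vs₀, h1, h2, h3, h4⟩ := exists_last_shapesRO h
  obtain rfl := hG.ins b a z h3 (by simp [ha, ins])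
  obtain ⟨rfl, rfl⟩ := h1.form hσ hX
  obtain rfl : u' = u := by simpa [ha, outs] using h2
  rcases h4 with ⟨rfl, rfl, rfl⟩ | ⟨m, Q', es', vs', h6, h7, h8, rfl, rfl⟩
  · exact ⟨.here, 0, by simp, fun y => ⟨rfl, rfl, rfl⟩⟩
  · exact ⟨.pairR () Q' .here, {m} + es', rfl, fun y => ⟨m, ![w, u', y], es', vs', 0, 0,
      places_mkShape.2 ⟨h6, h7⟩, h8, ⟨rfl, rfl, rfl⟩, rfl, by simp,
      congrArg (· + vs' + 0) (inner_bin_shapesRO ![w, u', y]).symm⟩⟩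

theorem exists_first_ctx_shapesRO (hσ : (σ₀).Regular ∅) (hG : Threaded G) {a : G.E}
    {X : Form {p : Pr // rk p = 2} Unit J} (h : (σ₀).Rep G S es vs [w, z])
    (hX : G.lab a = ((σ₀).mu X).1) (ha : G.att a = [w, u]) :
    ∃ D es', es = es' + {a} ∧ ∀ y, (σ₀).RepCtx G D es' vs [y, z] [y, u] := by
  obtain ⟨b, u', Q₀, es₀, vs₀, h1, h2, h3, h4⟩ := exists_first_shapesRO h
  obtain rfl := hG.outs b a w h2 (by simp [ha, outs])
  obtain ⟨rfl, rfl⟩ := h1.form hσ hX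
  obtain rfl : u' = u := by simpa [ha, ins] using h3
  rcases h4 with ⟨rfl, rfl, rfl, rfl⟩ | ⟨m, Q', es', vs', h6, h7, h8, rfl, rfl, -⟩
  · exact ⟨.here, 0, by simp, fun y => ⟨rfl, rfl, rfl⟩⟩
  · exact ⟨.pairL () .here Q', {m} + es', add_right_comm _ _ _, fun y => ⟨m, ![y, u', z], 0, 0, es',
      vs', places_mkShape.2 ⟨h6, h7⟩, ⟨rfl, rfl, rfl⟩, h8, rfl, by simp,
      congrArg (· + 0 + vs') (inner_bin_shapesRO ![y, u', z]).symm⟩⟩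

variable (o ho hJ) in
theorem decomposable_shapesRO (hinj : Function.Injective modality) :
    (shapesRO o ho modality hJ).Decomposable ∅ Set.univ where
  assoc _ _ G S T U es vs x := by
    constructor
    · intro h
      obtain ⟨m, h⟩ := Shapes.rep_iff_top.1 h
      obtain ⟨u, y, v, es₁, vs₁, es₂, vs₂, h4, h5, h2, h3, rfl, rfl, rfl⟩ :=
        repTop_shapesRO_pair.1 h
      obtain ⟨m', h3⟩ := Shapes.rep_iff_top.1 h3
      obtain ⟨_, y', _, es₃, vs₃, es₄, vs₄, h4', h5', h2', h3', h6, rfl, rfl⟩ :=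
        repTop_shapesRO_pair.1 h3
      cases h6
      exact (repTop_shapesRO_pair.2 ⟨u, y', v, _, _, es₄, vs₄, h4', h5', (repTop_shapesRO_pair.2
        ⟨u, y, y', es₁, vs₁, es₃, vs₃, h4, h5, h2, h2', rfl, rfl, rfl⟩).rep, h3', rfl, by abel,
        by abel⟩).rep
    · intro h
      obtain ⟨m, h⟩ := Shapes.rep_iff_top.1 h
      obtain ⟨u, y, v, es₁, vs₁, es₂, vs₂, h4, h5, h2, h3, rfl, rfl, rfl⟩ :=
        repTop_shapesRO_pair.1 h
      obtain ⟨m', h2⟩ := Shapes.rep_iff_top.1 h2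
      obtain ⟨_, y', _, es₃, vs₃, es₄, vs₄, h4', h5', h2', h3', h6, rfl, rfl⟩ :=
        repTop_shapesRO_pair.1 h2
      cases h6
      exact (repTop_shapesRO_pair.2 ⟨u, y', v, es₃, vs₃, _, _, h4', h5', h2',
        (repTop_shapesRO_pair.2 ⟨y', y, v, es₄, vs₄, es₂, vs₂, h4, h5, h3', h3, rfl, rfl,
        rfl⟩).rep, rfl, by abel, by abel⟩).rep
  unique G Q Q' h h' := by
    obtain ⟨u, v, huv⟩ := List.length_eq_two.1 h.length
    have h1 := h.2
    have h1' := h'.2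
    rw [huv] at h1 h1'
    exact structEq_shapesRO hinj (fullRep_shapesRO_threaded h) h1 h1' G.edges_full.1 G.edges_full.1
  prod G Q _ η m a b X Y h hm hX ha hY hb hab := by
    have hσ := regular_shapesRO o ho hJ hinj
    have hG := fullRep_shapesRO_threaded h
    obtain ⟨hm1, hm2⟩ := places_mkShape.1 hm
    obtain ⟨D, Q', es₁, vs₁, es₂, vs₂, y, rfl, h1, h2, h3, h4⟩ := h.2.locate (G.mem_edges m)
    obtain ⟨S, T, rfl⟩ := h2.eq_pair hσ (i := ()) hm1
    obtain ⟨_, _, _, es₃, vs₃, es₄, vs₄, h5, h6, h7, h8, rfl, rfl, rfl⟩ :=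
      repTop_shapesRO_pair.1 h2
    rw [hm2] at h6
    cases h6
    obtain ⟨DL, el, rfl, hl⟩ := exists_last_ctx_shapesRO hσ hG h7 hX ha
    obtain ⟨DR, er, rfl, hr⟩ := exists_first_ctx_shapesRO hσ hG h8 hY hb
    -- This is associativity: `a` is the last item on the left and `b` the first on the right. With
    -- the free ends chosen to be the ends of the two outer pieces, the remainders compose to a
    -- context whose hole runs from the start of `a` to the end of `b`.
    refine ⟨_, _, _, Shapes.repCtx_comp h1 (Shapes.repCtx_comp (hl _) (hr _)), h3.trans ?_,
      h4.trans ?_⟩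
    · simp only [Multiset.insert_eq_cons, ← Multiset.singleton_add]
      abel
    · refine Eq.trans ?_ (congrArg (vs₁ + (vs₃ + vs₄) + ·) (inner_bin_shapesRO η).symm)
      abel
  underSlot G Q _ η m a Y h hm hx hY ha := by
    have hσ := regular_shapesRO o ho hJ hinj
    have hG := fullRep_shapesRO_threaded h
    obtain ⟨hm1, hm2⟩ := places_mkShape.1 hm
    have h1 := h.2
    rw [hx] at h1
    obtain ⟨b, u, Q₀, es₀, vs₀, h2, h3, h4, h5⟩ := exists_first_shapesRO h1
    obtain rfl := hG.outs b a _ h3 (by rw [ha]; exact Multiset.mem_singleton_self _)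
    obtain ⟨rfl, rfl⟩ := h2.form hσ hY
    -- The path starts with `a`. It cannot stop there, since the mode `m` is also present; and the
    -- mode at the end of `a` is `m`, because a node carries at most one mode.
    rcases h5 with ⟨rfl, h6, -⟩ | ⟨m', Q', es', vs', h6, h7, h8, h9, h10, -⟩
    · have := h6 ▸ G.mem_edges m
      rw [Multiset.mem_singleton.1 this] at hm1
      exact absurd (hm1.symm.trans hY) (hσ.prim_mode_ne () Y)
    · rw [ha] at h4
      obtain rfl : u = _ := Multiset.mem_singleton.1 h4
      obtain rfl : m' = m := hG.mids _ _ _ (by rw [h7]; exact Multiset.mem_singleton_self _)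
        (by rw [hm2]; exact Multiset.mem_singleton_self _)
      refine ⟨Q', es', vs', h8, h9, h10.trans ?_⟩
      rw [add_zero]
      exact congrArg (· + vs') (inner_bin_shapesRO η).symm
  overSlot G Q _ η m a Y h hm hx hY ha := by
    have hσ := regular_shapesRO o ho hJ hinj
    have hG := fullRep_shapesRO_threaded h
    obtain ⟨hm1, hm2⟩ := places_mkShape.1 hm
    have h1 := h.2
    rw [hx] at h1
    obtain ⟨b, u, Q₀, es₀, vs₀, h2, h3, h4, h5⟩ := exists_last_shapesRO h1
    obtain rfl := hG.ins b a _ h4 (by rw [ha]; exact Multiset.mem_singleton_self _)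
    obtain ⟨rfl, rfl⟩ := h2.form hσ hY
    rcases h5 with ⟨h6, -⟩ | ⟨m', Q', es', vs', h6, h7, h8, h9, h10⟩
    · have := h6 ▸ G.mem_edges m
      rw [Multiset.mem_singleton.1 this] at hm1
      exact absurd (hm1.symm.trans hY) (hσ.prim_mode_ne () Y)
    · rw [ha] at h3
      obtain rfl : u = _ := Multiset.mem_singleton.1 h3
      obtain rfl : m' = m := hG.mids _ _ _ (by rw [h7]; exact Multiset.mem_singleton_self _)
        (by rw [hm2]; exact Multiset.mem_singleton_self _)
      refine ⟨Q', es', vs', h8, h9.trans (add_right_comm _ _ _), h10.trans ?_⟩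
      rw [add_zero]
      exact congrArg (· + vs') (inner_bin_shapesRO η).symm
  dia G Q j η m a X h hm hX ha := by
    have hσ := regular_shapesRO o ho hJ hinj
    have hG := fullRep_shapesRO_threaded h
    obtain ⟨hm1, hm2⟩ := places_mkShape.1 hm
    obtain ⟨D, Q', es₁, vs₁, es₂, vs₂, y, rfl, h1, h2, h3, h4⟩ := h.2.locate (G.mem_edges m)
    obtain ⟨S, rfl⟩ := h2.eq_brac hσ hm1
    obtain ⟨_, _, _, _, es₃, vs₃, h5, h6, h7, rfl, rfl, rfl⟩ := repTop_shapesRO_brac.1 h2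
    rw [hm2] at h6
    cases h6
    obtain ⟨b, u, Q₀, es₀, vs₀, h8, h9, h10, h11⟩ := exists_first_shapesRO h7
    obtain rfl := hG.outs b a _ h9 (by rw [ha]; exact Multiset.mem_singleton_self _)
    have h12 := h8.form hσ hX
    -- The inside of the bracket starts with `a`, which already ends where the inside ends. Going on
    -- would make a loop.
    rcases h11 with ⟨rfl, rfl, rfl, rfl⟩ | ⟨m', Q', es', vs', h13, h14, h15, rfl, rfl, -⟩
    · obtain ⟨rfl, rfl⟩ := h12
      refine ⟨D, es₁, vs₁, h1, h3.trans (by rfl), h4.trans ?_⟩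
      rw [add_zero]
      exact congrArg (vs₁ + ·) (inner_un_shapesRO η).symm
    · rw [ha] at h10
      obtain rfl : u = _ := Multiset.mem_singleton.1 h10
      refine (not_rep_shapesRO_loop hG h8 ?_ h15 (m := m') ?_).elim
      · rw [ha]
        exact Multiset.mem_singleton_self _
      · have := G.edges_full.1
        rw [h3] at this
        exact (Multiset.nodup_add.1 (Multiset.nodup_add.1 this).2.1).2.1
  box G Q j η m h hm hx := by
    have hσ := regular_shapesRO o ho hJ hinj
    have hG := fullRep_shapesRO_threaded h
    obtain ⟨hm1, hm2⟩ := places_mkShape.1 hm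
    have h1 := h.2
    rw [hx] at h1
    obtain ⟨b, u, Q₀, es₀, vs₀, h2, h3, h4, h5⟩ := exists_first_shapesRO h1
    have hout : η (0 : Fin 4) ∈ outs (G.att m) := by
      rw [hm2]
      exact Multiset.mem_cons_self (η (0 : Fin 4)) {η (3 : Fin 4)}
    obtain rfl := hG.outs b m _ h3 hout
    obtain ⟨S, rfl⟩ := h2.eq_brac hσ hm1
    obtain ⟨_, _, _, _, es₃, vs₃, h6, h7, h8, h9, rfl, rfl⟩ := repTop_shapesRO_brac.1 h2
    rw [hm2] at h7
    cases h7
    cases h9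
    -- The bracket `m` already leads from one external node to the other, so it is the whole path.
    rcases h5 with ⟨rfl, h10, h11, -⟩ | ⟨m', Q', es', vs', h10, h11, h12, h13, h14, -⟩
    · exact ⟨S, es₃, vs₃, h8, h10, h11.trans (congrArg (· + vs₃) (inner_un_shapesRO η).symm)⟩
    · exact (not_rep_shapesRO_loop hG h2 h4 h12 (m := m') (h13 ▸ G.edges_full.1)).elim

end RO

theorem shapesL_eq (o : Pr) (ho : rk o = 1) :
    shapesL o ho = shapesRO o ho Empty.elim fun j => j.elim := by
  unfold shapesL shapesRO
  congr 1
  funext j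
  exact j.elim

end
end HL

/-! ### The five calculi -/

theorem mainTheorem4 {Pr : Type u} (rk : Pr → ℕ) (hPr : ∀ k : ℕ, {p : Pr | rk p = k}.Infinite) :
    -- the Lambek calculus with brackets: one associative mode, one modality
    (∀ (o j : Pr) (ho : rk o = 1) (hj : rk j = 4),
      (HL.shapesBrackets o j ho hj).Embeds ∅ Set.univ) ∧
    -- the non-associative Lambek calculus `NL`
    (∀ (i : Pr) (hi : rk i = 3), (HL.shapesNL i hi).Embeds ∅ ∅) ∧
    -- the non-associative Lambek calculus with permutation `NLP`
    (∀ (c : Pr) (hc : rk c = 2), (HL.shapesNLP c hc).Embeds Set.univ ∅) ∧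
    -- the Lambek calculus `L`
    (∀ (o : Pr) (ho : rk o = 1), (HL.shapesL o ho).Embeds ∅ Set.univ) ∧
    -- the Lambek calculus with permutation `LP`
    (∀ (o : Pr) (ho : rk o = 2), (HL.shapesLP o ho).Embeds Set.univ Set.univ) := by
  refine ⟨fun o j ho hj => ?_, fun i hi => ?_, fun c hc => ?_, fun o ho => ?_, fun o ho => ?_⟩
  -- `shapesBrackets` unfolds to `shapesRO` with a single modality, so the general statements apply
  -- directly.
  · have hinj : Function.Injective fun _ : Unit => j := fun _ _ _ => rfl
    exact HL.Shapes.embeds_of_decomposable (HL.regular_shapesRO o ho (fun _ => hj) hinj)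
      (HL.decomposable_shapesRO o ho (fun _ => hj) hinj)
  · exact HL.Shapes.embeds_of_decomposable (HL.regular_shapesNL i hi)
      (HL.decomposable_shapesNL i hi)
  · exact HL.Shapes.embeds_of_decomposable (HL.regular_shapesNLP c hc)
      (HL.decomposable_shapesNLP c hc)
  · have hinj : Function.Injective (Empty.elim : Empty → Pr) := fun j => j.elim
    rw [HL.shapesL_eq]
    exact HL.Shapes.embeds_of_decomposable (HL.regular_shapesRO o ho _ hinj)
      (HL.decomposable_shapesRO o ho _ hinj)
  · exact HL.Shapes.embeds_of_decomposable (HL.regular_shapesLP o ho)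
      (HL.decomposable_shapesLP o ho)
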